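/- Let $N,n\ge 1$ and $m\ge 0$ be integers, let $\Omega\subset\mathbb R^N$ be open, and let $F\in C^0\big(\mathbb R^{m\times N^n}\times\mathbb R^{m\times N^{n-1}}\times\cdots\times\mathbb R^{m\times N}\times\mathbb R^m\times\mathbb R^N,\mathbb R\big)$ satisfy $F\ge 0$. Assume that there are $p\in[1,\infty)$ and $g\in C^0(\mathbb R^N,(0,+\infty))$ such that $$\frac1{g(x)}|A|^p\le F(A,a_1,\dots,a_{n-1},b,x)\le g(x)\Big(|A|^p+\sum_{j=1}^{n-1}|a_j|^p+|b|^p+1\Big)\qquad\text{for all }(A,a_1,\dots,a_{n-1},b,x)$$ (norms on the tensor spaces; since $g$ is arbitrary, it does not matter which), and that for every $x_0\in\Omega$ and every $\tau>0$ there is $\alpha>0$ such that $$F(a_1,\dots,a_n,b,x)-F(a_1,\dots,a_n,b,x_0)\ge-\tau F(a_1,\dots,a_n,b,x_0)$$ for all $a_1\in\mathbb R^{m\times N^n},\dots,a_n\in\mathbb R^{m\times N}$, $b\in\mathbb R^m$ and all $x\in\mathbb R^N$ with $|x-x_0|<\alpha$. Let $\varphi\in L^p(\Omega,\mathbb R^m)$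 with $F(0,\dots,0,\varphi(x),x)=0$ for a.e. $x\in\Omega$. Let $D\subset\Omega$ be a Borel set that is $\sigma$-finite with respect to the Hausdorff measure $\mathcal H^{N-1}$, and let $\varphi^+,\varphi^-:D\to\mathbb R^m$ and $\vec n:D\to S^{N-1}$ be Borel maps such that for every $x\in D$ $$\lim_{\rho\to0^+}\frac{\int_{B^+_\rho(x,\vec n(x))}|\varphi(y)-\varphi^+(x)|^p\,dy}{\mathcal L^N(B_\rho(x))}=0,\qquad \lim_{\rho\to0^+}\frac{\int_{B^-_\rho(x,\vec n(x))}|\varphi(y)-\varphi^-(x)|^p\,dy}{\mathcal L^N(B_\rho(x))}=0,$$ where $B^\pm_\rho(x,\vec\nu)=\{y:|y-x|<\rho,\ \pm(y-x)\cdot\vec\nu>0\}$. Then for every family $\{\varphi_\varepsilon\}_{\varepsilon>0}\subset W^{n,p}_{loc}(\Omega,\mathbb R^m)$ with $\varphi_\varepsilon\to\varphi$ in $L^p_{loc}(\Omega,\mathbb R^m)$ as $\varepsilon\to0^+$, $$\liminf_{\varepsilon\to0^+}\frac1\varepsilon\int_\Omega F\big(\varepsilon^n\nabla^n\varphi_\varepsilon,\varepsilon^{n-1}\nabla^{n-1}\varphi_\varepsilon,\dots,\varepsilon\nabla\varphi_\varepsilon,\varphi_\varepsilon,x\big)\,dx\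 \ge\ \int_D\bar E^{(n)}_{per}\big(\varphi^+(x),\varphi^-(x),\vec n(x),x\big)\,d\mathcal H^{N-1}(x)$$ (both sides in $[0,+\infty]$). Here, for $a^\pm\in\mathbb R^m$, a unit vector $\vec n$ and any orthonormal basis $\vec\nu_1=\vec n,\vec\nu_2,\dots,\vec\nu_N$ of $\mathbb R^N$, with $I_{\vec n}=\{y:|y\cdot\vec\nu_j|<1/2,\ j=1,\dots,N\}$, $$\bar E^{(n)}_{per}(a^+,a^-,\vec n,x)=\inf\Big\{\int_{I_{\vec n}}\frac1L F\big(L^n\nabla^n\zeta(y),\dots,L\nabla\zeta(y),\zeta(y),x\big)\,dy:\ L>0,\ \zeta\in\mathcal S^{(n)}(a^+,a^-,I_{\vec n})\Big\},$$ and $\mathcal S^{(n)}(a^+,a^-,I_{\vec n})$ is the set of $\zeta\in C^n(\mathbb R^N,\mathbb R^m)$ with $\zeta(y)=a^-$ if $y\cdot\vec n\le-1/2$, $\zeta(y)=a^+$ if $y\cdot\vec n\ge1/2$, and $\zeta(y+\vec\nu_j)=\zeta(y)$ for all $y$ and all $j=2,\dots,N$. The inequality holds for every choice, at each $x\in D$,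 of the orthonormal basis used in $\bar E^{(n)}_{per}(\cdot,\cdot,\vec n(x),x)$. -/

import Mathlib

open MeasureTheory Set Filter Topology
open scoped ENNReal ContDiff

noncomputable section

namespace SingularPerturbation

/-- `ℝ^d` with its Euclidean norm. -/
abbrev Vec (d : ℕ) : Type := EuclideanSpace ℝ (Fin d)

/-- `ℝ^{m × N^j}`, the space of values of the `j`-th gradient of a map `ℝ^N → ℝ^m`, realised as
the `j`-linear maps `(ℝ^N)^j → ℝ^m`. It carries the operator norm, which is equivalent to the
Euclidean norm of the array of entries. -/
abbrev Tensor (N m j : ℕ) : Type := Vec N [×j]→L[ℝ] Vec m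

/-- `ℝ^{m × N} × ⋯ × ℝ^{m × N^n}`: the entry with index `j : Fin n` is a tensor of order
`j + 1`, so that the last entry, of index `n - 1`, is the slot of the highest gradient `∇^n`. -/
abbrev Jet (N m n : ℕ) : Type := (j : Fin n) → Tensor N m (j + 1)

/-- The `d`-dimensional Hausdorff measure `𝓗^d` with its usual normalisation `ω_d / 2^d`
(the volume of a Euclidean ball of radius `1/2` in `ℝ^d`), under which it agrees with surface
area; Mathlib's `μH[d]` is built from `∑ (diam)^d` without this factor. -/
def hausdorff {X : Type*} [EMetricSpace X] [MeasurableSpace X] [BorelSpace X] (d : ℕ) :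
    Measure X :=
  volume (Metric.ball (0 : Vec d) (1 / 2)) • (Measure.hausdorffMeasure (d : ℝ) : Measure X)

/-! ### Local Lebesgue and Sobolev spaces -/

/-- `f ∈ L^p_loc(Ω)`. -/
def MemLpLoc {N : ℕ} {W : Type*} [NormedAddCommGroup W] (p : ℝ) (Ω : Set (Vec N))
    (f : Vec N → W) : Prop :=
  ∀ K : Set (Vec N), IsCompact K → K ⊆ Ω → MemLp f (ENNReal.ofReal p) (volume.restrict K)

/-- `φ_ε → φ` in `L^p_loc(Ω)` as `ε → 0⁺`. -/
def TendstoLpLoc {N : ℕ} {W : Type*} [NormedAddCommGroup W] (p : ℝ) (Ω : Set (Vec N))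
    (φe : ℝ → Vec N → W) (φ : Vec N → W) : Prop :=
  ∀ K : Set (Vec N), IsCompact K → K ⊆ Ω →
    Tendsto (fun ε => eLpNorm (fun x => φe ε x - φ x) (ENNReal.ofReal p) (volume.restrict K))
      (𝓝[>] 0) (𝓝 0)

/-- `G` is the weak `j`-th gradient `∇^j f` of `f` in `Ω`: both are locally integrable in `Ω`, and
for all directions `v₁, …, v_j` and every test function `η ∈ C_c^∞(Ω)`,
`∫ η ∂_{v₁} ⋯ ∂_{v_j} f = (-1)^j ∫ (∂_{v₁} ⋯ ∂_{v_j} η) f`. -/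
def HasWeakGrad {N m : ℕ} (Ω : Set (Vec N)) (j : ℕ) (f : Vec N → Vec m)
    (G : Vec N → Tensor N m j) : Prop :=
  LocallyIntegrableOn f Ω ∧ LocallyIntegrableOn G Ω ∧
    ∀ η : Vec N → ℝ, ContDiff ℝ ∞ η → HasCompactSupport η → tsupport η ⊆ Ω →
      ∀ v : Fin j → Vec N,
        ∫ x in Ω, η x • G x v = (-1 : ℝ) ^ j • ∫ x in Ω, iteratedFDeriv ℝ j η x v • f x

/-- `f ∈ W^{n,p}_loc(Ω, ℝ^m)`. -/
def MemSobolevLoc {N m : ℕ} (n : ℕ) (p : ℝ) (Ω : Set (Vec N)) (f : Vec N → Vec m) : Prop :=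
  MemLpLoc p Ω f ∧
    ∀ j : ℕ, 1 ≤ j → j ≤ n →
      ∃ G : Vec N → Tensor N m j, HasWeakGrad Ω j f G ∧ MemLpLoc p Ω G

open Classical in
/-- The weak `j`-th gradient of `f` in `Ω` (unique up to a null set; `0` if there is none). -/
def weakGrad {N m : ℕ} (Ω : Set (Vec N)) (j : ℕ) (f : Vec N → Vec m) : Vec N → Tensor N m j :=
  if h : ∃ G : Vec N → Tensor N m j, HasWeakGrad Ω j f G then h.choose else fun _ => 0

/-! ### The energies -/

/-- The singularly perturbed energy
`(1/ε) ∫_Ω F(ε^n ∇^n f, …, ε ∇f, f, x) dx ∈ [0, ∞]`, with weak gradients. -/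
def energy {N m n : ℕ} (F : Jet N m n → Vec m → Vec N → ℝ) (Ω : Set (Vec N)) (ε : ℝ)
    (f : Vec N → Vec m) : ℝ≥0∞ :=
  ENNReal.ofReal (1 / ε) *
    ∫⁻ x in Ω, ENNReal.ofReal
      (F (fun j => ε ^ ((j : ℕ) + 1) • weakGrad Ω ((j : ℕ) + 1) f x) (f x) x)

/-- The open unit cube `I_ν = {y : |y · ν_j| < 1/2 for all j}` of an orthonormal basis `ν`. -/
def cube {N : ℕ} (ν : OrthonormalBasis (Fin N) ℝ (Vec N)) : Set (Vec N) :=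
  {y | ∀ j : Fin N, |inner ℝ y (ν j)| < 1 / 2}

/-- The class `𝓢^{(n)}(a⁺, a⁻, I_ν)` of profiles: `C^n` maps `ℝ^N → ℝ^m` which equal `a⁻` where
`y · ν_1 ≤ -1/2`, equal `a⁺` where `y · ν_1 ≥ 1/2`, and are `1`-periodic in the directions of all
the other basis vectors. The first basis vector `ν_1` has index `0`. -/
def profiles {N m : ℕ} [NeZero N] (n : ℕ) (aplus aminus : Vec m)
    (ν : OrthonormalBasis (Fin N) ℝ (Vec N)) : Set (Vec N → Vec m) :=
  {ζ | ContDiff ℝ n ζ ∧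
    (∀ y, inner ℝ y (ν 0) ≤ -(1 / 2 : ℝ) → ζ y = aminus) ∧
    (∀ y, (1 / 2 : ℝ) ≤ inner ℝ y (ν 0) → ζ y = aplus) ∧
    ∀ j : Fin N, j ≠ 0 → ∀ y, ζ (y + ν j) = ζ y}

/-- The cell energy `Ē_per^{(n)}(a⁺, a⁻, ν_1, x)`: the infimum over `L > 0` and over profiles `ζ`
of `(1/L) ∫_{I_ν} F(L^n ∇^n ζ(y), …, L ∇ζ(y), ζ(y), x) dy`. The point `x` is frozen. -/
def cellEnergy {N m n : ℕ} [NeZero N] (F : Jet N m n → Vec m → Vec N → ℝ)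
    (aplus aminus : Vec m) (ν : OrthonormalBasis (Fin N) ℝ (Vec N)) (x : Vec N) : ℝ≥0∞ :=
  ⨅ (L : ℝ) (_ : 0 < L) (ζ : Vec N → Vec m) (_ : ζ ∈ profiles n aplus aminus ν),
    ENNReal.ofReal (1 / L) *
      ∫⁻ y in cube ν, ENNReal.ofReal
        (F (fun j => L ^ ((j : ℕ) + 1) • iteratedFDeriv ℝ ((j : ℕ) + 1) ζ y) (ζ y) x)

/-! ### One-sided limits -/

/-- The half ball `B_ρ^+(x, ν)`; `B_ρ^-(x, ν)` is `halfBall x (-ν) ρ`. -/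
def halfBall {N : ℕ} (x ν : Vec N) (ρ : ℝ) : Set (Vec N) :=
  {y | y ∈ Metric.ball x ρ ∧ 0 < inner ℝ (y - x) ν}

/-- `a` is the one-sided `L^p` limit of `f` at `x` from the side to which `ν` points:
`∫_{B_ρ^+(x, ν)} |f(y) - a|^p dy / |B_ρ(x)| → 0` as `ρ → 0⁺`. -/
def HasOneSidedLimit {N m : ℕ} (p : ℝ) (f : Vec N → Vec m) (x ν : Vec N) (a : Vec m) : Prop :=
  Tendsto
    (fun ρ : ℝ => (∫⁻ y in halfBall x ν ρ, ENNReal.ofReal (‖f y - a‖ ^ p)) /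
      volume (Metric.ball x ρ))
    (𝓝[>] 0) (𝓝 0)

end SingularPerturbation

end

/-! Localise the energy: for a set A let e(A) be the liminf, as ε → 0⁺, of (1/ε)∫_A F evaluated on
the rescaled weak jet of φ_ε. This set function is monotone and superadditive on disjoint measurable
sets, and the claim bounds e(Ω) from below by the integral of the cell energy over D. A Vitali
covering argument (`setLIntegral_hausdorff_le_of_density`) reduces it to a density estimate: for x
in D and c below the cell energy at x, all small r satisfy e(closed ball of radius r at x) ≥ c ·
volume of the (N-1)-dimensional ball of radius r (`eventually_mul_volume_ball_le_liminf`). Only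
lower integrals occur, so the bases may vary with x in any way.

For the density estimate, F(·,·,z) is replaced by F(·,·,x) at the price of a factor 1-t. In a small
ball around x the maps φ_ε are L^p-close to a jump across the hyperplane orthogonal to the normal.
Each cube of side tr centred on that hyperplane carries energy at least c(tr)^{N-1}
(`exists_weak_cell_lower_bound`), and averaging over tangential translations of the cube gives the
bound for the disc (`mul_volume_ball_le_of_forall_boxAt`).

The bound on a cube is proved after blowing up by ε, which gives a cube of large side R, and after
mollification (`exists_smooth_energy_approx`), so for smooth W with ∫|W - jump|^p ≤ ηR^N
(`exists_cell_lower_bound`). If the energy were below cR^{N-1}, coercivity would bound ∫|∇^n W|^p by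
a multiple of R^{N-1}. Let χ be a smooth transition between the two values, of width of order one.
Interpolation then bounds all derivatives of W - χ up to order n, in total by a multiple of (ηR +
1)R^{N-1}. Among the order of βR disjoint shells of width 2 near the boundary of the cube, one
carries only a multiple of (η + 1/R)R^{N-1}. Cutting W - χ off in this shell gives a map equal to W
inside and to χ outside, which can be made periodic and so competes in the cell problem
(`exists_gluing`, `mul_cellEnergy_le`). Because F vanishes at (0, a±), the constant in the growth
condition costs only an arbitrarily small τ per unit of volume where χ is constant; on the strip
where χ varies the cost is of order βR^{N-1}. With β, τ, η and 1/R small the competitor would beat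
the cell energy. -/

open scoped NNReal

namespace SingularPerturbation

/-! ### From lower densities to Hausdorff integrals, for superadditive set functions -/

section Covering

variable {N : ℕ} {e : Set (Vec N) → ℝ≥0∞}

theorem sum_le_of_superadditive
    (hadd : ∀ A B, MeasurableSet A → MeasurableSet B → Disjoint A B → e A + e B ≤ e (A ∪ B))
    {ι : Type*} (s : Finset ι) (B : ι → Set (Vec N)) (hB : ∀ i ∈ s, MeasurableSet (B i))
    (hd : (s : Set ι).PairwiseDisjoint B) : ∑ i ∈ s, e (B i) ≤ e (⋃ i ∈ s, B i) := by
  classical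
  induction s using Finset.induction_on with
  | empty => simp
  | insert a s ha ih =>
    rw [Finset.sum_insert ha, Finset.set_biUnion_insert]
    have h1 := ih (fun i hi => hB i (Finset.mem_insert_of_mem hi))
      (hd.subset (by simp))
    refine (add_le_add le_rfl h1).trans (hadd _ _ (hB a (by simp))
      (Finset.measurableSet_biUnion _ fun i hi => hB i (Finset.mem_insert_of_mem hi)) ?_)
    rw [Set.disjoint_iUnion₂_right]
    intro i hi
    exact hd (by simp) (by simp [hi]) (fun h => ha (h ▸ hi))

/-- Disjoint balls on which the density bound holds have total diameter power at most e(U)/c.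
Enlarging all balls of a Vitali subfamily would lose a factor 3^d. Here only a tail of the series is
enlarged, so the loss is at most δ. -/
theorem exists_cover_of_density (hmono : ∀ A B, A ⊆ B → e A ≤ e B)
    (hadd : ∀ A B, MeasurableSet A → MeasurableSet B → Disjoint A B → e A + e B ≤ e (A ∪ B))
    {K U : Set (Vec N)} (hU : IsOpen U) (hKU : K ⊆ U) (d : ℕ) {c : ℝ≥0∞} (hc0 : c ≠ 0)
    (hc : c ≠ ⊤) (heU : e U ≠ ⊤)
    (h : ∀ x ∈ K, ∀ᶠ r : ℝ in 𝓝[>] 0,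
      c * ENNReal.ofReal (2 * r) ^ (d : ℝ) ≤ e (Metric.closedBall x r))
    {δ : ℝ} (hδ : 0 < δ) :
    ∃ (u : Set (Vec N × ℝ)) (t : u → Set (Vec N)), u.Countable ∧
      (∀ i, Metric.ediam (t i) ≤ ENNReal.ofReal (6 * δ)) ∧ K ⊆ ⋃ i, t i ∧
      ∑' i, Metric.ediam (t i) ^ (d : ℝ) ≤ e U / c + ENNReal.ofReal δ := by
  classical
  let t : Set (Vec N × ℝ) := {q | q.1 ∈ K ∧ 0 < q.2 ∧ q.2 ≤ δ ∧ Metric.closedBall q.1 q.2 ⊆ U ∧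
    c * ENNReal.ofReal (2 * q.2) ^ (d : ℝ) ≤ e (Metric.closedBall q.1 q.2)}
  have hfine : ∀ x ∈ K, ∀ V : Set (Vec N), V ∈ 𝓝 x → ∃ r, (x, r) ∈ t ∧ Metric.closedBall x r ⊆ V := by
    intro x hx V hV
    obtain ⟨r0, hr0, hr0V⟩ := Metric.nhds_basis_closedBall.mem_iff.1
      (Filter.inter_mem hV (hU.mem_nhds (hKU hx)))
    have h1 : ∀ᶠ r : ℝ in 𝓝[>] 0, r ∈ Ioc 0 (min r0 δ) :=
      Ioc_mem_nhdsGT (lt_min hr0 hδ)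
    obtain ⟨r, hr, hr2⟩ := ((h x hx).and h1).exists
    have hsub := (Metric.closedBall_subset_closedBall (x := x) (hr2.2.trans (min_le_left _ _))).trans hr0V
    exact ⟨r, ⟨hx, hr2.1, hr2.2.trans (min_le_right _ _), hsub.trans inter_subset_right, hr⟩,
      hsub.trans inter_subset_left⟩
  obtain ⟨u, hut, hdisj, hcov⟩ := Vitali.exists_disjoint_subfamily_covering_enlargement
    (fun q : Vec N × ℝ => Metric.closedBall q.1 q.2) t (fun q => q.2) 2 one_lt_two
    (fun q hq => hq.2.1.le) δ (fun q hq => hq.2.2.1)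
    (fun q hq => ⟨q.1, Metric.mem_closedBall_self hq.2.1.le⟩)
  let a : u → ℝ≥0∞ := fun q => ENNReal.ofReal (2 * q.1.2) ^ (d : ℝ)
  have hapos : ∀ q : u, a q ≠ 0 := by
    intro q
    have := (hut q.2).2.1
    simp only [a, ne_eq, ENNReal.rpow_eq_zero_iff, not_or, not_and_or]
    exact ⟨Or.inl (by simp [this]), Or.inl ENNReal.ofReal_ne_top⟩
  have hsum : ∑' q, a q ≤ e U / c := by
    rw [ENNReal.tsum_eq_iSup_sum]
    refine iSup_le fun s => ?_
    rw [ENNReal.le_div_iff_mul_le (Or.inl hc0) (Or.inl hc), Finset.sum_mul]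
    calc ∑ q ∈ s, a q * c ≤ ∑ q ∈ s, e (Metric.closedBall q.1.1 q.1.2) :=
          Finset.sum_le_sum fun q _ => by rw [mul_comm]; exact (hut q.2).2.2.2.2
      _ ≤ e (⋃ q ∈ s, Metric.closedBall q.1.1 q.1.2) := by
          refine sum_le_of_superadditive hadd s
            (fun q : u => Metric.closedBall q.1.1 q.1.2) (fun q _ => measurableSet_closedBall) ?_
          intro q _ q' _ hne
          exact hdisj q.2 q'.2 (fun h => hne (Subtype.ext h))
      _ ≤ e U := hmono _ _ (iUnion₂_subset fun q _ => (hut q.2).2.2.2.1)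
  have hfin : ∑' q, a q ≠ ⊤ := ne_top_of_le_ne_top (ENNReal.div_ne_top heU hc0) hsum
  have hucount : u.Countable := by
    have := Summable.countable_support_ennreal hfin
    have h2 : Function.support a = univ := by ext q; simp [hapos q]
    rw [h2] at this
    exact countable_univ_iff.1 this
  have htail := ENNReal.tendsto_tsum_compl_atTop_zero hfin
  have hpos : 0 < ENNReal.ofReal δ / 3 ^ (d : ℝ) := by
    refine ENNReal.div_pos (by simpa using hδ) ?_
    exact ENNReal.rpow_ne_top_of_nonneg (by positivity) (by simp)
  -- Outside the finite set s the sum is below δ / 3^d, so enlarging those balls three times costs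
  -- less than δ.
  obtain ⟨s, hs⟩ := (htail.eventually (gt_mem_nhds hpos)).exists
  let T : u → Set (Vec N) := fun q => if q ∈ s then Metric.closedBall q.1.1 q.1.2
    else Metric.closedBall q.1.1 (3 * q.1.2)
  have hdiam : ∀ (x : Vec N) (r : ℝ), 0 ≤ r →
      Metric.ediam (Metric.closedBall x r) ≤ ENNReal.ofReal (2 * r) := by
    intro x r hr
    rw [← Metric.closedEBall_ofReal hr, ENNReal.ofReal_mul (by norm_num)]
    simpa using Metric.ediam_closedEBall_le (x := x) (r := ENNReal.ofReal r)
  refine ⟨u, T, hucount, ?_, ?_, ?_⟩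
  · intro q
    have h1 := (hut q.2).2.1
    have h2 := (hut q.2).2.2.1
    by_cases hq : q ∈ s
    · simp only [T, hq, if_true]
      refine (hdiam _ _ h1.le).trans (ENNReal.ofReal_le_ofReal (by linarith))
    · simp only [T, hq, if_false]
      refine (hdiam _ _ (by linarith)).trans (ENNReal.ofReal_le_ofReal (by linarith))
  · intro y hy
    rw [mem_iUnion]
    by_cases hys : ∃ q ∈ s, y ∈ Metric.closedBall q.1.1 q.1.2
    · obtain ⟨q, hq, hyq⟩ := hys
      exact ⟨q, by simpa only [T, hq, if_true] using hyq⟩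
    have hcl : IsClosed (⋃ q ∈ s, Metric.closedBall q.1.1 q.1.2) :=
      s.finite_toSet.isClosed_biUnion fun q _ => Metric.isClosed_closedBall
    have hyn : y ∉ (⋃ q ∈ s, Metric.closedBall q.1.1 q.1.2) := by
      simpa using hys
    -- A point missed by the finitely many closed balls of s has an admissible ball avoiding them.
    -- The Vitali ball meeting it therefore lies outside s. Only the centre y has to be covered, so
    -- r ≤ 2 r_b gives the factor 1 + 2 = 3.
    obtain ⟨r, hrt, hr⟩ := hfine y hy _ (hcl.isOpen_compl.mem_nhds hyn)
    obtain ⟨b, hbu, ⟨z, hz1, hz2⟩, hrb⟩ := hcov _ hrt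
    have hbs : (⟨b, hbu⟩ : u) ∉ s := by
      intro hb
      exact hr hz1 (mem_iUnion₂.2 ⟨⟨b, hbu⟩, hb, hz2⟩)
    refine ⟨⟨b, hbu⟩, ?_⟩
    simp only [T, hbs, if_false]
    have h3 : dist y b.1 ≤ dist z y + dist z b.1 := by
      rw [dist_comm z y]; exact dist_triangle _ _ _
    simp only [Metric.mem_closedBall] at hz1 hz2 ⊢
    simp only at hrb
    linarith
  · calc ∑' i, Metric.ediam (T i) ^ (d : ℝ)
        ≤ ∑' i : u, (a i + (if i ∈ s then 0 else 3 ^ (d : ℝ) * a i)) := by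
          refine ENNReal.tsum_le_tsum fun q => ?_
          have h1 := (hut q.2).2.1
          by_cases hq : q ∈ s
          · simp only [T, hq, if_true, add_zero, a]
            exact ENNReal.rpow_le_rpow (hdiam _ _ h1.le) (by positivity)
          · simp only [T, hq, if_false, a]
            refine le_trans ?_ le_add_self
            rw [← ENNReal.mul_rpow_of_nonneg _ _ (by positivity)]
            refine ENNReal.rpow_le_rpow ((hdiam _ _ (by linarith)).trans (le_of_eq ?_)) (by positivity)
            rw [← mul_assoc, mul_comm 2 (3 : ℝ), mul_assoc, ENNReal.ofReal_mul (by norm_num)]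
            simp
      _ = ∑' i, a i + 3 ^ (d : ℝ) * ∑' i : u, (if i ∈ s then 0 else a i) := by
          rw [ENNReal.tsum_add, ← ENNReal.tsum_mul_left]
          congr 2
          ext i; split_ifs <;> simp
      _ ≤ e U / c + ENNReal.ofReal δ := by
          refine add_le_add hsum ?_
          have : ∑' i : u, (if i ∈ s then 0 else a i) = ∑' i : { x // x ∉ s }, a i := by
            have h4 := tsum_subtype {x : u | x ∉ s} a
            refine Eq.trans (tsum_congr fun i => ?_) h4.symm
            by_cases hi : i ∈ s <;> simp [hi]
          rw [this]
          refine (mul_le_mul_right hs.le _).trans ?_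
          rw [mul_comm]
          exact (ENNReal.div_mul_cancel (by simp) (by simp)).le

/-- Letting δ → 0 in the covers bounds the unnormalised Hausdorff measure. The volume of a d-ball of
radius r is κ(2r)^d with κ the volume of the ball of radius 1/2, which is exactly the factor in
`hausdorff`. -/
theorem mul_hausdorff_le_of_density (hmono : ∀ A B, A ⊆ B → e A ≤ e B)
    (hadd : ∀ A B, MeasurableSet A → MeasurableSet B → Disjoint A B → e A + e B ≤ e (A ∪ B))
    {K U : Set (Vec N)} (hU : IsOpen U) (hKU : K ⊆ U) (d : ℕ) (c : ℝ≥0)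
    (h : ∀ x ∈ K, ∀ᶠ r : ℝ in 𝓝[>] 0,
      c * volume (Metric.ball (0 : Vec d) r) ≤ e (Metric.closedBall x r)) :
    c * hausdorff d K ≤ e U := by
  rcases eq_or_ne c 0 with rfl | hc
  · simp
  by_cases heU : e U = ⊤
  · simp [heU]
  set κ := volume (Metric.ball (0 : Vec d) (1 / 2)) with hκ
  have hκ0 : κ ≠ 0 := (Metric.measure_ball_pos volume _ (by norm_num)).ne'
  have hκt : κ ≠ ⊤ := measure_ball_lt_top.ne
  have hc' : (c : ℝ≥0∞) * κ ≠ 0 := mul_ne_zero (by simpa using hc) hκ0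
  have hct : (c : ℝ≥0∞) * κ ≠ ⊤ := ENNReal.mul_ne_top ENNReal.coe_ne_top hκt
  have h' : ∀ x ∈ K, ∀ᶠ r : ℝ in 𝓝[>] 0,
      (c * κ) * ENNReal.ofReal (2 * r) ^ (d : ℝ) ≤ e (Metric.closedBall x r) := by
    intro x hx
    filter_upwards [h x hx, self_mem_nhdsWithin] with r hr hr0
    have hr0 : (0 : ℝ) < r := hr0
    refine le_trans (le_of_eq ?_) hr
    have := Measure.addHaar_ball_mul_of_pos (volume : Measure (Vec d)) (0 : Vec d)
      (r := 2 * r) (by linarith) (1 / 2)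
    rw [show 2 * r * (1 / 2) = r by ring, finrank_euclideanSpace_fin] at this
    rw [this, ENNReal.ofReal_pow (by linarith), ENNReal.rpow_natCast, mul_assoc,
      mul_comm (ENNReal.ofReal (2 * r) ^ d)]
  choose u t hu hdiam hcov hsum using fun k : ℕ =>
    exists_cover_of_density hmono hadd hU hKU d hc' hct heU h'
      (δ := 1 / ((k : ℝ) + 1)) (by positivity)
  have : ∀ k, Countable (u k) := fun k => (hu k).to_subtype
  have hlim : Tendsto (fun k : ℕ => (1 : ℝ) / ((k : ℝ) + 1)) atTop (𝓝 0) :=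
    tendsto_one_div_add_atTop_nhds_zero_nat
  have hlim1 : Tendsto (fun k : ℕ => ENNReal.ofReal (6 * (1 / ((k : ℝ) + 1)))) atTop (𝓝 0) := by
    simpa using ENNReal.tendsto_ofReal (hlim.const_mul 6)
  have hlim2 : Tendsto (fun k : ℕ => e U / (c * κ) + ENNReal.ofReal (1 / ((k : ℝ) + 1))) atTop
      (𝓝 (e U / (c * κ))) := by
    simpa using (ENNReal.tendsto_ofReal hlim).const_add (e U / (c * κ))
  have key : (μH[(d : ℝ)] : Measure (Vec N)) K ≤ e U / (c * κ) := by
    refine (Measure.hausdorffMeasure_le_liminf_tsum (d : ℝ) K _ hlim1 t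
      (Eventually.of_forall hdiam) (Eventually.of_forall hcov)).trans ?_
    rw [← hlim2.liminf_eq]
    exact liminf_le_liminf (Eventually.of_forall hsum)
  rw [ENNReal.le_div_iff_mul_le (Or.inl hc') (Or.inl hct)] at key
  refine le_trans (le_of_eq ?_) key
  rw [hausdorff, Measure.smul_apply, smul_eq_mul, ← hκ]
  ring

/-- Disjoint compact sets have disjoint open neighbourhoods, and superadditivity adds the separate
bounds inside them. -/
theorem sum_mul_hausdorff_le_of_density (hmono : ∀ A B, A ⊆ B → e A ≤ e B)
    (hadd : ∀ A B, MeasurableSet A → MeasurableSet B → Disjoint A B → e A + e B ≤ e (A ∪ B))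
    (d : ℕ) {ι : Type*} (s : Finset ι) (c : ι → ℝ≥0) (K : ι → Set (Vec N))
    (hK : ∀ i ∈ s, IsCompact (K i)) (hdisj : (s : Set ι).PairwiseDisjoint K)
    (h : ∀ i ∈ s, ∀ x ∈ K i, ∀ᶠ r : ℝ in 𝓝[>] 0,
      c i * volume (Metric.ball (0 : Vec d) r) ≤ e (Metric.closedBall x r))
    {U : Set (Vec N)} (hU : IsOpen U) (hKU : ∀ i ∈ s, K i ⊆ U) :
    ∑ i ∈ s, c i * hausdorff d (K i) ≤ e U := by
  classical
  induction s using Finset.induction_on generalizing U with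
  | empty => simp
  | insert a s ha ih =>
    rw [Finset.sum_insert ha]
    have hcs : IsCompact (⋃ i ∈ s, K i) :=
      s.isCompact_biUnion fun i hi => hK i (Finset.mem_insert_of_mem hi)
    have hd : Disjoint (K a) (⋃ i ∈ s, K i) := by
      rw [Set.disjoint_iUnion₂_right]
      intro i hi
      exact hdisj (by simp) (by simp [hi]) (fun h => ha (h ▸ hi))
    obtain ⟨V, V', hV, hV', hKV, hKV', hVV'⟩ :=
      SeparatedNhds.of_isCompact_isCompact (hK a (by simp)) hcs hd
    have h1 : c a * hausdorff d (K a) ≤ e (U ∩ V) :=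
      mul_hausdorff_le_of_density hmono hadd (hU.inter hV)
        (subset_inter (hKU a (by simp)) hKV) d (c a) (h a (by simp))
    have h2 : ∑ i ∈ s, c i * hausdorff d (K i) ≤ e (U ∩ V') :=
      ih (fun i hi => hK i (Finset.mem_insert_of_mem hi)) (hdisj.subset (by simp))
        (fun i hi => h i (Finset.mem_insert_of_mem hi)) (hU.inter hV')
        (fun i hi => subset_inter (hKU i (Finset.mem_insert_of_mem hi))
          ((subset_iUnion₂ (s := fun i _ => K i) i hi).trans hKV'))
    refine (add_le_add h1 h2).trans ((hadd _ _ (hU.inter hV).measurableSet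
      (hU.inter hV').measurableSet ?_).trans (hmono _ _ ?_))
    · exact hVV'.mono inter_subset_right inter_subset_right
    · exact union_subset inter_subset_left inter_subset_left

/-- The Hausdorff measure is not σ-finite on the whole space. Restricting to D and then to a
spanning set gives a finite Borel measure on a Polish space, which is inner regular with respect to
compact sets. -/
theorem exists_isCompact_lt_measure {X : Type*} [TopologicalSpace X] [MeasurableSpace X]
    [PolishSpace X] [BorelSpace X] (μ : Measure X) {E D : Set X}
    (hE : MeasurableSet E) (hED : E ⊆ D) (hD : SigmaFinite (μ.restrict D)) {b : ℝ≥0∞}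
    (hb : b < μ E) : ∃ K ⊆ E, IsCompact K ∧ b < μ K := by
  have hμE : ∀ A ⊆ E, μ.restrict D A = μ A := fun A hA =>
    Measure.restrict_eq_self μ (hA.trans hED)
  rw [← hμE E subset_rfl] at hb
  obtain ⟨i, hi⟩ : ∃ i, b < μ.restrict D (E ∩ spanningSets (μ.restrict D) i) := by
    have h1 : (μ.restrict D) E = ⨆ i, μ.restrict D (E ∩ spanningSets (μ.restrict D) i) := by
      rw [← Monotone.measure_iUnion, ← inter_iUnion, iUnion_spanningSets, inter_univ]
      exact fun i j hij => inter_subset_inter_right _ (monotone_spanningSets _ hij)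
    rw [h1] at hb
    exact lt_iSup_iff.1 hb
  set S := spanningSets (μ.restrict D) i
  have hS : MeasurableSet S := measurableSet_spanningSets _ _
  have : IsFiniteMeasure ((μ.restrict D).restrict S) :=
    ⟨by simpa using measure_spanningSets_lt_top (μ.restrict D) i⟩
  have h2 : b < (μ.restrict D).restrict S E := by rwa [Measure.restrict_apply hE]
  let := TopologicalSpace.upgradeIsCompletelyMetrizable X
  obtain ⟨K, hKE, hK, hbK⟩ := hE.exists_lt_isCompact_of_ne_top (measure_ne_top _ _) h2
  refine ⟨K, hKE, hK, hbK.trans_le ?_⟩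
  rw [← hμE K hKE]
  exact Measure.restrict_apply_le _ _

/-- Lower bound for a superadditive set function through its lower density with respect to the
Hausdorff measure; `f` need not be measurable. -/
theorem setLIntegral_hausdorff_le_of_density (hmono : ∀ A B, A ⊆ B → e A ≤ e B)
    (hadd : ∀ A B, MeasurableSet A → MeasurableSet B → Disjoint A B → e A + e B ≤ e (A ∪ B))
    (d : ℕ) {D U : Set (Vec N)} (hD : MeasurableSet D) (hU : IsOpen U) (hDU : D ⊆ U)
    (hfin : SigmaFinite ((hausdorff d : Measure (Vec N)).restrict D)) (f : Vec N → ℝ≥0∞)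
    (h : ∀ x ∈ D, ∀ c : ℝ≥0, (c : ℝ≥0∞) < f x → ∀ᶠ r : ℝ in 𝓝[>] 0,
      c * volume (Metric.ball (0 : Vec d) r) ≤ e (Metric.closedBall x r)) :
    ∫⁻ x in D, f x ∂(hausdorff d) ≤ e U := by
  classical
  rw [lintegral_eq_nnreal]
  refine iSup₂_le fun s hs => ?_
  -- The density hypothesis needs constants strictly below f, while a simple function under f may
  -- touch it. Hence the factor θ < 1, sent to 1 at the end.
  have hint : ∀ θ : ℝ≥0, θ < 1 → (θ : ℝ≥0∞) *
      (s.map ((↑) : ℝ≥0 → ℝ≥0∞)).lintegral ((hausdorff d).restrict D) ≤ e U := by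
    intro θ hθ
    rw [SimpleFunc.map_lintegral, Finset.mul_sum]
    -- Simultaneous choices of a compact set in every level set. Unions make this family directed,
    -- which allows the finite sum of suprema to be written as one supremum.
    let T := {K : ℝ≥0 → Set (Vec N) // ∀ i, IsCompact (K i) ∧ K i ⊆ s ⁻¹' {i} ∩ D}
    have hE : ∀ i : ℝ≥0, (hausdorff d).restrict D (s ⁻¹' {i}) =
        ⨆ K : T, (hausdorff d : Measure (Vec N)) (K.1 i) := by
      intro i
      rw [Measure.restrict_apply (s.measurableSet_preimage _)]
      refine le_antisymm (le_of_forall_lt fun b hb => ?_) (iSup_le fun K => measure_mono (K.2 i).2)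
      obtain ⟨K, hKE, hK, hbK⟩ := exists_isCompact_lt_measure (hausdorff d)
        ((s.measurableSet_preimage {i}).inter hD) inter_subset_right hfin hb
      refine hbK.trans_le ?_
      let K' : T := ⟨fun j => if j = i then K else ∅, fun j => by
        by_cases hj : j = i
        · subst hj; simp [hK, subset_inter_iff.1 hKE]
        · simp [hj]⟩
      refine le_trans (le_of_eq ?_) (le_iSup _ K')
      simp [K']
    simp_rw [hE, ENNReal.mul_iSup]
    rw [ENNReal.finsetSum_iSup]
    · refine iSup_le fun K => ?_
      simp_rw [← mul_assoc, ← ENNReal.coe_mul]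
      refine sum_mul_hausdorff_le_of_density hmono hadd d s.range (fun i => θ * i) K.1
        (fun i _ => (K.2 i).1) ?_ ?_ hU (fun i _ => (K.2 i).2.trans (inter_subset_right.trans hDU))
      · intro i _ j _ hij
        refine Disjoint.mono (K.2 i).2 (K.2 j).2 (Set.disjoint_left.2 ?_)
        rintro x ⟨hx, -⟩ ⟨hx', -⟩
        exact hij (hx.symm.trans hx')
      · intro i _ x hx
        obtain ⟨hxi, hxD⟩ := (K.2 i).2 hx
        rcases eq_or_ne i 0 with rfl | hi
        · simp
        refine h x hxD _ (lt_of_lt_of_le ?_ (hs x))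
        rw [show s x = i from hxi, ENNReal.coe_lt_coe]
        exact mul_lt_of_lt_one_left (pos_iff_ne_zero.2 hi) hθ
    · intro K K'
      refine ⟨⟨fun i => K.1 i ∪ K'.1 i, fun i => ⟨(K.2 i).1.union (K'.2 i).1,
        union_subset (K.2 i).2 (K'.2 i).2⟩⟩, fun a => ⟨?_, ?_⟩⟩
      · dsimp only; gcongr; exact subset_union_left
      · dsimp only; gcongr; exact subset_union_right
  refine ENNReal.le_of_forall_nnreal_lt fun b hb => ?_
  have hone : Tendsto (fun θ : ℝ≥0 => (θ : ℝ≥0∞) *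
      (s.map ((↑) : ℝ≥0 → ℝ≥0∞)).lintegral ((hausdorff d).restrict D)) (𝓝[<] 1)
      (𝓝 (1 * (s.map ((↑) : ℝ≥0 → ℝ≥0∞)).lintegral ((hausdorff d).restrict D))) := by
    refine ENNReal.Tendsto.mul_const ?_ (Or.inl one_ne_zero)
    exact (ENNReal.tendsto_coe.2 tendsto_id).mono_left nhdsWithin_le_nhds
  rw [one_mul] at hone
  have : (𝓝[<] (1 : ℝ≥0)).NeBot := nhdsLT_neBot_of_exists_lt ⟨0, zero_lt_one⟩
  refine hb.le.trans (le_of_tendsto hone ?_)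
  filter_upwards [self_mem_nhdsWithin] with θ hθ using hint θ hθ

end Covering

/-! ### Interpolation inequalities for intermediate derivatives -/

section Interpolation

theorem rpow_lintegral_le_lintegral_rpow {α : Type*} [MeasurableSpace α] (μ : Measure α)
    [IsProbabilityMeasure μ] {p : ℝ} (hp : 1 ≤ p) {f : α → ℝ≥0∞} (hf : AEMeasurable f μ) :
    (∫⁻ x, f x ∂μ) ^ p ≤ ∫⁻ x, f x ^ p ∂μ := by
  have h := eLpNorm'_le_eLpNorm'_of_exponent_le (μ := μ) (f := f) zero_lt_one hp
    hf.aestronglyMeasurable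
  simp only [eLpNorm', enorm_eq_self, ENNReal.rpow_one, div_one] at h
  have hp0 : 0 < p := by linarith
  calc (∫⁻ x, f x ∂μ) ^ p ≤ ((∫⁻ x, f x ^ p ∂μ) ^ (1 / p)) ^ p :=
        ENNReal.rpow_le_rpow h hp0.le
    _ = _ := by rw [← ENNReal.rpow_mul, one_div, inv_mul_cancel₀ hp0.ne', ENNReal.rpow_one]

/-- Coefficients of a finite difference formula for the first derivative. -/
theorem exists_difference_coeff (n : ℕ) : ∃ c : Fin n → ℝ,
    ∀ k < n, ∑ i, c i * ((i : ℕ) : ℝ) ^ k = if k = 1 then 1 else 0 := by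
  have hdet : (Matrix.vandermonde (fun i : Fin n => ((i : ℕ) : ℝ))).det ≠ 0 :=
    Matrix.det_vandermonde_ne_zero_iff.2 fun i j h => Fin.ext (by exact_mod_cast h)
  set V := Matrix.vandermonde (fun i : Fin n => ((i : ℕ) : ℝ))
  let b : Fin n → ℝ := fun k => if (k : ℕ) = 1 then 1 else 0
  refine ⟨Matrix.vecMul b V⁻¹, fun k hk => ?_⟩
  have h : Matrix.vecMul (Matrix.vecMul b V⁻¹) V = b := by
    rw [Matrix.vecMul_vecMul, Matrix.nonsing_inv_mul _ (isUnit_iff_ne_zero.2 hdet),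
      Matrix.vecMul_one]
  have := congrFun h ⟨k, hk⟩
  simpa [Matrix.vecMul, dotProduct, V, Matrix.vandermonde, b] using this

variable {N : ℕ}

/-- Taylor's formula of order n at the points z + i v, i < n, is combined with the weights c_i:
every polynomial term cancels except the first-order one. What is left are the values of w and the
integral remainders, where i^n ≤ n^n bounds the n directions. -/
theorem enorm_fderiv_apply_le {n : ℕ} (hn : 2 ≤ n) {c : Fin n → ℝ}
    (hc : ∀ k < n, ∑ i, c i * ((i : ℕ) : ℝ) ^ k = if k = 1 then 1 else 0)
    {E : Type} [NormedAddCommGroup E] [NormedSpace ℝ E] [CompleteSpace E]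
    {w : Vec N → E} (hw : ContDiff ℝ ∞ w) (z v : Vec N) (hv : ‖v‖ ≤ 1) :
    ‖fderiv ℝ w z v‖ₑ ≤ ∑ i : Fin n, ‖c i‖ₑ * n ^ n * (‖w (z + ((i : ℕ) : ℝ) • v)‖ₑ +
      ∫⁻ t in Icc (0 : ℝ) 1, ‖iteratedFDeriv ℝ n w (z + (t * ((i : ℕ) : ℝ)) • v)‖ₑ) := by
  obtain ⟨m, rfl⟩ : ∃ m, n = m + 1 := ⟨n - 1, by omega⟩
  have hT := fun i : Fin (m + 1) => map_add_eq_sum_add_integral_iteratedFDeriv (f := w) (x := z)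
    (y := ((i : ℕ) : ℝ) • v) (n := m)
    (fun t _ => hw.contDiffAt.of_le (by exact_mod_cast le_top))
  have hsum : ∑ i : Fin (m + 1), c i • ∑ k ∈ Finset.range (m + 1), (k.factorial : ℝ)⁻¹ •
      (iteratedFDeriv ℝ k w z (fun _ => ((i : ℕ) : ℝ) • v)) = fderiv ℝ w z v := by
    simp_rw [Finset.smul_sum]
    rw [Finset.sum_comm, Finset.sum_eq_single 1]
    · have := hc 1 (by omega)
      simp only [pow_one, if_true] at this
      simp only [iteratedFDeriv_one_apply, map_smul, smul_smul, ← Finset.sum_smul]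
      simp [this]
    · intro k hk hk1
      have := hc k (Finset.mem_range.1 hk)
      simp only [hk1, if_false] at this
      have h2 : ∀ i : Fin (m + 1), c i • (k.factorial : ℝ)⁻¹ •
          (iteratedFDeriv ℝ k w z (fun _ => ((i : ℕ) : ℝ) • v)) =
          (c i * ((i : ℕ) : ℝ) ^ k) • (k.factorial : ℝ)⁻¹ • iteratedFDeriv ℝ k w z (fun _ => v) := by
        intro i
        rw [ContinuousMultilinearMap.map_smul_univ _ (fun _ => ((i : ℕ) : ℝ)) (fun _ => v)]
        simp [smul_smul]; ring_nf
      simp_rw [h2, ← Finset.sum_smul, this, zero_smul]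
    · intro h
      exact absurd (Finset.mem_range.2 (by omega)) h
  have hrep : fderiv ℝ w z v = ∑ i : Fin (m + 1), c i • (w (z + ((i : ℕ) : ℝ) • v) -
      (m.factorial : ℝ)⁻¹ • ∫ t in (0 : ℝ)..1, (1 - t) ^ m •
        iteratedFDeriv ℝ (m + 1) w (z + t • ((i : ℕ) : ℝ) • v) (fun _ => ((i : ℕ) : ℝ) • v)) := by
    rw [← hsum]
    refine Finset.sum_congr rfl fun i _ => ?_
    rw [hT i, add_sub_cancel_right]
  rw [hrep]
  refine (enorm_sum_le _ _).trans (Finset.sum_le_sum fun i _ => ?_)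
  rw [enorm_smul, mul_assoc]
  refine mul_le_mul_right ?_ _
  refine (enorm_sub_le).trans ?_
  rw [mul_add]
  have h1 : (1 : ℝ≥0∞) ≤ ((m + 1 : ℕ) : ℝ≥0∞) ^ (m + 1) := by
    refine one_le_pow₀ ?_
    exact_mod_cast (by omega : 1 ≤ m + 1)
  refine add_le_add (le_mul_of_one_le_left' h1) ?_
  rw [enorm_smul, ← lintegral_const_mul' _ _ (by finiteness)]
  have h2 : ‖(m.factorial : ℝ)⁻¹‖ₑ ≤ 1 := by
    rw [← ofReal_norm, ← ENNReal.ofReal_one]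
    refine ENNReal.ofReal_le_ofReal ?_
    rw [norm_inv, Real.norm_natCast]
    exact inv_le_one_of_one_le₀ (by exact_mod_cast Nat.factorial_pos m)
  refine (mul_le_of_le_one_left' h2).trans ?_
  rw [intervalIntegral.integral_of_le zero_le_one]
  refine (enorm_integral_le_lintegral_enorm _).trans ?_
  refine (lintegral_mono_set Ioc_subset_Icc_self).trans ?_
  refine setLIntegral_mono' measurableSet_Icc fun t ht => ?_
  rw [enorm_smul, smul_smul]
  have h3 : ‖(1 - t) ^ m‖ₑ ≤ 1 := by
    rw [← ofReal_norm, ← ENNReal.ofReal_one]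
    refine ENNReal.ofReal_le_ofReal ?_
    rw [norm_pow, Real.norm_of_nonneg (by linarith [ht.2])]
    exact pow_le_one₀ (by linarith [ht.2]) (by linarith [ht.1])
  refine (mul_le_of_le_one_left' h3).trans ?_
  set T := iteratedFDeriv ℝ (m + 1) w (z + (t * ((i : ℕ) : ℝ)) • v)
  have h4 : ‖T (fun _ => ((i : ℕ) : ℝ) • v)‖ ≤ ((m + 1 : ℕ) : ℝ) ^ (m + 1) * ‖T‖ := by
    refine (T.le_opNorm _).trans ?_
    rw [mul_comm]
    refine mul_le_mul_of_nonneg_right ?_ (norm_nonneg _)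
    simp only [Finset.prod_const, Finset.card_univ, Fintype.card_fin]
    refine pow_le_pow_left₀ (norm_nonneg _) ?_ _
    rw [norm_smul, Real.norm_natCast]
    calc ((i : ℕ) : ℝ) * ‖v‖ ≤ ((i : ℕ) : ℝ) * 1 := by gcongr
      _ ≤ _ := by rw [mul_one]; exact_mod_cast i.2.le
  rw [← ofReal_norm, ← ofReal_norm]
  refine (ENNReal.ofReal_le_ofReal h4).trans (le_of_eq ?_)
  rw [ENNReal.ofReal_mul (by positivity), ENNReal.ofReal_pow (by positivity), ENNReal.ofReal_natCast]

theorem setLIntegral_comp_add_le {A A' : Set (Vec N)} {h : Vec N} (hA : ∀ z ∈ A, z + h ∈ A')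
    (f : Vec N → ℝ≥0∞) : ∫⁻ z in A, f (z + h) ≤ ∫⁻ z in A', f z := by
  have hm := measurePreserving_add_right (volume : Measure (Vec N)) h
  calc ∫⁻ z in A, f (z + h) ≤ ∫⁻ z in (fun z => z + h) ⁻¹' A', f (z + h) :=
        lintegral_mono_set hA
    _ = _ := hm.setLIntegral_comp_preimage_emb (measurableEmbedding_addRight h) f A'

theorem rpow_sum_le_card_mul {ι : Type*} (s : Finset ι) (f : ι → ℝ≥0∞) {p : ℝ} (hp : 1 ≤ p) :
    (∑ i ∈ s, f i) ^ p ≤ (s.card : ℝ≥0∞) ^ p * ∑ i ∈ s, f i ^ p := by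
  rcases s.eq_empty_or_nonempty with rfl | hs
  · simp [show 0 < p by linarith]
  refine (ENNReal.rpow_sum_le_const_mul_sum_rpow s f hp).trans ?_
  gcongr
  · exact_mod_cast hs.card_pos
  · linarith

theorem rpow_add_le_mul {p : ℝ} (hp : 1 ≤ p) (a b : ℝ≥0∞) :
    (a + b) ^ p ≤ 2 ^ p * (a ^ p + b ^ p) := by
  refine (ENNReal.rpow_add_le_mul_rpow_add_rpow a b hp).trans ?_
  gcongr
  · norm_num
  · linarith

theorem enorm_fderiv_le_sum {E : Type} [NormedAddCommGroup E] [NormedSpace ℝ E]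
    (T : Vec N →L[ℝ] E) : ‖T‖ₑ ≤ ∑ j, ‖T (EuclideanSpace.basisFun (Fin N) ℝ j)‖ₑ := by
  have h : ‖T‖ ≤ ∑ j, ‖T (EuclideanSpace.basisFun (Fin N) ℝ j)‖ := by
    refine T.opNorm_le_bound (Finset.sum_nonneg fun _ _ => norm_nonneg _) fun x => ?_
    conv_lhs => rw [← (EuclideanSpace.basisFun (Fin N) ℝ).sum_repr x, map_sum]
    refine (norm_sum_le _ _).trans ?_
    rw [Finset.sum_mul]
    refine Finset.sum_le_sum fun j _ => ?_
    rw [map_smul, norm_smul, mul_comm]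
    refine mul_le_mul_of_nonneg_left ?_ (norm_nonneg _)
    simpa using PiLp.norm_apply_le x j
  rw [← ofReal_norm]
  refine (ENNReal.ofReal_le_ofReal h).trans (le_of_eq ?_)
  rw [ENNReal.ofReal_sum_of_nonneg fun _ _ => norm_nonneg _]
  simp

/-- First-order interpolation inequality, with a loss of domain. -/
theorem exists_lintegral_fderiv_le (N : ℕ) {p : ℝ} (hp : 1 ≤ p) (n : ℕ) (hn : 2 ≤ n) :
    ∃ C : ℝ≥0∞, C ≠ ⊤ ∧ ∀ (E : Type) [NormedAddCommGroup E] [NormedSpace ℝ E] [CompleteSpace E]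
      (w : Vec N → E), ContDiff ℝ ∞ w → ∀ A A' : Set (Vec N),
      (∀ z ∈ A, ∀ h : Vec N, ‖h‖ ≤ n → z + h ∈ A') →
      ∫⁻ z in A, ‖fderiv ℝ w z‖ₑ ^ p ≤
        C * ((∫⁻ z in A', ‖w z‖ₑ ^ p) + ∫⁻ z in A', ‖iteratedFDeriv ℝ n w z‖ₑ ^ p) := by
  obtain ⟨c, hc⟩ := exists_difference_coeff n
  have hp0 : 0 ≤ p := by linarith
  let C1 : ℝ≥0∞ := ∑ i : Fin n, (‖c i‖ₑ * n ^ n) ^ p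
  have hC1 : C1 ≠ ⊤ := ENNReal.sum_ne_top.2 fun i _ =>
    ENNReal.rpow_ne_top_of_nonneg hp0 (by finiteness)
  refine ⟨(N : ℝ≥0∞) ^ p * (N * ((n : ℝ≥0∞) ^ p * (C1 * 2 ^ p))), ?_, ?_⟩
  · have h1 : ((N : ℝ≥0∞) ^ p) ≠ ⊤ := ENNReal.rpow_ne_top_of_nonneg hp0 (by simp)
    have h2 : ((n : ℝ≥0∞) ^ p) ≠ ⊤ := ENNReal.rpow_ne_top_of_nonneg hp0 (by simp)
    have h3 : ((2 : ℝ≥0∞) ^ p) ≠ ⊤ := ENNReal.rpow_ne_top_of_nonneg hp0 (by simp)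
    finiteness
  intro E _ _ _ w hw A A' hA
  have hwn : Continuous (iteratedFDeriv ℝ n w) :=
    hw.continuous_iteratedFDeriv (by exact_mod_cast le_top)
  set I := ∫⁻ z in A', ‖w z‖ₑ ^ p
  set J := ∫⁻ z in A', ‖iteratedFDeriv ℝ n w z‖ₑ ^ p
  have hdir : ∀ v : Vec N, ‖v‖ = 1 → ∫⁻ z in A, ‖fderiv ℝ w z v‖ₑ ^ p ≤
      (n : ℝ≥0∞) ^ p * (C1 * 2 ^ p) * (I + J) := by
    intro v hv
    have hmem : ∀ i : Fin n, ∀ t ∈ Icc (0 : ℝ) 1, ∀ z ∈ A, z + (t * ((i : ℕ) : ℝ)) • v ∈ A' := by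
      intro i t ht z hz
      refine hA z hz _ ?_
      rw [norm_smul, hv, mul_one, Real.norm_of_nonneg (mul_nonneg ht.1 (by positivity))]
      have h1 : ((i : ℕ) : ℝ) ≤ n := by exact_mod_cast i.2.le
      nlinarith [ht.1, ht.2]
    have hcont : ∀ i : Fin n, Continuous (Function.uncurry fun (z : Vec N) (t : ℝ) =>
        ‖iteratedFDeriv ℝ n w (z + (t * ((i : ℕ) : ℝ)) • v)‖ₑ) := by
      intro i
      refine continuous_enorm.comp (hwn.comp ?_)
      fun_prop
    have hprob : IsProbabilityMeasure (volume.restrict (Icc (0 : ℝ) 1)) := ⟨by simp⟩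
    have hterm : ∀ i : Fin n, ∫⁻ z in A, (‖w (z + ((i : ℕ) : ℝ) • v)‖ₑ +
        ∫⁻ t in Icc (0 : ℝ) 1, ‖iteratedFDeriv ℝ n w (z + (t * ((i : ℕ) : ℝ)) • v)‖ₑ) ^ p ≤
        2 ^ p * (I + J) := by
      intro i
      calc _ ≤ ∫⁻ z in A, 2 ^ p * (‖w (z + ((i : ℕ) : ℝ) • v)‖ₑ ^ p + ∫⁻ t in Icc (0 : ℝ) 1,
              ‖iteratedFDeriv ℝ n w (z + (t * ((i : ℕ) : ℝ)) • v)‖ₑ ^ p) := by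
            refine lintegral_mono fun z => (rpow_add_le_mul hp _ _).trans ?_
            gcongr
            refine rpow_lintegral_le_lintegral_rpow _ hp ?_
            exact ((hcont i).comp (Continuous.prodMk_right z)).measurable.aemeasurable
        _ = 2 ^ p * ((∫⁻ z in A, ‖w (z + ((i : ℕ) : ℝ) • v)‖ₑ ^ p) + ∫⁻ t in Icc (0 : ℝ) 1,
              ∫⁻ z in A, ‖iteratedFDeriv ℝ n w (z + (t * ((i : ℕ) : ℝ)) • v)‖ₑ ^ p) := by
            rw [lintegral_const_mul' _ _ (ENNReal.rpow_ne_top_of_nonneg hp0 (by simp)),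
              lintegral_add_left, lintegral_lintegral_swap]
            · exact ((hcont i).measurable.pow_const p).aemeasurable
            · exact (continuous_enorm.comp (hw.continuous.comp (by fun_prop))).measurable.pow_const p
        _ ≤ 2 ^ p * (I + ∫⁻ t in Icc (0 : ℝ) 1, J) := by
            refine mul_le_mul_right (add_le_add ?_ ?_) _
            · refine setLIntegral_comp_add_le (fun z hz => ?_) (fun z => ‖w z‖ₑ ^ p)
              have h1 : (1 : ℝ) ∈ Icc (0 : ℝ) 1 := ⟨zero_le_one, le_rfl⟩
              simpa using hmem i 1 h1 z hz
            · refine setLIntegral_mono' measurableSet_Icc fun t ht => ?_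
              exact setLIntegral_comp_add_le (hmem i t ht) (fun z => ‖iteratedFDeriv ℝ n w z‖ₑ ^ p)
        _ = _ := by simp
    calc ∫⁻ z in A, ‖fderiv ℝ w z v‖ₑ ^ p
        ≤ ∫⁻ z in A, (n : ℝ≥0∞) ^ p * ∑ i : Fin n, (‖c i‖ₑ * n ^ n) ^ p *
          (‖w (z + ((i : ℕ) : ℝ) • v)‖ₑ +
            ∫⁻ t in Icc (0 : ℝ) 1, ‖iteratedFDeriv ℝ n w (z + (t * ((i : ℕ) : ℝ)) • v)‖ₑ) ^ p := by
          refine lintegral_mono fun z => ?_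
          refine (ENNReal.rpow_le_rpow (enorm_fderiv_apply_le hn hc hw z v hv.le) hp0).trans ?_
          refine (rpow_sum_le_card_mul _ _ hp).trans (le_of_eq ?_)
          simp only [Finset.card_univ, Fintype.card_fin]
          congr 1
          exact Finset.sum_congr rfl fun i _ => ENNReal.mul_rpow_of_nonneg _ _ hp0
      _ = (n : ℝ≥0∞) ^ p * ∑ i : Fin n, (‖c i‖ₑ * n ^ n) ^ p * ∫⁻ z in A,
          (‖w (z + ((i : ℕ) : ℝ) • v)‖ₑ +
            ∫⁻ t in Icc (0 : ℝ) 1, ‖iteratedFDeriv ℝ n w (z + (t * ((i : ℕ) : ℝ)) • v)‖ₑ) ^ p := by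
          have hmeas : ∀ i : Fin n, Measurable fun z => (‖w (z + ((i : ℕ) : ℝ) • v)‖ₑ +
            ∫⁻ t in Icc (0 : ℝ) 1, ‖iteratedFDeriv ℝ n w (z + (t * ((i : ℕ) : ℝ)) • v)‖ₑ) ^ p := by
            intro i
            refine ((continuous_enorm.comp (hw.continuous.comp (by fun_prop))).measurable.add
              ?_).pow_const p
            exact (hcont i).measurable.lintegral_prod_right'
          rw [lintegral_const_mul' _ _ (ENNReal.rpow_ne_top_of_nonneg hp0 (by simp)),
            lintegral_finsetSum]
          · congr 1
            refine Finset.sum_congr rfl fun i _ => ?_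
            rw [lintegral_const_mul _ (hmeas i)]
          · exact fun i _ => (hmeas i).const_mul _
      _ ≤ (n : ℝ≥0∞) ^ p * ∑ i : Fin n, (‖c i‖ₑ * n ^ n) ^ p * (2 ^ p * (I + J)) := by
          gcongr with i
          exact hterm i
      _ = _ := by rw [← Finset.sum_mul]; ring
  calc ∫⁻ z in A, ‖fderiv ℝ w z‖ₑ ^ p
      ≤ ∫⁻ z in A, (N : ℝ≥0∞) ^ p * ∑ j, ‖fderiv ℝ w z (EuclideanSpace.basisFun (Fin N) ℝ j)‖ₑ ^ p := by
        refine lintegral_mono fun z => ?_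
        refine (ENNReal.rpow_le_rpow (enorm_fderiv_le_sum _) hp0).trans ?_
        simpa using rpow_sum_le_card_mul Finset.univ
          (fun j => ‖fderiv ℝ w z (EuclideanSpace.basisFun (Fin N) ℝ j)‖ₑ) hp
    _ = (N : ℝ≥0∞) ^ p * ∑ j, ∫⁻ z in A,
          ‖fderiv ℝ w z (EuclideanSpace.basisFun (Fin N) ℝ j)‖ₑ ^ p := by
        rw [lintegral_const_mul' _ _ (ENNReal.rpow_ne_top_of_nonneg hp0 (by simp)),
            lintegral_finsetSum]
        intro j _
        refine (continuous_enorm.comp ?_).measurable.pow_const p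
        exact (hw.continuous_fderiv (by simp)).clm_apply continuous_const
    _ ≤ (N : ℝ≥0∞) ^ p * ∑ j : Fin N, (n : ℝ≥0∞) ^ p * (C1 * 2 ^ p) * (I + J) := by
        gcongr with j
        exact hdir _ (by simp)
    _ = _ := by
        simp only [Finset.sum_const, Finset.card_univ, Fintype.card_fin, nsmul_eq_mul]
        ring

/-- Interpolation inequality for the intermediate derivatives, with a loss of domain. -/
theorem exists_lintegral_iteratedFDeriv_le (N : ℕ) {p : ℝ} (hp : 1 ≤ p) (j n : ℕ) (hj : j ≤ n) :
    ∃ (C : ℝ≥0∞) (κ : ℕ), C ≠ ⊤ ∧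
      ∀ (E : Type) [NormedAddCommGroup E] [NormedSpace ℝ E] [CompleteSpace E]
      (w : Vec N → E), ContDiff ℝ ∞ w → ∀ A A' : Set (Vec N),
      (∀ z ∈ A, ∀ h : Vec N, ‖h‖ ≤ κ → z + h ∈ A') →
      ∫⁻ z in A, ‖iteratedFDeriv ℝ j w z‖ₑ ^ p ≤
        C * ((∫⁻ z in A', ‖w z‖ₑ ^ p) + ∫⁻ z in A', ‖iteratedFDeriv ℝ n w z‖ₑ ^ p) := by
  induction j generalizing n with
  | zero =>
    refine ⟨1, 0, by simp, fun E _ _ _ w hw A A' hA => ?_⟩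
    have hAA' : A ⊆ A' := fun z hz => by simpa using hA z hz 0 (by simp)
    rw [one_mul]
    refine le_trans ?_ le_self_add
    refine le_trans (le_of_eq ?_) (lintegral_mono_set hAA')
    congr 1; ext z
    rw [← ofReal_norm, norm_iteratedFDeriv_zero, ofReal_norm]
  | succ j ih =>
    obtain ⟨k, rfl⟩ : ∃ k, n = k + 1 := ⟨n - 1, by omega⟩
    rcases Nat.eq_zero_or_pos k with rfl | hk
    · obtain rfl : j = 0 := by omega
      refine ⟨1, 0, by simp, fun E _ _ _ w hw A A' hA => ?_⟩
      have hAA' : A ⊆ A' := fun z hz => by simpa using hA z hz 0 (by simp)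
      rw [one_mul]
      exact (lintegral_mono_set hAA').trans le_add_self
    -- The induction hypothesis is applied to `fderiv ℝ w`, whose values lie in another space; this
    -- is why E is quantified after the constants. The first-order inequality then removes the
    -- resulting norm of `fderiv ℝ w`, and the losses of domain add up.
    obtain ⟨C, κ, hC, h⟩ := ih k (by omega)
    obtain ⟨C', hC', h'⟩ := exists_lintegral_fderiv_le N hp (k + 1) (by omega)
    refine ⟨C * (C' + 1), κ + (k + 1), by finiteness, fun E _ _ _ w hw A A' hA => ?_⟩
    let A1 : Set (Vec N) := {y | ∀ h : Vec N, ‖h‖ ≤ ((k + 1 : ℕ) : ℝ) → y + h ∈ A'}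
    have hA1A' : A1 ⊆ A' := fun z hz => by simpa using hz 0 (by rw [norm_zero]; positivity)
    have hE : ∀ i z, ‖iteratedFDeriv ℝ (i + 1) w z‖ₑ = ‖iteratedFDeriv ℝ i (fderiv ℝ w) z‖ₑ := by
      intro i z
      rw [← ofReal_norm, ← ofReal_norm, norm_iteratedFDeriv_fderiv]
    have h1 := h _ (fderiv ℝ w) (hw.fderiv_right (by simp)) A A1 (by
      intro z hz y hy y' hy'
      rw [add_assoc]
      refine hA z hz _ ((norm_add_le _ _).trans ?_)
      push_cast at hy' ⊢
      linarith)
    have h2 := h' E w hw A1 A' (fun z hz y hy => hz y hy)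
    simp_rw [hE]
    simp_rw [hE] at h2
    refine h1.trans ?_
    rw [mul_assoc]
    refine mul_le_mul_right ?_ _
    rw [add_mul, one_mul]
    refine add_le_add h2 ((lintegral_mono_set hA1A').trans le_add_self)

end Interpolation

/-! ### Mollification and translation in L^p -/

section Mollification

open scoped Convolution
open ContinuousLinearMap (lsmul)

variable {N : ℕ} {E : Type} [NormedAddCommGroup E] [NormedSpace ℝ E]

theorem iteratedFDeriv_convolution_apply {g : Vec N → E} (hg : LocallyIntegrable g) (j : ℕ)
    (ρ : Vec N → ℝ) (hρ : ContDiff ℝ ∞ ρ) (hρc : HasCompactSupport ρ) (x : Vec N)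
    (v : Fin j → Vec N) :
    iteratedFDeriv ℝ j (ρ ⋆[lsmul ℝ ℝ, volume] g) x v =
      ((fun y => iteratedFDeriv ℝ j ρ y v) ⋆[lsmul ℝ ℝ, volume] g) x := by
  induction j generalizing x with
  | zero => simp
  | succ j ih =>
    have hsm : ContDiff ℝ ∞ (ρ ⋆[lsmul ℝ ℝ, volume] g) := hρc.contDiff_convolution_left _ hρ hg
    have hd : Differentiable ℝ (iteratedFDeriv ℝ j (ρ ⋆[lsmul ℝ ℝ, volume] g)) :=
      hsm.differentiable_iteratedFDeriv (by exact_mod_cast ENat.natCast_lt_top j)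
    have hdρ : Differentiable ℝ (iteratedFDeriv ℝ j ρ) :=
      hρ.differentiable_iteratedFDeriv (by exact_mod_cast ENat.natCast_lt_top j)
    rw [(hd x).iteratedFDeriv_succ_apply_left']
    simp_rw [ih _ (Fin.tail v)]
    have hc : HasCompactSupport (fun y => iteratedFDeriv ℝ j ρ y (Fin.tail v)) :=
      (hρc.iteratedFDeriv (𝕜 := ℝ) j).comp_left
        (g := fun T : ContinuousMultilinearMap ℝ (fun _ : Fin j => Vec N) ℝ => T (Fin.tail v)) rfl
    have hs : ContDiff ℝ 1 (fun y => iteratedFDeriv ℝ j ρ y (Fin.tail v)) := by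
      have h1 : ContDiff ℝ 1 (iteratedFDeriv ℝ j ρ) :=
        hρ.iteratedFDeriv_right (by exact_mod_cast le_top)
      exact (ContinuousMultilinearMap.apply ℝ (fun _ : Fin j => Vec N) ℝ (Fin.tail v)).contDiff.comp h1
    have := hc.hasFDerivAt_convolution_left (lsmul ℝ ℝ) hs hg x
    rw [this.fderiv]
    have hint : Integrable (fun t => ((lsmul ℝ ℝ).precompL (Vec N)
        (fderiv ℝ (fun y => iteratedFDeriv ℝ j ρ y (Fin.tail v)) t)) (g (x - t))) :=
      (hc.fderiv ℝ).convolutionExists_left _ (hs.continuous_fderiv (by simp)) hg x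
    rw [convolution_def, ContinuousLinearMap.integral_apply hint, convolution_def]
    refine integral_congr_ae (Eventually.of_forall fun t => ?_)
    simp only [ContinuousLinearMap.precompL_apply]
    rw [(hdρ t).iteratedFDeriv_succ_apply_left']

theorem iteratedFDeriv_comp_sub_left_apply {ρ : Vec N → ℝ} (hρ : ContDiff ℝ ∞ ρ) (x : Vec N)
    (j : ℕ) (y : Vec N) :
    iteratedFDeriv ℝ j (fun y => ρ (x - y)) y = (-1 : ℝ) ^ j • iteratedFDeriv ℝ j ρ (x - y) := by
  have h1 : (fun y => ρ (x - y)) = fun y => (fun z => ρ (x + z)) ((-1 : ℝ) • y) := by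
    ext y; simp [sub_eq_add_neg]
  have h2 : ContDiff ℝ j (fun z => ρ (x + z)) :=
    (hρ.of_le (by exact_mod_cast le_top)).comp (by fun_prop)
  rw [h1, iteratedFDeriv_comp_const_smul _ h2]
  simp [iteratedFDeriv_comp_add_left, sub_eq_add_neg]

/-- Smooth approximations of indicator functions with uniformly bounded derivatives. -/
theorem exists_cutoff (N : ℕ) : ∃ C : ℕ → ℝ, ∀ A : Set (Vec N), MeasurableSet A →
    ∃ Θ : Vec N → ℝ, ContDiff ℝ ∞ Θ ∧ (∀ x, Metric.ball x (1 / 2) ⊆ A → Θ x = 1) ∧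
      (∀ x, Disjoint (Metric.ball x (1 / 2)) A → Θ x = 0) ∧
      ∀ j x, ‖iteratedFDeriv ℝ j Θ x‖ ≤ C j := by
  -- The cutoff is the indicator of A convolved with this kernel ρ. All derivatives fall on ρ, so
  -- ∫‖D^jρ‖ is a bound not depending on A.
  let b : ContDiffBump (0 : Vec N) := ⟨1 / 4, 1 / 2, by norm_num, by norm_num⟩
  let ρ : Vec N → ℝ := b.normed volume
  have hρ : ContDiff ℝ ∞ ρ := b.contDiff_normed
  have hρc : HasCompactSupport ρ := b.hasCompactSupport_normed
  have hsupp : ∀ t, ρ t ≠ 0 → ‖t‖ < 1 / 2 := by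
    intro t ht
    have : t ∈ Function.support (b.normed volume) := ht
    rw [b.support_normed_eq] at this
    have h2 : t ∈ Metric.ball (0 : Vec N) (1 / 2) := this
    simpa using h2
  refine ⟨fun j => ∫ y, ‖iteratedFDeriv ℝ j ρ y‖, fun A hA => ?_⟩
  let g : Vec N → ℝ := A.indicator fun _ => 1
  have hg : LocallyIntegrable g := (locallyIntegrable_const (1 : ℝ)).indicator hA
  have hg1 : ∀ x, |g x| ≤ 1 := by
    intro x
    by_cases hx : x ∈ A <;> simp [g, hx]
  have hmem : ∀ x t : Vec N, ‖t‖ < 1 / 2 → x - t ∈ Metric.ball x (1 / 2) := by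
    intro x t ht
    simpa [Metric.mem_ball, dist_eq_norm] using ht
  refine ⟨ρ ⋆[lsmul ℝ ℝ, volume] g, hρc.contDiff_convolution_left _ hρ hg, ?_, ?_, ?_⟩
  · intro x hx
    rw [convolution_lsmul, ← b.integral_normed (μ := volume)]
    refine integral_congr_ae (Eventually.of_forall fun t => ?_)
    by_cases ht : ρ t = 0
    · have h0 : b.normed volume t = 0 := ht
      simp [ρ, h0]
    · have : x - t ∈ A := hx (hmem x t (hsupp t ht))
      simp [g, this, ρ]
  · intro x hx
    rw [convolution_lsmul]
    refine integral_eq_zero_of_ae (Eventually.of_forall fun t => ?_)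
    by_cases ht : ρ t = 0
    · simp [ht]
    · have : x - t ∉ A := Set.disjoint_left.1 hx (hmem x t (hsupp t ht))
      simp [g, this]
  · intro j x
    have hcj : Continuous (iteratedFDeriv ℝ j ρ) :=
      hρ.continuous_iteratedFDeriv (by exact_mod_cast le_top)
    have hint : Integrable fun y => ‖iteratedFDeriv ℝ j ρ y‖ :=
      (hcj.integrable_of_hasCompactSupport (hρc.iteratedFDeriv j)).norm
    refine ContinuousMultilinearMap.opNorm_le_bound (integral_nonneg fun _ => norm_nonneg _)
      fun v => ?_
    rw [iteratedFDeriv_convolution_apply hg j ρ hρ hρc, convolution_lsmul, ← integral_mul_const]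
    refine norm_integral_le_of_norm_le (hint.mul_const _) (Eventually.of_forall fun t => ?_)
    rw [norm_smul]
    refine (mul_le_of_le_one_right (norm_nonneg _) (hg1 _)).trans ?_
    exact ContinuousMultilinearMap.le_opNorm _ _

omit [NormedSpace ℝ E] in
-- This is the continuity of the translation action on L^p for finite p, unfolded into integrals.
theorem tendsto_lintegral_translation_sub {p : ℝ} (hp : 1 ≤ p) {g : Vec N → E}
    (hg : MemLp g (ENNReal.ofReal p) volume) :
    Tendsto (fun h : Vec N => ∫⁻ x, ‖g (x - h) - g x‖ₑ ^ p) (𝓝 0) (𝓝 0) := by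
  have : Fact (1 ≤ ENNReal.ofReal p) := ⟨by simpa using ENNReal.ofReal_le_ofReal hp⟩
  have : Fact (ENNReal.ofReal p ≠ ⊤) := ⟨ENNReal.ofReal_ne_top⟩
  have hp0 : 0 < p := by linarith
  have h1 : Continuous fun h : Vec N => (DomAddAct.mk (-h)) +ᵥ hg.toLp g := by
    have : Continuous fun h : Vec N => (DomAddAct.mk (-h) : (Vec N)ᵈᵃᵃ) :=
      DomAddAct.continuous_mk.comp continuous_neg
    exact this.vadd continuous_const
  have h2 := (tendsto_iff_edist_tendsto_0.1 (h1.tendsto 0))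
  have h3 := (ENNReal.continuous_rpow_const (y := p)).tendsto 0 |>.comp h2
  rw [ENNReal.zero_rpow_of_pos hp0] at h3
  refine h3.congr fun h => ?_
  have h0 : (DomAddAct.mk (-(0 : Vec N))) +ᵥ hg.toLp g = hg.toLp g := by simp
  simp only [Function.comp]
  rw [h0, DomAddAct.mk_vadd_toLp, Lp.edist_toLp_toLp, eLpNorm_eq_lintegral_rpow_enorm_toReal
    (by simp [hp0]) ENNReal.ofReal_ne_top, ENNReal.toReal_ofReal hp0.le, ← ENNReal.rpow_mul,
    one_div, inv_mul_cancel₀ hp0.ne', ENNReal.rpow_one]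
  congr 1; ext x
  simp [vadd_eq_add, neg_add_eq_sub]

theorem isProbabilityMeasure_withDensity_normed (b : ContDiffBump (0 : Vec N)) :
    IsProbabilityMeasure
      ((volume : Measure (Vec N)).withDensity fun h => ENNReal.ofReal (b.normed volume h)) := by
  refine ⟨?_⟩
  rw [withDensity_apply _ MeasurableSet.univ, setLIntegral_univ,
    ← ofReal_integral_eq_lintegral_ofReal b.integrable_normed
    (Eventually.of_forall fun x => b.nonneg_normed x), b.integral_normed, ENNReal.ofReal_one]

/-- Jensen's inequality for the probability measure whose density is the mollifier. -/
theorem enorm_convolution_sub_rpow_le {p : ℝ} (hp : 1 ≤ p) [CompleteSpace E] {g : Vec N → E}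
    (hg : LocallyIntegrable g) (hgm : StronglyMeasurable g) (b : ContDiffBump (0 : Vec N))
    (x : Vec N) :
    ‖((b.normed volume : Vec N → ℝ) ⋆[lsmul ℝ ℝ, volume] g) x - g x‖ₑ ^ p ≤
      ∫⁻ h, ‖g (x - h) - g x‖ₑ ^ p
        ∂(volume.withDensity fun h => ENNReal.ofReal (b.normed volume h)) := by
  have := isProbabilityMeasure_withDensity_normed b
  have hmeas : Measurable fun h : Vec N => ENNReal.ofReal (b.normed volume h) :=
    b.continuous_normed.measurable.ennreal_ofReal
  have hsub : Measurable fun h : Vec N => ‖g (x - h) - g x‖ₑ := by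
    refine StronglyMeasurable.enorm ?_
    exact (hgm.comp_measurable (measurable_const.sub measurable_id)).sub stronglyMeasurable_const
  refine le_trans (ENNReal.rpow_le_rpow ?_ (by linarith))
    (rpow_lintegral_le_lintegral_rpow _ hp hsub.aemeasurable)
  rw [lintegral_withDensity_eq_lintegral_mul _ hmeas hsub, convolution_lsmul]
  have hint1 : Integrable fun t => b.normed volume t • g (x - t) :=
    b.hasCompactSupport_normed.convolutionExists_left (lsmul ℝ ℝ) b.continuous_normed hg x
  have hint2 : Integrable fun t => b.normed volume t • g x := b.integrable_normed.smul_const _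
  have h1 : g x = ∫ t, b.normed volume t • g x := by
    rw [integral_smul_const, b.integral_normed, one_smul]
  conv_lhs => rw [h1]
  rw [← integral_sub hint1 hint2]
  refine (enorm_integral_le_lintegral_enorm _).trans (lintegral_mono fun t => ?_)
  rw [← smul_sub, enorm_smul, Real.enorm_of_nonneg (b.nonneg_normed t)]
  rfl

theorem tendsto_lintegral_convolution_sub {p : ℝ} (hp : 1 ≤ p) [CompleteSpace E] {g : Vec N → E}
    (hg : MemLp g (ENNReal.ofReal p) volume) {b : ℕ → ContDiffBump (0 : Vec N)}
    (hb : Tendsto (fun k => (b k).rOut) atTop (𝓝 0)) :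
    Tendsto (fun k => ∫⁻ x, ‖(((b k).normed volume : Vec N → ℝ) ⋆[lsmul ℝ ℝ, volume] g) x
      - g x‖ₑ ^ p) atTop (𝓝 0) := by
  have hp1 : 1 ≤ ENNReal.ofReal p := by simpa using ENNReal.ofReal_le_ofReal hp
  -- A strongly measurable representative makes (x, h) ↦ g(x - h) - g(x) jointly measurable, as
  -- Tonelli's theorem requires.
  let g' := hg.1.mk g
  have hgg' : g =ᵐ[volume] g' := hg.1.ae_eq_mk
  have hg' : MemLp g' (ENNReal.ofReal p) volume := (memLp_congr_ae hgg').1 hg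
  have hgm : StronglyMeasurable g' := hg.1.stronglyMeasurable_mk
  have hcongr : ∀ k, ∫⁻ x, ‖(((b k).normed volume : Vec N → ℝ) ⋆[lsmul ℝ ℝ, volume] g) x
      - g x‖ₑ ^ p = ∫⁻ x, ‖(((b k).normed volume : Vec N → ℝ) ⋆[lsmul ℝ ℝ, volume] g') x
      - g' x‖ₑ ^ p := by
    intro k
    have h1 : ((b k).normed volume : Vec N → ℝ) ⋆[lsmul ℝ ℝ, volume] g =
        ((b k).normed volume : Vec N → ℝ) ⋆[lsmul ℝ ℝ, volume] g' :=
      convolution_congr _ (ae_eq_refl _) hgg'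
    rw [h1]
    refine lintegral_congr_ae ?_
    filter_upwards [hgg'] with x hx
    rw [hx]
  simp_rw [hcongr]
  have hT := tendsto_lintegral_translation_sub hp hg'
  rw [ENNReal.tendsto_nhds_zero] at hT ⊢
  intro ε hε
  obtain ⟨δ, hδ, hball⟩ := Metric.eventually_nhds_iff_ball.1 (hT ε hε)
  filter_upwards [hb.eventually (gt_mem_nhds hδ)] with k hk
  have := isProbabilityMeasure_withDensity_normed (b k)
  set π := (volume : Measure (Vec N)).withDensity fun h => ENNReal.ofReal ((b k).normed volume h)
  have hmeas : StronglyMeasurable fun q : Vec N × Vec N => g' (q.1 - q.2) - g' q.1 :=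
    (hgm.comp_measurable (measurable_fst.sub measurable_snd)).sub
      (hgm.comp_measurable measurable_fst)
  calc _ ≤ ∫⁻ x, ∫⁻ h, ‖g' (x - h) - g' x‖ₑ ^ p ∂π :=
        lintegral_mono fun x => enorm_convolution_sub_rpow_le hp (hg'.locallyIntegrable hp1) hgm _ x
    _ = ∫⁻ h, (∫⁻ x, ‖g' (x - h) - g' x‖ₑ ^ p) ∂π := by
        rw [lintegral_lintegral_swap]
        exact (hmeas.enorm.pow_const p).aemeasurable
    _ ≤ ∫⁻ h, ε ∂π := by
        refine lintegral_mono_ae ?_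
        rw [ae_withDensity_iff (b k).continuous_normed.measurable.ennreal_ofReal]
        refine Eventually.of_forall fun h hh => hball h ?_
        have h2 : h ∈ Function.support ((b k).normed volume) := by
          intro h0
          exact hh (by rw [h0, ENNReal.ofReal_zero])
        rw [(b k).support_normed_eq] at h2
        exact Metric.ball_subset_ball hk.le h2
    _ = ε := by simp

theorem integrable_smul_of_tsupport_subset {Ω : Set (Vec N)} {g : Vec N → E}
    (hg : LocallyIntegrableOn g Ω) {η : Vec N → ℝ} (hη : Continuous η) (hηc : HasCompactSupport η)
    (hηΩ : tsupport η ⊆ Ω) : Integrable fun x => η x • g x := by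
  have h1 : IntegrableOn (fun x => η x • g x) (tsupport η) :=
    (hg.integrableOn_compact_subset hηΩ hηc).continuousOn_smul hη.continuousOn hηc
  have h2 : Function.support (fun x => η x • g x) ⊆ tsupport η := by
    intro x hx
    by_contra hx'
    exact hx (by simp [image_eq_zero_of_notMem_tsupport hx'])
  rw [← integrable_indicator_iff (isClosed_tsupport η).measurableSet,
    indicator_eq_self.2 h2] at h1
  exact h1

end Mollification

/-! ### Weak gradients and their smooth approximation -/

section WeakGrad

open scoped Convolution
open ContinuousLinearMap (lsmul)

variable {N m : ℕ}

/-- The translated kernel y ↦ ρ(x - y) is an admissible test function because its support lies in K.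
The sign (-1)^j of integration by parts cancels the one from the reflection of the variable. -/
theorem iteratedFDeriv_convolution_indicator {Ω K : Set (Vec N)} {j : ℕ} {f : Vec N → Vec m}
    {G : Vec N → Tensor N m j} (h : HasWeakGrad Ω j f G) (hKΩ : K ⊆ Ω)
    (hΩ : MeasurableSet Ω)
    (hf : LocallyIntegrable (K.indicator f)) (hG : LocallyIntegrable (K.indicator G))
    (b : ContDiffBump (0 : Vec N)) {x : Vec N} (hx : Metric.closedBall x b.rOut ⊆ K) :
    iteratedFDeriv ℝ j ((b.normed volume : Vec N → ℝ) ⋆[lsmul ℝ ℝ, volume] (K.indicator f)) x =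
      ((b.normed volume : Vec N → ℝ) ⋆[lsmul ℝ ℝ, volume] (K.indicator G)) x := by
  set ρ : Vec N → ℝ := b.normed volume with hρdef
  have hρ : ContDiff ℝ ∞ ρ := b.contDiff_normed
  have hρc : HasCompactSupport ρ := b.hasCompactSupport_normed
  have htsupp : tsupport ρ = Metric.closedBall 0 b.rOut := b.tsupport_normed_eq
  have hmemK : ∀ t, x - t ∈ tsupport ρ → t ∈ K := by
    intro t ht
    rw [htsupp] at ht
    refine hx ?_
    rw [Metric.mem_closedBall, dist_comm, dist_eq_norm]
    simpa using ht
  ext1 v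
  rw [iteratedFDeriv_convolution_apply hf j ρ hρ hρc, convolution_eq_swap, convolution_eq_swap]
  have hint : Integrable fun t => lsmul ℝ ℝ (ρ (x - t)) (K.indicator G t) :=
    (hρc.convolutionExists_left (lsmul ℝ ℝ) b.continuous_normed hG x).integrable_swap
  rw [ContinuousMultilinearMap.integral_apply hint]
  have hη : ContDiff ℝ ∞ (fun y => ρ (x - y)) := hρ.comp (by fun_prop)
  have htη : tsupport (fun y => ρ (x - y)) ⊆ Metric.closedBall x b.rOut := by
    refine closure_minimal (fun y hy => ?_) Metric.isClosed_closedBall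
    have : x - y ∈ tsupport ρ := subset_tsupport _ hy
    rw [htsupp] at this
    rw [Metric.mem_closedBall, dist_comm, dist_eq_norm]
    simpa using this
  have hηc : HasCompactSupport (fun y => ρ (x - y)) :=
    (isCompact_closedBall x b.rOut).of_isClosed_subset (isClosed_tsupport _) htη
  have key := h.2.2 _ hη hηc (htη.trans (hx.trans hKΩ)) v
  have hL : ∫ t, lsmul ℝ ℝ (iteratedFDeriv ℝ j ρ (x - t) v) (K.indicator f t) =
      ∫ t in Ω, iteratedFDeriv ℝ j ρ (x - t) v • f t := by
    rw [← integral_indicator hΩ]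
    refine integral_congr_ae (Eventually.of_forall fun t => ?_)
    by_cases ht : t ∈ K
    · simp [ht, hKΩ ht]
    · have h0 : iteratedFDeriv ℝ j ρ (x - t) = 0 := by
        by_contra h0
        exact ht (hmemK t (support_iteratedFDeriv_subset j h0))
      simp [ht, h0, indicator]
  have hR : ∫ t, (lsmul ℝ ℝ (ρ (x - t)) (K.indicator G t)) v =
      ∫ t in Ω, ρ (x - t) • G t v := by
    rw [← integral_indicator hΩ]
    refine integral_congr_ae (Eventually.of_forall fun t => ?_)
    by_cases ht : t ∈ K
    · simp [ht, hKΩ ht]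
    · have h0 : ρ (x - t) = 0 := by
        by_contra h0
        exact ht (hmemK t (subset_tsupport _ h0))
      simp [ht, h0, indicator]
  rw [hL, hR, key]
  simp_rw [iteratedFDeriv_comp_sub_left_apply hρ]
  simp only [smul_apply, smul_assoc]
  rw [integral_smul, smul_smul, ← mul_pow]
  simp

/-- The fundamental lemma of the calculus of variations, applied to the difference of two weak
gradients. -/
theorem HasWeakGrad.ae_eq {Ω : Set (Vec N)} (hΩ : IsOpen Ω) {j : ℕ} {f : Vec N → Vec m}
    {G G' : Vec N → Tensor N m j} (h : HasWeakGrad Ω j f G) (h' : HasWeakGrad Ω j f G') :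
    G =ᵐ[volume.restrict Ω] G' := by
  have hloc : LocallyIntegrableOn (fun x => G x - G' x) Ω := h.2.1.sub h'.2.1
  have := IsOpen.ae_eq_zero_of_integral_contDiff_smul_eq_zero hΩ hloc (fun η hη hηc hηΩ => ?_)
  · rw [EventuallyEq, ae_restrict_iff' hΩ.measurableSet]
    filter_upwards [this] with x hx hxΩ
    exact sub_eq_zero.1 (hx hxΩ)
  have hint : ∀ G'' : Vec N → Tensor N m j, LocallyIntegrableOn G'' Ω →
      Integrable fun x => η x • G'' x := by
    intro G'' hG''
    exact integrable_smul_of_tsupport_subset hG'' hη.continuous hηc hηΩ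
  ext1 v
  simp_rw [smul_sub]
  rw [integral_sub (hint G h.2.1) (hint G' h'.2.1)]
  have e : ∀ G'' : Vec N → Tensor N m j, HasWeakGrad Ω j f G'' →
      (∫ x, η x • G'' x) v = (-1 : ℝ) ^ j • ∫ x in Ω, iteratedFDeriv ℝ j η x v • f x := by
    intro G'' hG''
    rw [ContinuousMultilinearMap.integral_apply (hint G'' hG''.2.1), ← hG''.2.2 η hη hηc hηΩ v]
    refine (setIntegral_eq_integral_of_forall_compl_eq_zero fun x hx => ?_).symm
    have : η x = 0 := by
      by_contra h0
      exact hx (hηΩ (subset_tsupport _ h0))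
    simp [this]
  rw [sub_apply, e G h, e G' h', sub_self]
  rfl

/-- The gradient selected by choice need not be the one known to be locally in L^p, but uniqueness
transfers the integrability. -/
theorem weakGrad_spec {Ω : Set (Vec N)} (hΩ : IsOpen Ω) {n : ℕ} {p : ℝ} {f : Vec N → Vec m}
    (h : MemSobolevLoc n p Ω f) {j : ℕ} (h1 : 1 ≤ j) (hj : j ≤ n) :
    HasWeakGrad Ω j f (weakGrad Ω j f) ∧ MemLpLoc p Ω (weakGrad Ω j f) := by
  obtain ⟨G, hG, hGp⟩ := h.2 j h1 hj
  have hex : ∃ G : Vec N → Tensor N m j, HasWeakGrad Ω j f G := ⟨G, hG⟩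
  have hw : HasWeakGrad Ω j f (weakGrad Ω j f) := by
    rw [weakGrad, dif_pos hex]
    exact hex.choose_spec
  refine ⟨hw, fun K hK hKΩ => ?_⟩
  refine (memLp_congr_ae ?_).1 (hGp K hK hKΩ)
  exact ae_restrict_of_ae_restrict_of_subset hKΩ (hG.ae_eq hΩ hw)

/-- Local approximation of a Sobolev function by smooth functions. -/
theorem exists_smooth_approx {p : ℝ} (hp : 1 ≤ p) {Ω K Q : Set (Vec N)} (hΩ : IsOpen Ω)
    (hK : IsCompact K) (hKΩ : K ⊆ Ω) (hQ : MeasurableSet Q) {r : ℝ} (hr : 0 < r)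
    (hQK : ∀ x ∈ Q, Metric.closedBall x r ⊆ K) {n : ℕ} {f : Vec N → Vec m}
    (hf : MemSobolevLoc n p Ω f) :
    ∃ u : ℕ → Vec N → Vec m, (∀ k, ContDiff ℝ ∞ (u k)) ∧
      Tendsto (fun k => ∫⁻ x in Q, ‖u k x - f x‖ₑ ^ p) atTop (𝓝 0) ∧
      (∀ᵐ x ∂(volume.restrict Q), Tendsto (fun k => u k x) atTop (𝓝 (f x))) ∧
      ∀ j, 1 ≤ j → j ≤ n →
        Tendsto (fun k => ∫⁻ x in Q, ‖iteratedFDeriv ℝ j (u k) x - weakGrad Ω j f x‖ₑ ^ p)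
          atTop (𝓝 0) ∧
        ∀ᵐ x ∂(volume.restrict Q),
          Tendsto (fun k => iteratedFDeriv ℝ j (u k) x) atTop (𝓝 (weakGrad Ω j f x)) := by
  have hp1 : 1 ≤ ENNReal.ofReal p := by simpa using ENNReal.ofReal_le_ofReal hp
  have hQK' : Q ⊆ K := fun x hx => hQK x hx (Metric.mem_closedBall_self hr.le)
  -- The bounded ratio 2 of the outer to the inner radius is what gives convergence at almost every
  -- point. Outer radii at most r keep the kernels inside K for base points in Q.
  let b : ℕ → ContDiffBump (0 : Vec N) := fun k =>
    ⟨r / 2 / ((k : ℝ) + 1), r / ((k : ℝ) + 1), by positivity, by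
      have : (0 : ℝ) < (k : ℝ) + 1 := by positivity
      gcongr; linarith⟩
  have hb : Tendsto (fun k => (b k).rOut) atTop (𝓝 0) := by
    have := tendsto_one_div_add_atTop_nhds_zero_nat (𝕜 := ℝ) |>.const_mul r
    simpa [b, div_eq_mul_inv] using this
  have hb2 : ∀ k, (b k).rOut ≤ 2 * (b k).rIn := by
    intro k
    refine le_of_eq ?_
    change r / ((k : ℝ) + 1) = 2 * (r / 2 / ((k : ℝ) + 1))
    ring
  have hbr : ∀ k, (b k).rOut ≤ r := by
    intro k
    exact div_le_self hr.le (by linarith [Nat.cast_nonneg (α := ℝ) k])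
  have hgen : ∀ {W : Type} [NormedAddCommGroup W] [NormedSpace ℝ W] [CompleteSpace W]
      (g : Vec N → W), MemLpLoc p Ω g →
      Tendsto (fun k => ∫⁻ x in Q, ‖(((b k).normed volume : Vec N → ℝ) ⋆[lsmul ℝ ℝ, volume]
        (K.indicator g)) x - g x‖ₑ ^ p) atTop (𝓝 0) ∧
      (∀ᵐ x ∂(volume.restrict Q), Tendsto (fun k => (((b k).normed volume : Vec N → ℝ)
        ⋆[lsmul ℝ ℝ, volume] (K.indicator g)) x) atTop (𝓝 (g x))) ∧
      LocallyIntegrable (K.indicator g) := by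
    intro W _ _ _ g hg
    have hmem : MemLp (K.indicator g) (ENNReal.ofReal p) volume :=
      (memLp_indicator_iff_restrict hK.measurableSet).2 (hg K hK hKΩ)
    have hloc := hmem.locallyIntegrable hp1
    refine ⟨?_, ?_, hloc⟩
    · refine tendsto_of_tendsto_of_tendsto_of_le_of_le tendsto_const_nhds
        (tendsto_lintegral_convolution_sub hp hmem hb) (fun _ => zero_le) fun k => ?_
      refine le_trans (le_of_eq ?_) (setLIntegral_le_lintegral Q _)
      refine setLIntegral_congr_fun hQ fun x hx => ?_
      simp [hQK' hx]
    · rw [ae_restrict_iff' hQ]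
      filter_upwards [ContDiffBump.ae_convolution_tendsto_right_of_locallyIntegrable hb
        (Eventually.of_forall hb2) hloc] with x hx hxQ
      simpa [hQK' hxQ] using hx
  obtain ⟨h1, h2, h3⟩ := hgen f hf.1
  refine ⟨fun k => ((b k).normed volume : Vec N → ℝ) ⋆[lsmul ℝ ℝ, volume] (K.indicator f),
    fun k => (b k).hasCompactSupport_normed.contDiff_convolution_left _ (b k).contDiff_normed h3,
    h1, h2, fun j hj1 hjn => ?_⟩
  obtain ⟨hw, hwp⟩ := weakGrad_spec hΩ hf hj1 hjn
  obtain ⟨h4, h5, h6⟩ := hgen (weakGrad Ω j f) hwp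
  have heq : ∀ k, ∀ x ∈ Q, iteratedFDeriv ℝ j (((b k).normed volume : Vec N → ℝ)
      ⋆[lsmul ℝ ℝ, volume] (K.indicator f)) x = (((b k).normed volume : Vec N → ℝ)
      ⋆[lsmul ℝ ℝ, volume] (K.indicator (weakGrad Ω j f))) x := fun k x hx =>
    iteratedFDeriv_convolution_indicator hw hKΩ hΩ.measurableSet h3 h6 (b k)
      ((Metric.closedBall_subset_closedBall (hbr k)).trans (hQK x hx))
  refine ⟨h4.congr fun k => setLIntegral_congr_fun hQ fun x hx => ?_, ?_⟩
  · simp only [heq k x hx]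
  · rw [ae_restrict_iff' hQ] at h5 ⊢
    filter_upwards [h5] with x hx hxQ
    simp_rw [heq _ x hxQ]
    exact hx hxQ

end WeakGrad

/-! ### Cubes spanned by an orthonormal basis -/

section Box

variable {N : ℕ}

/-- The open cube of side `2a` spanned by an orthonormal basis. -/
def box (ν : OrthonormalBasis (Fin N) ℝ (Vec N)) (a : ℝ) : Set (Vec N) :=
  {z | ∀ j : Fin N, |inner ℝ z (ν j)| < a}

variable (ν : OrthonormalBasis (Fin N) ℝ (Vec N))

theorem isOpen_box (a : ℝ) : IsOpen (box ν a) := by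
  have : box ν a = ⋂ j, {z | |inner ℝ z (ν j)| < a} := by ext; simp [box]
  rw [this]
  exact isOpen_iInter_of_finite fun j => isOpen_lt (by fun_prop) continuous_const

theorem box_mono {a b : ℝ} (h : a ≤ b) : box ν a ⊆ box ν b := fun _ hz j => (hz j).trans_le h

theorem abs_inner_basis_le (z : Vec N) (j : Fin N) : |inner ℝ z (ν j)| ≤ ‖z‖ := by
  simpa using abs_real_inner_le_norm z (ν j)

theorem add_mem_box {a κ : ℝ} {z h : Vec N} (hz : z ∈ box ν a) (hh : ‖h‖ ≤ κ) :
    z + h ∈ box ν (a + κ) := by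
  intro j
  rw [inner_add_left]
  exact (abs_add_le _ _).trans_lt (add_lt_add_of_lt_of_le (hz j) ((abs_inner_basis_le ν h j).trans hh))

theorem volume_setOf_inner_mem (S : Fin N → Set ℝ) (hS : ∀ j, MeasurableSet (S j)) :
    volume {z : Vec N | ∀ j, inner ℝ z (ν j) ∈ S j} = ∏ j, volume (S j) := by
  have h1 := (EuclideanSpace.volume_preserving_symm_measurableEquiv_toLp (Fin N)).comp
    ν.measurePreserving_repr
  have h2 : {z : Vec N | ∀ j, inner ℝ z (ν j) ∈ S j} =
      ((MeasurableEquiv.toLp 2 (Fin N → ℝ)).symm ∘ ν.repr) ⁻¹' (Set.pi univ S) := by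
    ext z
    simp [ν.repr_apply_apply, real_inner_comm]
  rw [h2, h1.measure_preimage (MeasurableSet.univ_pi hS).nullMeasurableSet, volume_pi_pi]

theorem setLIntegral_comp_add_smul (x : Vec N) {ε : ℝ} (hε : 0 < ε) (A : Set (Vec N))
    (f : Vec N → ℝ≥0∞) :
    ENNReal.ofReal (ε ^ N) * ∫⁻ z in (fun z => x + ε • z) ⁻¹' A, f (x + ε • z) =
      ∫⁻ y in A, f y := by
  have hemb : MeasurableEmbedding (fun z : Vec N => x + ε • z) :=
    (measurableEmbedding_addLeft x).comp (measurableEmbedding_const_smul₀ hε.ne')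
  have hmap : (volume : Measure (Vec N)).map (fun z : Vec N => x + ε • z) =
      ENNReal.ofReal (ε ^ N)⁻¹ • volume := by
    have : (fun z : Vec N => x + ε • z) = (fun z => x + z) ∘ (fun z => ε • z) := rfl
    rw [this, ← Measure.map_map (by fun_prop) (by fun_prop)]
    rw [Measure.map_addHaar_smul volume hε.ne', Measure.map_smul, map_add_left_eq_self,
      finrank_euclideanSpace_fin, abs_of_pos (by positivity)]
  have h1 : ∫⁻ z in (fun z => x + ε • z) ⁻¹' A, f (x + ε • z) =
      ENNReal.ofReal (ε ^ N)⁻¹ * ∫⁻ y in A, f y := by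
    rw [← hemb.lintegral_map f, ← hemb.restrict_map, hmap, Measure.restrict_smul,
      lintegral_smul_measure, smul_eq_mul]
  rw [h1, ← mul_assoc, ← ENNReal.ofReal_mul (by positivity), mul_inv_cancel₀ (by positivity)]
  simp

end Box

/-! ### Periodising a map into a competitor for the cell problem -/

section Profile

/-- Near a point either the nearest integer does not change, or the coordinate is farther than b
from both candidates; a function supported within distance b of the lattice points then vanishes for
either choice. -/
theorem round_eq_or_lt {t t' b : ℝ} (h : |t' - t| < 1 / 2 - b) :
    round t' = round t ∨ (b < |t' - round t| ∧ b < |t' - round t'|) := by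
  by_cases hr : round t' = round t
  · exact Or.inl hr
  right
  have h1 : (1 : ℝ) ≤ |(round t' : ℝ) - round t| := by
    exact_mod_cast Int.one_le_abs (sub_ne_zero.2 hr)
  have h2 := round_le t' (round t)
  have h3 := round_le t (round t')
  have h4 : |(round t' : ℝ) - round t| ≤ |t' - round t'| + |t' - round t| := by
    rw [abs_sub_comm t' (round t')]; exact abs_sub_le _ _ _
  have h5 : |(round t' : ℝ) - round t| ≤ |t - round t'| + |t - round t| := by
    rw [abs_sub_comm t (round t')]; exact abs_sub_le _ _ _
  have h6 : |t - round t'| ≤ |t' - t| + |t' - round t'| := by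
    rw [abs_sub_comm t' t]; exact abs_sub_le _ _ _
  have h7 := abs_nonneg (t' - t)
  constructor <;> linarith

variable {N m n : ℕ} [NeZero N]

/-- Reduction modulo the lattice spanned by all basis vectors but the first. -/
noncomputable def reduce (ν : OrthonormalBasis (Fin N) ℝ (Vec N)) (y : Vec N) : Vec N :=
  y - ∑ j, (if j = 0 then 0 else (round (inner ℝ y (ν j) : ℝ) : ℝ)) • ν j

variable (ν : OrthonormalBasis (Fin N) ℝ (Vec N))

omit [NeZero N] in
theorem inner_sum_smul_basis (c : Fin N → ℝ) (j : Fin N) :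
    inner ℝ (∑ i, c i • ν i) (ν j) = c j := by
  simp [sum_inner, inner_smul_left, ν.inner_eq_ite]

theorem inner_reduce (y : Vec N) (j : Fin N) : inner ℝ (reduce ν y) (ν j) =
    inner ℝ y (ν j) - if j = 0 then 0 else (round (inner ℝ y (ν j) : ℝ) : ℝ) := by
  rw [reduce, inner_sub_left, inner_sum_smul_basis]

theorem reduce_add_basis (y : Vec N) {j : Fin N} (hj : j ≠ 0) :
    reduce ν (y + ν j) = reduce ν y := by
  refine InnerProductSpace.ext_inner_right_basis ν.toBasis fun i => ?_
  simp only [OrthonormalBasis.coe_toBasis, inner_reduce, inner_add_left, ν.inner_eq_ite]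
  by_cases hi : i = 0
  · simp [hi, hj]
  · by_cases hij : j = i
    · simp [hi, hij]
    · simp [hi, hij]

theorem reduce_eq_self {y : Vec N} (hy : y ∈ cube ν) : reduce ν y = y := by
  rw [reduce, sub_eq_self]
  refine Finset.sum_eq_zero fun j _ => ?_
  have h1 := hy j
  have : round (inner ℝ y (ν j) : ℝ) = 0 := by
    rw [abs_lt] at h1
    rw [round_eq_zero_iff]
    exact ⟨by linarith [h1.1], h1.2⟩
  simp [this]

/-- `reduce` jumps across the faces of the cells, but `h (R • ·)` vanishes near them because a < R /
2. Near y₀ one may therefore subtract the fixed lattice vector v: where `reduce` subtracts a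
different one, both expressions are zero. -/
theorem contDiff_comp_reduce {h : Vec N → Vec m} {k : ℕ∞ω} (hh : ContDiff ℝ k h) {a R : ℝ}
    (hR : 0 < R) (haR : a < R / 2) (hsupp : ∀ z, z ∉ box ν a → h z = 0) :
    ContDiff ℝ k fun y => h (R • reduce ν y) := by
  rw [contDiff_iff_contDiffAt]
  intro y₀
  let v : Vec N := ∑ j, (if j = 0 then 0 else (round (inner ℝ y₀ (ν j) : ℝ) : ℝ)) • ν j
  have hsm : ContDiffAt ℝ k (fun y => h (R • (y - v))) y₀ :=
    (hh.comp (by fun_prop : ContDiff ℝ k fun y : Vec N => R • (y - v))).contDiffAt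
  refine hsm.congr_of_eventuallyEq ?_
  have hb : 0 < 1 / 2 - a / R := by
    rw [sub_pos, div_lt_iff₀ hR]; linarith
  filter_upwards [Metric.ball_mem_nhds y₀ hb] with y hy
  have hzero : ∀ z : Vec N, (∃ j, a / R < |inner ℝ z (ν j)|) → h (R • z) = 0 := by
    rintro z ⟨j, hj⟩
    refine hsupp _ fun hz => ?_
    have := hz j
    rw [inner_smul_left, abs_mul] at this
    simp only [conj_trivial, abs_of_pos hR] at this
    rw [div_lt_iff₀ hR] at hj
    linarith
  by_cases hall : ∀ j, j ≠ 0 → round (inner ℝ y (ν j) : ℝ) = round (inner ℝ y₀ (ν j) : ℝ)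
  · have : reduce ν y = y - v := by
      rw [reduce]
      congr 1
      refine Finset.sum_congr rfl fun j _ => ?_
      by_cases hj : j = 0
      · simp [hj]
      · simp [hj, hall j hj]
    rw [this]
  · push Not at hall
    obtain ⟨j, hj, hne⟩ := hall
    have hd : |(inner ℝ y (ν j) : ℝ) - inner ℝ y₀ (ν j)| < 1 / 2 - a / R := by
      rw [← inner_sub_left]
      refine (abs_inner_basis_le ν _ j).trans_lt ?_
      rwa [← dist_eq_norm]
    obtain h1 | ⟨h1, h2⟩ := round_eq_or_lt hd
    · exact absurd h1 hne
    rw [hzero _ ⟨j, by rw [inner_reduce, if_neg hj]; exact h2⟩, hzero _ ⟨j, ?_⟩]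
    rw [inner_sub_left, inner_sum_smul_basis, if_neg hj]
    exact h1

/-- The jet of a map: its derivatives of order `1, …, n`. -/
noncomputable def jet (n : ℕ) (f : Vec N → Vec m) (z : Vec N) : Jet N m n :=
  fun j => iteratedFDeriv ℝ ((j : ℕ) + 1) f z

/-- The competitor is ζ(y) = χ(Ry) + h(R · `reduce ν y`) with L = 1/R: h is made periodic, χ already
is since it depends only on the normal coordinate. The factors L^j cancel those of the chain rule,
and R^{N-1} together with 1/L = R is the Jacobian R^N. The bound R ≥ 2 squeezes the transition of χ
into |y · ν₁| ≤ 1/2. -/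
theorem mul_cellEnergy_le {F : Jet N m n → Vec m → Vec N → ℝ} {aplus aminus : Vec m} {x : Vec N}
    {χ h : Vec N → Vec m} (hχ : ContDiff ℝ n χ) (hh : ContDiff ℝ n h) {a R : ℝ}
    (hR : 2 ≤ R) (haR : a < R / 2) (hsupp : ∀ z, z ∉ box ν a → h z = 0)
    (hplus : ∀ z, 1 ≤ inner ℝ z (ν 0) → χ z = aplus)
    (hminus : ∀ z, inner ℝ z (ν 0) ≤ -1 → χ z = aminus)
    (hinv : ∀ z (j : Fin N) (t : ℝ), j ≠ 0 → χ (z + t • ν j) = χ z) :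
    ENNReal.ofReal (R ^ (N - 1)) * cellEnergy F aplus aminus ν x ≤
      ∫⁻ z in box ν (R / 2), ENNReal.ofReal (F (jet n (χ + h) z) ((χ + h) z) x) := by
  have hR0 : 0 < R := by linarith
  let ζ : Vec N → Vec m := fun y => χ (R • y) + h (R • reduce ν y)
  have hζ : ζ ∈ profiles n aplus aminus ν := by
    have hz0 : ∀ y : Vec N, 1 / 2 ≤ |inner ℝ y (ν 0)| → h (R • reduce ν y) = 0 := by
      intro y hy
      refine hsupp _ fun hz => ?_
      have := hz 0
      rw [inner_smul_left, inner_reduce, abs_mul] at this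
      simp only [conj_trivial, abs_of_pos hR0, if_true, sub_zero] at this
      nlinarith
    refine ⟨(hχ.comp (by fun_prop)).add (contDiff_comp_reduce ν hh hR0 haR hsupp), ?_, ?_, ?_⟩
    · intro y hy
      simp only [ζ]
      rw [hz0 y (le_abs.2 (Or.inr (by linarith))), add_zero]
      refine hminus _ ?_
      rw [inner_smul_left]; simp only [conj_trivial]
      nlinarith
    · intro y hy
      simp only [ζ]
      rw [hz0 y (le_abs.2 (Or.inl (by linarith))), add_zero]
      refine hplus _ ?_
      rw [inner_smul_left]; simp only [conj_trivial]
      nlinarith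
    · intro j hj y
      simp only [ζ]
      rw [reduce_add_basis ν y hj, smul_add, hinv _ j R hj]
  have hL : 0 < 1 / R := by positivity
  have h1 : cellEnergy F aplus aminus ν x ≤ ENNReal.ofReal (1 / (1 / R)) *
      ∫⁻ y in cube ν, ENNReal.ofReal
        (F (fun j => (1 / R) ^ ((j : ℕ) + 1) • iteratedFDeriv ℝ ((j : ℕ) + 1) ζ y) (ζ y) x) :=
    iInf₂_le_of_le (1 / R) hL (iInf₂_le ζ hζ)
  have hopen : IsOpen (cube ν) := isOpen_box ν (1 / 2)
  have heq : ∀ y ∈ cube ν, ζ y = (χ + h) (R • y) := by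
    intro y hy
    simp [ζ, reduce_eq_self ν hy]
  have hjet : ∀ y ∈ cube ν, ∀ j : Fin n,
      (1 / R) ^ ((j : ℕ) + 1) • iteratedFDeriv ℝ ((j : ℕ) + 1) ζ y = jet n (χ + h) (R • y) j := by
    intro y hy j
    have h2 : ζ =ᶠ[𝓝 y] fun y => (χ + h) (R • y) := by
      filter_upwards [hopen.mem_nhds hy] with y' hy' using heq y' hy'
    have hc : ContDiff ℝ ((j : ℕ) + 1 : ℕ) (χ + h) :=
      (hχ.add hh).of_le (by exact_mod_cast j.2)
    rw [(h2.iteratedFDeriv ℝ _).eq_of_nhds, iteratedFDeriv_comp_const_smul R hc, smul_smul,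
      ← mul_pow, one_div, inv_mul_cancel₀ hR0.ne', one_pow, one_smul]
    rfl
  have h2 : ∫⁻ y in cube ν, ENNReal.ofReal
        (F (fun j => (1 / R) ^ ((j : ℕ) + 1) • iteratedFDeriv ℝ ((j : ℕ) + 1) ζ y) (ζ y) x) =
      ∫⁻ y in cube ν, ENNReal.ofReal (F (jet n (χ + h) (R • y)) ((χ + h) (R • y)) x) := by
    refine setLIntegral_congr_fun hopen.measurableSet fun y hy => ?_
    simp only [heq y hy]
    congr 3
    funext j
    exact hjet y hy j
  have h3 : ∀ f : Vec N → ℝ≥0∞, ENNReal.ofReal (R ^ N) * ∫⁻ y in cube ν, f (R • y) =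
      ∫⁻ z in box ν (R / 2), f z := by
    intro f
    have := setLIntegral_comp_add_smul 0 hR0 (box ν (R / 2)) f
    simp only [zero_add] at this
    rw [← this]
    congr 3
    ext y
    simp only [cube, box, mem_ofPred_eq, mem_preimage, inner_smul_left, conj_trivial, abs_mul,
      abs_of_pos hR0]
    refine forall_congr' fun j => ?_
    rw [← lt_div_iff₀' hR0]
    congr! 1
    field_simp
  rw [h2, one_div_one_div] at h1
  calc _ ≤ ENNReal.ofReal (R ^ (N - 1)) * (ENNReal.ofReal R *
      ∫⁻ y in cube ν, ENNReal.ofReal (F (jet n (χ + h) (R • y)) ((χ + h) (R • y)) x)) := by gcongr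
    _ = _ := by
      rw [← mul_assoc, ← ENNReal.ofReal_mul (by positivity), ← pow_succ, Nat.sub_add_cancel
        (NeZero.one_le)]
      exact h3 fun z => ENNReal.ofReal (F (jet n (χ + h) z) ((χ + h) z) x)

end Profile

/-! ### Volumes of shells and of the transition strip -/

section Volumes

variable {N : ℕ} (ν : OrthonormalBasis (Fin N) ℝ (Vec N))

theorem prod_ofReal_le_pow_mul {ι : Type*} [DecidableEq ι] (s : Finset ι) (f : ι → ℝ≥0∞) {R b : ℝ}
    (hR : 0 ≤ R) (hb : 0 ≤ b) {j : ι} (hj : j ∈ s)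
    (hf : ∀ i ∈ s, f i ≤ ENNReal.ofReal R) (hfj : f j ≤ ENNReal.ofReal b) :
    ∏ i ∈ s, f i ≤ ENNReal.ofReal (b * R ^ (s.card - 1)) := by
  rw [← Finset.mul_prod_erase s f hj, ENNReal.ofReal_mul hb, ENNReal.ofReal_pow hR,
    ← Finset.card_erase_of_mem hj]
  gcongr
  exact Finset.prod_le_pow_card _ _ _ fun i hi => hf i (Finset.mem_of_mem_erase hi)

theorem volume_abs_lt (R : ℝ) : volume {t : ℝ | |t| < R / 2} ≤ ENNReal.ofReal R := by
  have : {t : ℝ | |t| < R / 2} = Ioo (-(R / 2)) (R / 2) := by ext t; simp [abs_lt]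
  rw [this, Real.volume_Ioo]
  apply ENNReal.ofReal_le_ofReal; linarith

theorem measurableSet_le_abs_lt (a b : ℝ) : MeasurableSet {t : ℝ | a ≤ |t| ∧ |t| < b} := by
  have h1 : MeasurableSet {t : ℝ | a ≤ |t|} := measurableSet_le measurable_const continuous_abs.measurable
  exact h1.inter (measurableSet_lt continuous_abs.measurable measurable_const)

theorem volume_le_abs_lt {a b : ℝ} (hab : a ≤ b) :
    volume {t : ℝ | a ≤ |t| ∧ |t| < b} ≤ ENNReal.ofReal (2 * (b - a)) := by
  have : {t : ℝ | a ≤ |t| ∧ |t| < b} ⊆ Icc a b ∪ Icc (-b) (-a) := by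
    rintro t ⟨h1, h2⟩
    rw [abs_lt] at h2
    rcases le_abs.1 h1 with h | h
    · exact Or.inl ⟨h, h2.2.le⟩
    · exact Or.inr ⟨h2.1.le, by linarith⟩
  refine (measure_mono this).trans ((measure_union_le _ _).trans ?_)
  rw [Real.volume_Icc, Real.volume_Icc, ← ENNReal.ofReal_add (by linarith) (by linarith)]
  apply ENNReal.ofReal_le_ofReal; linarith

theorem volume_box_diff_le {a b R : ℝ} (hR : 0 ≤ R) (hab : a ≤ b) (hbR : b ≤ R / 2) :
    volume (box ν b \ box ν a) ≤ ENNReal.ofReal (2 * N * (b - a) * R ^ (N - 1)) := by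
  classical
  let S : Fin N → Fin N → Set ℝ := fun j i =>
    if i = j then {t | a ≤ |t| ∧ |t| < b} else {t | |t| < R / 2}
  have hS : ∀ j i, MeasurableSet (S j i) := by
    intro j i
    by_cases h : i = j <;> simp only [S, h, if_true, if_false]
    · exact measurableSet_le_abs_lt _ _
    · exact measurableSet_lt (by fun_prop) measurable_const
  have hsub : box ν b \ box ν a ⊆ ⋃ j, {z : Vec N | ∀ i, inner ℝ z (ν i) ∈ S j i} := by
    rintro z ⟨hzb, hza⟩
    simp only [box, mem_ofPred_eq, not_forall, not_lt] at hza
    obtain ⟨j, hj⟩ := hza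
    refine mem_iUnion.2 ⟨j, fun i => ?_⟩
    by_cases h : i = j
    · subst h
      simp only [S, if_true]
      exact ⟨hj, hzb i⟩
    · simp only [S, h, if_false]
      exact (hzb i).trans_le hbR
  refine (measure_mono hsub).trans ((measure_iUnion_fintype_le _ _).trans ?_)
  calc _ ≤ ∑ j : Fin N, ENNReal.ofReal (2 * (b - a) * R ^ (N - 1)) := by
        refine Finset.sum_le_sum fun j _ => ?_
        rw [volume_setOf_inner_mem ν _ (hS j)]
        refine (prod_ofReal_le_pow_mul Finset.univ _ hR (b := 2 * (b - a)) (by linarith)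
          (Finset.mem_univ j) (fun i _ => ?_) ?_).trans (by simp)
        · by_cases h : i = j
          · simp only [S, h, if_true]
            exact (measure_mono fun t ht => lt_of_lt_of_le ht.2 hbR).trans (volume_abs_lt R)
          · simp only [S, h, if_false]
            exact volume_abs_lt R
        · simp only [S, if_true]
          exact volume_le_abs_lt hab
    _ = _ := by
        rw [Finset.sum_const, Finset.card_univ, Fintype.card_fin, nsmul_eq_mul,
          ← ENNReal.ofReal_natCast, ← ENNReal.ofReal_mul (by positivity)]
        ring_nf

variable [NeZero N]

/-- The strip where the transition between the two values takes place. -/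
def strip : Set (Vec N) := {z | |inner ℝ z (ν 0)| ≤ 1}

theorem measurableSet_strip : MeasurableSet (strip ν) :=
  (isClosed_le (by fun_prop) continuous_const).measurableSet

theorem volume_abs_le_one : volume {t : ℝ | |t| ≤ 1} ≤ ENNReal.ofReal 2 := by
  have : {t : ℝ | |t| ≤ 1} = Icc (-1) 1 := by ext t; simp [abs_le]
  rw [this, Real.volume_Icc]
  norm_num

theorem volume_strip_inter_box_le {R : ℝ} (hR : 0 ≤ R) :
    volume (strip ν ∩ box ν (R / 2)) ≤ ENNReal.ofReal (2 * R ^ (N - 1)) := by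
  classical
  let S : Fin N → Set ℝ := fun i => if i = 0 then {t | |t| ≤ 1} else {t | |t| < R / 2}
  have hS : ∀ i, MeasurableSet (S i) := by
    intro i
    by_cases h : i = 0 <;> simp only [S, h, if_true, if_false]
    · exact measurableSet_le (by fun_prop) measurable_const
    · exact measurableSet_lt (by fun_prop) measurable_const
  have hsub : strip ν ∩ box ν (R / 2) ⊆ {z : Vec N | ∀ i, inner ℝ z (ν i) ∈ S i} := by
    rintro z ⟨hz0, hzb⟩ i
    by_cases h : i = 0
    · subst h
      simp only [S, if_true]
      exact hz0
    · simp only [S, h, if_false]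
      exact hzb i
  refine (measure_mono hsub).trans ?_
  rw [volume_setOf_inner_mem ν _ hS, ← Finset.mul_prod_erase _ _ (Finset.mem_univ (0 : Fin N)),
    ENNReal.ofReal_mul (by norm_num), ENNReal.ofReal_pow hR]
  refine mul_le_mul' ?_ ((Finset.prod_le_pow_card _ _ (ENNReal.ofReal R) fun i hi => ?_).trans
    (by simp))
  · simp only [S, if_true]
    exact volume_abs_le_one
  · simp only [S, Finset.ne_of_mem_erase hi, if_false]
    exact volume_abs_lt R

/-- In the strip the normal coordinate is at most 1 < a, so leaving the smaller cube happens in a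
tangential direction. That coordinate has a range of length at most 2βR, the normal one at most 2,
and the other N - 2 at most R each. Compared with the whole strip this gains the small factor β. -/
theorem volume_strip_inter_box_diff_le {a R β : ℝ} (hR : 0 ≤ R) (hβ : 0 ≤ β) (ha : 1 < a)
    (haR : a ≤ R / 2) (haβ : R / 2 - a ≤ β * R) :
    volume (strip ν ∩ (box ν (R / 2) \ box ν a)) ≤
      ENNReal.ofReal (4 * N * β * R ^ (N - 1)) := by
  classical
  let S : Fin N → Fin N → Set ℝ := fun j i =>
    if i = 0 then {t | |t| ≤ 1} else
      if i = j then {t | a ≤ |t| ∧ |t| < R / 2} else {t | |t| < R / 2}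
  have hS : ∀ j i, MeasurableSet (S j i) := by
    intro j i
    simp only [S]
    split_ifs
    · exact measurableSet_le (by fun_prop) measurable_const
    · exact measurableSet_le_abs_lt _ _
    · exact measurableSet_lt (by fun_prop) measurable_const
  have hsub : strip ν ∩ (box ν (R / 2) \ box ν a) ⊆
      ⋃ j ∈ Finset.univ.erase (0 : Fin N), {z : Vec N | ∀ i, inner ℝ z (ν i) ∈ S j i} := by
    rintro z ⟨hz0, hzb, hza⟩
    simp only [box, mem_ofPred_eq, not_forall, not_lt] at hza
    obtain ⟨j, hj⟩ := hza
    have hj0 : j ≠ 0 := by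
      rintro rfl
      have : |(inner ℝ z (ν 0) : ℝ)| ≤ 1 := hz0
      linarith
    refine mem_iUnion₂.2 ⟨j, by simp [hj0], fun i => ?_⟩
    by_cases h : i = 0
    · subst h
      simp only [S, if_true]
      exact hz0
    · by_cases hij : i = j
      · subst hij
        simp only [S, h, if_true, if_false]
        exact ⟨hj, hzb i⟩
      · simp only [S, h, hij, if_false]
        exact hzb i
  refine (measure_mono hsub).trans ((measure_biUnion_finset_le _ _).trans ?_)
  calc _ ≤ ∑ j ∈ Finset.univ.erase (0 : Fin N), ENNReal.ofReal (4 * β * R ^ (N - 1)) := by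
        refine Finset.sum_le_sum fun j hj => ?_
        have hj0 : j ≠ 0 := Finset.ne_of_mem_erase hj
        have hN : 2 ≤ N := by
          have h1 := j.2
          have h2 : (j : ℕ) ≠ 0 := fun h => hj0 (Fin.ext h)
          omega
        rw [volume_setOf_inner_mem ν _ (hS j), ← Finset.mul_prod_erase _ _ (Finset.mem_univ (0 : Fin N))]
        have h1 : ∏ i ∈ Finset.univ.erase (0 : Fin N), volume (S j i) ≤
            ENNReal.ofReal ((2 * (β * R)) * R ^ (N - 1 - 1)) := by
          refine (prod_ofReal_le_pow_mul (Finset.univ.erase (0 : Fin N)) _ hR (b := 2 * (β * R))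
            (by positivity) hj (fun i hi => ?_) ?_).trans (by simp)
          · have hi0 := Finset.ne_of_mem_erase hi
            by_cases h : i = j
            · simp only [S, h, hj0, if_true, if_false]
              exact (measure_mono fun t ht => ht.2).trans (volume_abs_lt R)
            · simp only [S, h, hi0, if_false]
              exact volume_abs_lt R
          · simp only [S, hj0, if_true, if_false]
            exact (volume_le_abs_lt haR).trans (ENNReal.ofReal_le_ofReal (by linarith))
        have h0 : volume (S j 0) ≤ ENNReal.ofReal 2 := by
          simp only [S, if_true]
          exact volume_abs_le_one
        refine (mul_le_mul' h0 h1).trans (le_of_eq ?_)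
        rw [← ENNReal.ofReal_mul (by norm_num)]
        congr 1
        obtain ⟨k, rfl⟩ : ∃ k, N = k + 2 := ⟨N - 2, by omega⟩
        simp only [Nat.add_sub_cancel, show k + 2 - 1 = k + 1 by omega, pow_succ]
        ring
    _ ≤ ∑ j : Fin N, ENNReal.ofReal (4 * β * R ^ (N - 1)) :=
        Finset.sum_le_sum_of_subset (Finset.erase_subset _ _)
    _ = _ := by
        rw [Finset.sum_const, Finset.card_univ, Fintype.card_fin, nsmul_eq_mul,
          ← ENNReal.ofReal_natCast, ← ENNReal.ofReal_mul (by positivity)]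
        ring_nf

end Volumes

/-! ### The smooth transition profile χ -/

section Transition

variable {N m : ℕ} [NeZero N] (ν : OrthonormalBasis (Fin N) ℝ (Vec N)) (aplus aminus : Vec m)

/-- A smooth transition between the two values, depending only on the first coordinate. -/
noncomputable def transition (z : Vec N) : Vec m :=
  aminus + Real.smoothTransition ((inner ℝ z (ν 0) + 1) / 2) • (aplus - aminus)

theorem contDiff_transition : ContDiff ℝ ∞ (transition ν aplus aminus) := by
  unfold transition
  refine contDiff_const.add (ContDiff.fun_smul ?_ contDiff_const)
  exact Real.smoothTransition.contDiff.comp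
    (((contDiff_id.inner ℝ contDiff_const).add contDiff_const).div_const 2)

variable {ν aplus aminus}

theorem transition_of_one_le {z : Vec N} (hz : 1 ≤ inner ℝ z (ν 0)) :
    transition ν aplus aminus z = aplus := by
  rw [transition, Real.smoothTransition.one_of_one_le (by linarith)]
  simp

theorem transition_of_le_neg_one {z : Vec N} (hz : inner ℝ z (ν 0) ≤ -1) :
    transition ν aplus aminus z = aminus := by
  rw [transition, Real.smoothTransition.zero_of_nonpos (by linarith)]
  simp

theorem transition_add_of_inner_eq_zero (z : Vec N) {w : Vec N} (hw : inner ℝ w (ν 0) = (0 : ℝ)) :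
    transition ν aplus aminus (z + w) = transition ν aplus aminus z := by
  rw [transition, transition, inner_add_left, hw, add_zero]

theorem norm_transition_sub_le (z : Vec N) (a : Vec m) (ha : a = aplus ∨ a = aminus) :
    ‖transition ν aplus aminus z - a‖ ≤ ‖aplus - aminus‖ := by
  have h0 := Real.smoothTransition.nonneg ((inner ℝ z (ν 0) + 1) / 2)
  have h1 := Real.smoothTransition.le_one ((inner ℝ z (ν 0) + 1) / 2)
  set t := Real.smoothTransition ((inner ℝ z (ν 0) + 1) / 2) with ht
  rcases ha with rfl | rfl
  · have : transition ν a aminus z - a = (t - 1) • (a - aminus) := by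
      rw [transition, ← ht, sub_smul, one_smul]; abel
    rw [this, norm_smul]
    refine mul_le_of_le_one_left (norm_nonneg _) ?_
    rw [Real.norm_eq_abs, abs_le]; constructor <;> linarith
  · have : transition ν aplus a z - a = t • (aplus - a) := by
      rw [transition, ← ht]; abel
    rw [this, norm_smul]
    refine mul_le_of_le_one_left (norm_nonneg _) ?_
    rw [Real.norm_eq_abs, abs_le]; constructor <;> linarith

theorem iteratedFDeriv_transition_eq_zero (j : ℕ) {z : Vec N} (hz : z ∉ strip ν) :
    iteratedFDeriv ℝ (j + 1) (transition ν aplus aminus) z = 0 := by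
  have hz' : 1 < |(inner ℝ z (ν 0) : ℝ)| := not_le.1 hz
  obtain ⟨a, ha⟩ : ∃ a : Vec m, transition ν aplus aminus =ᶠ[𝓝 z] fun _ => a := by
    rcases lt_abs.1 hz' with h | h
    · have hopen : IsOpen {z : Vec N | (1 : ℝ) < inner ℝ z (ν 0)} :=
        isOpen_lt continuous_const (by fun_prop)
      refine ⟨aplus, ?_⟩
      filter_upwards [hopen.mem_nhds h] with y hy using transition_of_one_le (le_of_lt hy)
    · have hopen : IsOpen {z : Vec N | (1 : ℝ) < -inner ℝ z (ν 0)} :=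
        isOpen_lt continuous_const (by fun_prop)
      refine ⟨aminus, ?_⟩
      filter_upwards [hopen.mem_nhds h] with y hy
      have hy : (1 : ℝ) < -inner ℝ y (ν 0) := hy
      exact transition_of_le_neg_one (by linarith)
  rw [(ha.iteratedFDeriv ℝ _).eq_of_nhds, iteratedFDeriv_succ_const]
  rfl

theorem transition_eq_of_notMem_strip {z : Vec N} (hz : z ∉ strip ν) :
    transition ν aplus aminus z = if 0 < (inner ℝ z (ν 0) : ℝ) then aplus else aminus := by
  have hz' : 1 < |(inner ℝ z (ν 0) : ℝ)| := not_le.1 hz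
  rcases lt_abs.1 hz' with h | h
  · rw [transition_of_one_le h.le, if_pos (by linarith)]
  · rw [transition_of_le_neg_one (by linarith), if_neg (by linarith)]

/-- Tangential translations leave the profile unchanged, and its derivatives of positive order
vanish off the strip; so they are bounded by their maximum on the segment [-1, 1] of the normal
axis. Order zero is bounded directly. -/
theorem exists_norm_iteratedFDeriv_transition_le (n : ℕ) :
    ∃ M : ℝ, 0 ≤ M ∧ ∀ j ≤ n, ∀ z, ‖iteratedFDeriv ℝ j (transition ν aplus aminus) z‖ ≤ M := by
  have hj : ∀ j, ∃ M : ℝ, 0 ≤ M ∧ ∀ z, ‖iteratedFDeriv ℝ j (transition ν aplus aminus) z‖ ≤ M := by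
    intro j
    rcases j with - | j
    · refine ⟨‖aplus‖ + ‖aplus - aminus‖, by positivity, fun z => ?_⟩
      rw [norm_iteratedFDeriv_zero]
      have h1 := norm_transition_sub_le (ν := ν) (aplus := aplus) (aminus := aminus) z aplus
        (Or.inl rfl)
      have h2 := norm_le_norm_add_norm_sub' (transition ν aplus aminus z) aplus
      linarith
    · have hc : Continuous (iteratedFDeriv ℝ (j + 1) (transition ν aplus aminus)) :=
        (contDiff_transition ν aplus aminus).continuous_iteratedFDeriv (by exact_mod_cast le_top)
      have hcomp : IsCompact ((fun t : ℝ => t • ν 0) '' Icc (-1) 1) :=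
        isCompact_Icc.image (by fun_prop)
      obtain ⟨M, hM⟩ := hcomp.exists_bound_of_continuousOn hc.continuousOn
      refine ⟨max M 0, le_max_right _ _, fun z => ?_⟩
      by_cases hz : z ∈ strip ν
      · set t : ℝ := inner ℝ z (ν 0) with ht
        have h1 : (fun y => transition ν aplus aminus (y + (z - t • ν 0))) =
            transition ν aplus aminus := by
          ext1 y
          refine transition_add_of_inner_eq_zero y ?_
          rw [inner_sub_left, inner_smul_left, ← ht]
          simp
        have h2 := iteratedFDeriv_comp_add_right (𝕜 := ℝ) (f := transition ν aplus aminus) (j + 1)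
          (z - t • ν 0) (t • ν 0)
        rw [h1, add_sub_cancel] at h2
        rw [← h2]
        exact (hM _ ⟨t, abs_le.1 hz, rfl⟩).trans (le_max_left _ _)
      · rw [iteratedFDeriv_transition_eq_zero j hz, norm_zero]
        exact le_max_right _ _
  choose M hM0 hM using hj
  refine ⟨∑ j ∈ Finset.range (n + 1), M j, Finset.sum_nonneg fun j _ => hM0 j, fun j hjn z => ?_⟩
  exact (hM j z).trans (Finset.single_le_sum (f := M) (fun i _ => hM0 i)
    (Finset.mem_range.2 (by omega)))

end Transition

/-! ### Growth estimates for F near zeros and near bounded jets -/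

section Growth

variable {N m n : ℕ} {p : ℝ}

/-- The sum of the `p`-th powers of the norms of the entries. -/
noncomputable def powSum (p : ℝ) (A : Jet N m n) (b : Vec m) : ℝ := (∑ j, ‖A j‖ ^ p) + ‖b‖ ^ p

theorem powSum_nonneg (A : Jet N m n) (b : Vec m) : 0 ≤ powSum p A b := by
  unfold powSum; positivity

theorem real_rpow_add_le (hp : 1 ≤ p) {a b : ℝ} (ha : 0 ≤ a) (hb : 0 ≤ b) :
    (a + b) ^ p ≤ 2 ^ p * (a ^ p + b ^ p) := by
  have hp0 : 0 ≤ p := by linarith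
  wlog hab : a ≤ b generalizing a b
  · rw [add_comm a b, add_comm (a ^ p)]
    exact this hb ha (le_of_not_ge hab)
  calc (a + b) ^ p ≤ (2 * b) ^ p := by
        apply Real.rpow_le_rpow (by positivity) (by linarith) hp0
    _ = 2 ^ p * b ^ p := Real.mul_rpow (by norm_num) hb
    _ ≤ _ := by
      have : 0 ≤ a ^ p := by positivity
      gcongr; linarith

theorem powSum_add_le (hp : 1 ≤ p) (A A' : Jet N m n) (b b' : Vec m) :
    powSum p (A + A') (b + b') ≤ 2 ^ p * (powSum p A b + powSum p A' b') := by
  have hp0 : 0 ≤ p := by linarith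
  have key : ∀ {W : Type} [NormedAddCommGroup W] (u v : W),
      ‖u + v‖ ^ p ≤ 2 ^ p * (‖u‖ ^ p + ‖v‖ ^ p) := fun u v =>
    (Real.rpow_le_rpow (norm_nonneg _) (norm_add_le u v) hp0).trans
      (real_rpow_add_le hp (norm_nonneg _) (norm_nonneg _))
  calc powSum p (A + A') (b + b') ≤ (∑ j, 2 ^ p * (‖A j‖ ^ p + ‖A' j‖ ^ p)) +
        2 ^ p * (‖b‖ ^ p + ‖b'‖ ^ p) :=
      add_le_add (Finset.sum_le_sum fun j _ => key _ _) (key _ _)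
    _ = _ := by rw [← Finset.mul_sum, Finset.sum_add_distrib, powSum, powSum]; ring

variable {f : Jet N m n → Vec m → ℝ}

/-- Within distance κ of the zero (0, a), continuity gives f < τ. Farther away `powSum` is at least
κ^p, so the constant term of the growth condition is absorbed into a multiple of it. The gluing
shell has volume of the critical order R^{N-1}, and only an arbitrarily small constant τ is
affordable there. -/
theorem exists_growth_near_zero (hp : 1 ≤ p)
    (hf : Continuous fun q : Jet N m n × Vec m => f q.1 q.2) {C₀ : ℝ} (hC₀ : 0 ≤ C₀)
    (hup : ∀ A b, f A b ≤ C₀ * ((∑ j, ‖A j‖ ^ p) + ‖b‖ ^ p + 1)) {a : Vec m} (ha : f 0 a = 0)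
    {τ : ℝ} (hτ : 0 < τ) : ∃ C, 0 ≤ C ∧ ∀ A b, f A (a + b) ≤ τ + C * powSum p A b := by
  have hp0 : 0 < p := by linarith
  have h1 : ∀ᶠ q : Jet N m n × Vec m in 𝓝 (0, a), f q.1 q.2 < τ :=
    (hf.tendsto (0, a)).eventually (gt_mem_nhds (by simpa [ha] using hτ))
  obtain ⟨κ, hκ, hball⟩ := Metric.eventually_nhds_iff_ball.1 h1
  set P := powSum p (0 : Jet N m n) a with hP
  have hP0 : 0 ≤ P := powSum_nonneg _ _
  have hκp : 0 < κ ^ p := Real.rpow_pos_of_pos hκ p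
  refine ⟨C₀ * (2 ^ p + (2 ^ p * P + 1) / κ ^ p), by positivity, fun A b => ?_⟩
  have hS0 : 0 ≤ powSum p A b := powSum_nonneg _ _
  by_cases hsmall : (∀ j, ‖A j‖ < κ) ∧ ‖b‖ < κ
  · have : f A (a + b) < τ := by
      refine hball (A, a + b) ?_
      rw [Metric.mem_ball, Prod.dist_eq, dist_zero_right, max_lt_iff]
      refine ⟨(pi_norm_lt_iff hκ).2 hsmall.1, ?_⟩
      rw [dist_eq_norm]; simpa using hsmall.2
    have h2 : 0 ≤ C₀ * (2 ^ p + (2 ^ p * P + 1) / κ ^ p) * powSum p A b := by positivity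
    linarith
  · have hbig : κ ^ p ≤ powSum p A b := by
      rw [not_and_or, not_forall] at hsmall
      have hsum : 0 ≤ ∑ j, ‖A j‖ ^ p := by positivity
      have hb : 0 ≤ ‖b‖ ^ p := by positivity
      rcases hsmall with ⟨j, hj⟩ | hb'
      · have h2 : κ ^ p ≤ ‖A j‖ ^ p := Real.rpow_le_rpow hκ.le (not_lt.1 hj) hp0.le
        have h3 : ‖A j‖ ^ p ≤ ∑ j, ‖A j‖ ^ p :=
          Finset.single_le_sum (f := fun j => ‖A j‖ ^ p) (fun i _ => by positivity)
            (Finset.mem_univ j)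
        unfold powSum; linarith
      · have h2 : κ ^ p ≤ ‖b‖ ^ p := Real.rpow_le_rpow hκ.le (not_lt.1 hb') hp0.le
        unfold powSum; linarith
    have h2 := hup A (a + b)
    have h3 := powSum_add_le hp 0 A a b
    rw [zero_add, ← hP] at h3
    have h4 : 2 ^ p * P + 1 ≤ (2 ^ p * P + 1) / κ ^ p * powSum p A b := by
      rw [div_mul_eq_mul_div, le_div_iff₀ hκp]
      exact mul_le_mul_of_nonneg_left hbig (by positivity)
    calc f A (a + b) ≤ C₀ * (powSum p A (a + b) + 1) := h2
      _ ≤ C₀ * (2 ^ p * powSum p A b + (2 ^ p * P + 1) / κ ^ p * powSum p A b) := by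
          apply mul_le_mul_of_nonneg_left _ hC₀; linarith
      _ ≤ _ := by rw [← add_mul, ← mul_assoc]; linarith

/-- A cruder bound for the strip, where χ is not a zero of F and the constant 1 cannot be avoided.
-/
theorem exists_growth_of_bounded (hp : 1 ≤ p) {C₀ : ℝ} (hC₀ : 0 ≤ C₀)
    (hup : ∀ A b, f A b ≤ C₀ * ((∑ j, ‖A j‖ ^ p) + ‖b‖ ^ p + 1)) {M : ℝ} (hM : 0 ≤ M) :
    ∃ C, 0 ≤ C ∧ ∀ A₀ b₀ A b, (∀ j, ‖A₀ j‖ ≤ M) → ‖b₀‖ ≤ M →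
      f (A₀ + A) (b₀ + b) ≤ C * (1 + powSum p A b) := by
  have hp0 : 0 ≤ p := by linarith
  refine ⟨C₀ * (2 ^ p * (n * M ^ p + M ^ p + 1) + 1), by positivity, fun A₀ b₀ A b hA hb => ?_⟩
  have hS0 : 0 ≤ powSum p A b := powSum_nonneg _ _
  have h1 : powSum p A₀ b₀ ≤ n * M ^ p + M ^ p := by
    refine add_le_add ?_ (Real.rpow_le_rpow (norm_nonneg _) hb hp0)
    refine (Finset.sum_le_sum fun j _ => Real.rpow_le_rpow (norm_nonneg _) (hA j) hp0).trans ?_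
    simp
  have h2 := powSum_add_le hp A₀ A b₀ b
  have h3 : (0 : ℝ) < 2 ^ p := by positivity
  have h4 : 0 ≤ M ^ p := by positivity
  calc f (A₀ + A) (b₀ + b) ≤ C₀ * (powSum p (A₀ + A) (b₀ + b) + 1) := hup _ _
    _ ≤ C₀ * (2 ^ p * (n * M ^ p + M ^ p + powSum p A b) + 1) := by
        apply mul_le_mul_of_nonneg_left _ hC₀
        have := mul_le_mul_of_nonneg_left (add_le_add_left h1 (powSum p A b)) h3.le
        linarith
    _ ≤ _ := by
        rw [mul_assoc]
        apply mul_le_mul_of_nonneg_left _ hC₀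
        have h5 : 0 ≤ 2 ^ p * ((n * M ^ p + M ^ p) * powSum p A b) := by positivity
        nlinarith

/-- The sum of the `p`-th powers of the norms of the derivatives of order at most `n`. -/
noncomputable def derivSum (p : ℝ) (n : ℕ) (w : Vec N → Vec m) (z : Vec N) : ℝ :=
  ∑ i ∈ Finset.range (n + 1), ‖iteratedFDeriv ℝ i w z‖ ^ p

theorem derivSum_nonneg (w : Vec N → Vec m) (z : Vec N) : 0 ≤ derivSum p n w z := by
  unfold derivSum; positivity

variable [NeZero N]

/-- Leibniz's rule; the constant depends on the cutoff only through the bounds `C`, hence not on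
where the shell lies. -/
theorem exists_powSum_jet_smul_le (N m n : ℕ) [NeZero N] (hp : 1 ≤ p) (C : ℕ → ℝ) :
    ∃ K, 0 ≤ K ∧ ∀ (Θ : Vec N → ℝ) (w : Vec N → Vec m), ContDiff ℝ ∞ Θ → ContDiff ℝ ∞ w →
      (∀ j x, ‖iteratedFDeriv ℝ j Θ x‖ ≤ C j) → ∀ z,
        powSum p (jet n (fun y => Θ y • w y) z) (Θ z • w z) ≤ K * derivSum p n w z := by
  have hp0 : 0 ≤ p := by linarith
  let K₁ : ℝ := ∑ k ∈ Finset.range (n + 1), ∑ i ∈ Finset.range (n + 1), (k.choose i : ℝ) * |C i|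
  have hK₁ : 0 ≤ K₁ := by positivity
  refine ⟨(n + 1) * (K₁ ^ p * ((n + 1 : ℕ) : ℝ) ^ (p - 1)), by positivity, fun Θ w hΘ hw hC z => ?_⟩
  set s := ∑ i ∈ Finset.range (n + 1), ‖iteratedFDeriv ℝ i w z‖ with hs
  have hs0 : 0 ≤ s := by positivity
  have hderiv : ∀ k ≤ n, ‖iteratedFDeriv ℝ k (fun y => Θ y • w y) z‖ ≤ K₁ * s := by
    intro k hk
    refine (norm_iteratedFDeriv_smul_le hΘ hw z (by exact_mod_cast le_top)).trans ?_
    have h1 : ∀ i ∈ Finset.range (k + 1), (k.choose i : ℝ) * ‖iteratedFDeriv ℝ i Θ z‖ *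
        ‖iteratedFDeriv ℝ (k - i) w z‖ ≤ ((k.choose i : ℝ) * |C i|) * s := by
      intro i hi
      refine mul_le_mul ?_ ?_ (norm_nonneg _) (by positivity)
      · exact mul_le_mul_of_nonneg_left ((hC i z).trans (le_abs_self _)) (by positivity)
      · exact Finset.single_le_sum (f := fun i => ‖iteratedFDeriv ℝ i w z‖)
          (fun i _ => norm_nonneg _) (Finset.mem_range.2 (by omega))
    refine (Finset.sum_le_sum h1).trans ?_
    rw [← Finset.sum_mul]
    refine mul_le_mul_of_nonneg_right ?_ hs0
    calc _ ≤ ∑ i ∈ Finset.range (n + 1), (k.choose i : ℝ) * |C i| :=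
          Finset.sum_le_sum_of_subset_of_nonneg
            (Finset.range_subset_range.2 (by omega)) (fun i _ _ => by positivity)
      _ ≤ K₁ := Finset.single_le_sum
          (f := fun k => ∑ i ∈ Finset.range (n + 1), (k.choose i : ℝ) * |C i|)
          (fun i _ => by positivity) (Finset.mem_range.2 (by omega))
  have hpow : ∀ t, 0 ≤ t → t ≤ K₁ * s →
      t ^ p ≤ K₁ ^ p * ((n + 1 : ℕ) : ℝ) ^ (p - 1) * derivSum p n w z := by
    intro t ht0 ht
    refine (Real.rpow_le_rpow ht0 ht hp0).trans ?_
    rw [Real.mul_rpow hK₁ hs0, mul_assoc]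
    refine mul_le_mul_of_nonneg_left ?_ (by positivity)
    have := Real.rpow_sum_le_const_mul_sum_rpow_of_nonneg (s := Finset.range (n + 1))
      (f := fun i => ‖iteratedFDeriv ℝ i w z‖) hp (fun i _ => norm_nonneg _)
    simpa [derivSum] using this
  have h0 := hderiv 0 (Nat.zero_le _)
  rw [norm_iteratedFDeriv_zero] at h0
  calc powSum p (jet n (fun y => Θ y • w y) z) (Θ z • w z)
      ≤ (∑ _j : Fin n, K₁ ^ p * ((n + 1 : ℕ) : ℝ) ^ (p - 1) * derivSum p n w z) +
        K₁ ^ p * ((n + 1 : ℕ) : ℝ) ^ (p - 1) * derivSum p n w z :=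
        add_le_add (Finset.sum_le_sum fun j _ => hpow _ (norm_nonneg _) (hderiv _ (by omega)))
          (hpow _ (norm_nonneg _) h0)
    _ = _ := by
        rw [Finset.sum_const, Finset.card_univ, Fintype.card_fin, nsmul_eq_mul]; ring

end Growth

/-! ### Gluing a map to the transition profile -/

section Gluing

variable {N m n : ℕ} [NeZero N] (ν : OrthonormalBasis (Fin N) ℝ (Vec N))

omit [NeZero N] in
theorem jet_add {u v : Vec N → Vec m} (hu : ContDiff ℝ ∞ u) (hv : ContDiff ℝ ∞ v) (z : Vec N) :
    jet n (u + v) z = jet n u z + jet n v z := by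
  funext j
  exact iteratedFDeriv_add_apply (hu.contDiffAt.of_le (by exact_mod_cast le_top))
    (hv.contDiffAt.of_le (by exact_mod_cast le_top))

omit [NeZero N] in
theorem jet_congr {u v : Vec N → Vec m} {z : Vec N} (h : u =ᶠ[𝓝 z] v) :
    jet n u z = jet n v z := by
  funext j
  exact (h.iteratedFDeriv ℝ _).eq_of_nhds

omit [NeZero N] in
theorem jet_zero_fun (z : Vec N) : jet n (0 : Vec N → Vec m) z = 0 := by
  funext j
  simp [jet]

/-- Gluing a map to the smooth transition profile in a layer of fixed width gives a competitor
for the cell problem. -/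
theorem exists_gluing {F : Jet N m n → Vec m → Vec N → ℝ} {x : Vec N} {p : ℝ} (hp : 1 ≤ p)
    (hF : Continuous fun q : Jet N m n × Vec m => F q.1 q.2 x)
    {C₀ : ℝ} (hC₀ : 0 ≤ C₀)
    (hup : ∀ A b, F A b x ≤ C₀ * ((∑ j, ‖A j‖ ^ p) + ‖b‖ ^ p + 1)) {aplus aminus : Vec m}
    (hplus : F 0 aplus x = 0) (hminus : F 0 aminus x = 0) :
    ∃ C', 0 ≤ C' ∧ ∀ τ, 0 < τ → ∃ C'', 0 ≤ C'' ∧ ∀ a R : ℝ, 0 ≤ a → a + 2 < R / 2 →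
      ∀ W : Vec N → Vec m, ContDiff ℝ ∞ W →
        ENNReal.ofReal (R ^ (N - 1)) * cellEnergy F aplus aminus ν x ≤
          (∫⁻ z in box ν (R / 2), ENNReal.ofReal (F (jet n W z) (W z) x)) +
          ENNReal.ofReal τ * volume (box ν (a + 2) \ box ν a) +
          ENNReal.ofReal C'' * (∫⁻ z in box ν (a + 2) \ box ν a,
            ENNReal.ofReal (derivSum p n (fun y => W y - transition ν aplus aminus y) z)) +
          ENNReal.ofReal C' * volume (strip ν ∩ (box ν (R / 2) \ box ν a)) := by
  obtain ⟨M, hM0, hM⟩ :=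
    exists_norm_iteratedFDeriv_transition_le (ν := ν) (aplus := aplus) (aminus := aminus) n
  obtain ⟨C', hC'0, hC'⟩ := exists_growth_of_bounded (f := fun A b => F A b x) hp hC₀ hup hM0
  obtain ⟨Cut, hCut⟩ := exists_cutoff N
  obtain ⟨K, hK0, hK⟩ := exists_powSum_jet_smul_le N m n hp Cut
  -- C' is fixed before τ, whereas C'' may blow up as τ → 0. The later choice of constants relies on
  -- this order.
  refine ⟨C', hC'0, fun τ hτ => ?_⟩
  obtain ⟨Cp, hCp0, hCp⟩ :=
    exists_growth_near_zero (f := fun A b => F A b x) hp hF hC₀ hup hplus hτ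
  obtain ⟨Cm, hCm0, hCm⟩ :=
    exists_growth_near_zero (f := fun A b => F A b x) hp hF hC₀ hup hminus hτ
  refine ⟨(C' + Cp + Cm) * K, by positivity, fun a R ha haR W hW => ?_⟩
  set χ := transition ν aplus aminus with hχdef
  have hχ : ContDiff ℝ ∞ χ := contDiff_transition ν aplus aminus
  let w : Vec N → Vec m := fun y => W y - χ y
  have hw : ContDiff ℝ ∞ w := hW.sub hχ
  -- Θ is 1 on the cube of half-side a and 0 where some coordinate reaches a + 1. The competitor χ +
  -- Θ(W - χ) thus goes over from W to χ, and the remaining unit of the shell makes h vanish in a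
  -- neighbourhood of every point outside it.
  obtain ⟨Θ, hΘ, hΘ1, hΘ0, hΘC⟩ := hCut (box ν (a + 1 / 2)) (isOpen_box ν _).measurableSet
  let h : Vec N → Vec m := fun y => Θ y • w y
  have hh : ContDiff ℝ ∞ h := hΘ.smul hw
  have hone : ∀ z ∈ box ν a, Θ z = 1 := by
    intro z hz
    refine hΘ1 z fun y hy => ?_
    have : z + (y - z) ∈ box ν (a + 1 / 2) := by
      refine add_mem_box ν hz ?_
      rw [Metric.mem_ball, dist_eq_norm] at hy
      exact hy.le
    simpa using this
  have hzero : ∀ z, (∃ j, a + 1 ≤ |(inner ℝ z (ν j) : ℝ)|) → h z = 0 := by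
    rintro z ⟨j, hj⟩
    have : Θ z = 0 := by
      refine hΘ0 z (Set.disjoint_left.2 fun y hy hyb => ?_)
      rw [Metric.mem_ball, dist_eq_norm] at hy
      have h1 := hyb j
      have h2 := abs_inner_basis_le ν (y - z) j
      rw [inner_sub_left] at h2
      have h3 := abs_sub_abs_le_abs_sub (inner ℝ z (ν j) : ℝ) (inner ℝ y (ν j))
      rw [abs_sub_comm] at h3
      linarith
    simp [h, this]
  have hsupp : ∀ z, z ∉ box ν (a + 2) → h z = 0 := by
    intro z hz
    simp only [box, mem_ofPred_eq, not_forall, not_lt] at hz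
    obtain ⟨j, hj⟩ := hz
    exact hzero z ⟨j, by linarith⟩
  have hnear : ∀ z, z ∉ box ν (a + 2) → h =ᶠ[𝓝 z] 0 := by
    intro z hz
    simp only [box, mem_ofPred_eq, not_forall, not_lt] at hz
    obtain ⟨j, hj⟩ := hz
    have hopen : IsOpen {z : Vec N | a + 1 < |(inner ℝ z (ν j) : ℝ)|} :=
      isOpen_lt continuous_const (by fun_prop)
    filter_upwards [hopen.mem_nhds (by simp only [mem_ofPred_eq]; linarith : z ∈ _)] with y hy
    exact hzero y ⟨j, le_of_lt hy⟩
  have hcell := mul_cellEnergy_le ν (F := F) (aplus := aplus) (aminus := aminus) (x := x)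
    (hχ.of_le (by exact_mod_cast le_top) : ContDiff ℝ n χ)
    (hh.of_le (by exact_mod_cast le_top) : ContDiff ℝ n h) (by linarith) haR hsupp
    (fun z hz => transition_of_one_le hz) (fun z hz => transition_of_le_neg_one hz)
    (fun z j t hj => transition_add_of_inner_eq_zero z (by
      rw [inner_smul_left, ν.inner_eq_ite, if_neg hj, mul_zero]))
  refine hcell.trans ?_
  set G : Vec N → ℝ≥0∞ := fun z => ENNReal.ofReal (F (jet n (χ + h) z) ((χ + h) z) x) with hG
  have hin : ∀ z ∈ box ν a, G z = ENNReal.ofReal (F (jet n W z) (W z) x) := by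
    intro z hz
    have : χ + h =ᶠ[𝓝 z] W := by
      filter_upwards [(isOpen_box ν a).mem_nhds hz] with y hy
      simp [h, w, hone y hy]
    simp only [hG, jet_congr this, this.eq_of_nhds]
  have hjet : ∀ z, jet n (χ + h) z = jet n χ z + jet n h z := fun z => jet_add hχ hh z
  -- On the strip χ has bounded derivatives and the crude growth bound applies. Off the strip χ is
  -- locally constant with a value a± at which F vanishes, so the refined bound applies inside the
  -- larger cube, and beyond it the integrand is F(0, a±) = 0.
  have hout : ∀ z, G z ≤ (box ν (a + 2)).indicator
      (fun z => ENNReal.ofReal τ + ENNReal.ofReal ((C' + Cp + Cm) * K) *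
        ENNReal.ofReal (derivSum p n w z)) z +
      (strip ν).indicator (fun _ => ENNReal.ofReal C') z := by
    intro z
    have hd0 : 0 ≤ derivSum p n w z := derivSum_nonneg w z
    have hS : powSum p (jet n h z) (h z) ≤ K * derivSum p n w z := hK Θ w hΘ hw hΘC z
    have hKd : 0 ≤ K * derivSum p n w z := by positivity
    have hgen : ∀ c t : ℝ, 0 ≤ c → t ≤ c * (1 + powSum p (jet n h z) (h z)) → 
        t ≤ c + c * (K * derivSum p n w z) := by
      intro c t hc ht
      have := mul_le_mul_of_nonneg_left hS hc
      linarith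
    by_cases hz : z ∈ strip ν
    · rw [indicator_of_mem hz]
      have h1 : F (jet n (χ + h) z) ((χ + h) z) x ≤ C' * (1 + powSum p (jet n h z) (h z)) := by
        rw [hjet]
        exact hC' _ _ _ _ (fun j => hM _ (by omega) z) (by simpa using hM 0 (Nat.zero_le _) z)
      by_cases hzb : z ∈ box ν (a + 2)
      · rw [indicator_of_mem hzb, ← ENNReal.ofReal_mul (by positivity),
          ← ENNReal.ofReal_add hτ.le (by positivity), ← ENNReal.ofReal_add (by positivity) hC'0]
        refine ENNReal.ofReal_le_ofReal ((hgen C' _ hC'0 h1).trans ?_)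
        have h2 : 0 ≤ (Cp + Cm) * (K * derivSum p n w z) := by positivity
        linarith
      · rw [indicator_of_notMem hzb, zero_add]
        refine ENNReal.ofReal_le_ofReal (h1.trans ?_)
        rw [jet_congr (hnear z hzb), (hnear z hzb).eq_of_nhds, jet_zero_fun]
        simp [powSum, Real.zero_rpow (by linarith : p ≠ 0)]
    · rw [indicator_of_notMem hz, add_zero]
      have h0 : jet n χ z = 0 := by
        funext j
        exact iteratedFDeriv_transition_eq_zero _ hz
      obtain ⟨c, a', hc0, hcle, ha', hca, hF0a⟩ : ∃ (c : ℝ) (a' : Vec m), 0 ≤ c ∧ c ≤ C' + Cp + Cm ∧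
          χ z = a' ∧ (∀ A b, F A (a' + b) x ≤ τ + c * powSum p A b) ∧ F 0 a' x = 0 := by
        rw [hχdef, transition_eq_of_notMem_strip hz]
        split_ifs
        · exact ⟨Cp, aplus, hCp0, by linarith, rfl, hCp, hplus⟩
        · exact ⟨Cm, aminus, hCm0, by linarith, rfl, hCm, hminus⟩
      by_cases hzb : z ∈ box ν (a + 2)
      · rw [indicator_of_mem hzb, ← ENNReal.ofReal_mul (by positivity),
          ← ENNReal.ofReal_add hτ.le (by positivity)]
        refine ENNReal.ofReal_le_ofReal ?_
        rw [hjet, h0, zero_add, Pi.add_apply, ha']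
        refine (hca _ _).trans ?_
        have h2 := mul_le_mul_of_nonneg_left hS hc0
        have h3 := mul_le_mul_of_nonneg_right hcle hKd
        linarith
      · rw [indicator_of_notMem hzb]
        simp only [hG]
        rw [hjet, h0, zero_add, Pi.add_apply, jet_congr (hnear z hzb),
          (hnear z hzb).eq_of_nhds, jet_zero_fun, ha', Pi.zero_apply, add_zero, hF0a]
        simp
  have hmb : ∀ b, MeasurableSet (box ν b) := fun b => (isOpen_box ν b).measurableSet
  have hsub : box ν a ⊆ box ν (R / 2) := box_mono ν (by linarith)
  have hsub2 : box ν (a + 2) ⊆ box ν (R / 2) := box_mono ν (by linarith)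
  rw [← lintegral_inter_add_sdiff G (box ν (R / 2)) (hmb a), inter_eq_self_of_subset_right hsub,
    add_assoc, add_assoc]
  refine add_le_add ?_ ?_
  · rw [setLIntegral_congr_fun (hmb a) hin]
    exact lintegral_mono_set hsub
  · have hmeas2 : Measurable ((strip ν).indicator fun _ : Vec N => ENNReal.ofReal C') :=
      measurable_const.indicator (measurableSet_strip ν)
    refine (lintegral_mono hout).trans ?_
    rw [lintegral_add_right _ hmeas2, ← add_assoc]
    refine add_le_add ?_ ?_
    · rw [setLIntegral_indicator (hmb _), lintegral_add_left measurable_const,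
        setLIntegral_const, lintegral_const_mul' _ _ ENNReal.ofReal_ne_top]
      have : box ν (a + 2) ∩ (box ν (R / 2) \ box ν a) = box ν (a + 2) \ box ν a := by
        rw [← inter_sdiff_assoc, inter_eq_self_of_subset_left hsub2]
      rw [this]
    · rw [setLIntegral_indicator (measurableSet_strip ν), setLIntegral_const]

end Gluing

/-! ### Lower bound on a large cube for smooth maps -/

section CellBound

variable {N m n : ℕ} (ν : OrthonormalBasis (Fin N) ℝ (Vec N))

/-- Pigeonhole: the k shells of width 2 are disjoint, so the cheapest carries at most one k-th of
the integral. -/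
theorem exists_layer_lintegral_le (f : Vec N → ℝ≥0∞) (a : ℝ) {k : ℕ} (hk : 0 < k) {b : ℝ}
    (hb : a + 2 * k ≤ b) : ∃ i < k,
      (k : ℝ≥0∞) * ∫⁻ z in box ν (a + 2 * i + 2) \ box ν (a + 2 * i), f z ≤ ∫⁻ z in box ν b, f z := by
  set L : ℕ → ℝ≥0∞ := fun i => ∫⁻ z in box ν (a + 2 * i + 2) \ box ν (a + 2 * i), f z with hL
  have hsum : ∀ k : ℕ, ∑ i ∈ Finset.range k, L i ≤ ∫⁻ z in box ν (a + 2 * k), f z := by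
    intro k
    induction k with
    | zero => simp
    | succ k ih =>
      have hcast : a + 2 * ((k + 1 : ℕ) : ℝ) = a + 2 * k + 2 := by push_cast; ring
      have hsub : box ν (a + 2 * (k : ℝ)) ⊆ box ν (a + 2 * k + 2) := box_mono ν (by linarith)
      rw [Finset.sum_range_succ, hcast, ← lintegral_inter_add_sdiff f (box ν (a + 2 * k + 2))
        (isOpen_box ν (a + 2 * k)).measurableSet, inter_eq_self_of_subset_right hsub]
      exact add_le_add ih le_rfl
  obtain ⟨i, hi, hmin⟩ := Finset.exists_min_image (Finset.range k) L ⟨0, by simpa using hk⟩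
  refine ⟨i, Finset.mem_range.1 hi, ?_⟩
  calc (k : ℝ≥0∞) * L i = ∑ _j ∈ Finset.range k, L i := by simp
    _ ≤ ∑ j ∈ Finset.range k, L j := Finset.sum_le_sum hmin
    _ ≤ _ := (hsum k).trans (lintegral_mono_set (box_mono ν hb))

/-- All derivatives up to order `n` are controlled by those of order `0` and `n`. -/
theorem exists_lintegral_derivSum_le (N m n : ℕ) {p : ℝ} (hp : 1 ≤ p) :
    ∃ C κ : ℝ, 0 ≤ C ∧ 1 ≤ κ ∧ ∀ (ν : OrthonormalBasis (Fin N) ℝ (Vec N)) (w : Vec N → Vec m),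
      ContDiff ℝ ∞ w → ∀ b, ∫⁻ z in box ν (b - κ), ENNReal.ofReal (derivSum p n w z) ≤
        ENNReal.ofReal C * ((∫⁻ z in box ν b, ‖w z‖ₑ ^ p) +
          ∫⁻ z in box ν b, ‖iteratedFDeriv ℝ n w z‖ₑ ^ p) := by
  have hp0 : 0 ≤ p := by linarith
  choose! C κ hC h using fun (j : ℕ) (hj : j ≤ n) => exists_lintegral_iteratedFDeriv_le N hp j n hj
  refine ⟨∑ j ∈ Finset.range (n + 1), (C j).toReal, 1 + ∑ j ∈ Finset.range (n + 1), (κ j : ℝ),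
    by positivity, by simp; positivity, fun ν w hw b => ?_⟩
  set I := (∫⁻ z in box ν b, ‖w z‖ₑ ^ p) + ∫⁻ z in box ν b, ‖iteratedFDeriv ℝ n w z‖ₑ ^ p
  have hpt : ∀ z, ENNReal.ofReal (derivSum p n w z) =
      ∑ i ∈ Finset.range (n + 1), ‖iteratedFDeriv ℝ i w z‖ₑ ^ p := by
    intro z
    rw [derivSum, ENNReal.ofReal_sum_of_nonneg (fun i _ => by positivity)]
    refine Finset.sum_congr rfl fun i _ => ?_
    rw [← ENNReal.ofReal_rpow_of_nonneg (norm_nonneg _) hp0, ofReal_norm]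
  simp_rw [hpt]
  rw [lintegral_finsetSum, ENNReal.ofReal_sum_of_nonneg (fun i _ => ENNReal.toReal_nonneg),
    Finset.sum_mul]
  · refine Finset.sum_le_sum fun i hi => ?_
    have hin : i ≤ n := by have := Finset.mem_range.1 hi; omega
    rw [ENNReal.ofReal_toReal (hC i hin)]
    refine h i hin (Vec m) w hw _ _ fun z hz y hy => ?_
    refine box_mono ν ?_ (add_mem_box ν hz hy)
    have := Finset.single_le_sum (f := fun j => (κ j : ℝ)) (fun i _ => by positivity) hi
    linarith
  · intro i _
    exact (continuous_enorm.comp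
      (hw.continuous_iteratedFDeriv (by exact_mod_cast le_top))).measurable.pow_const p

variable [NeZero N]

/-- The piecewise constant map with the two given values on the two sides of a hyperplane. -/
noncomputable def jump (ν : OrthonormalBasis (Fin N) ℝ (Vec N)) (aplus aminus : Vec m) (z : Vec N) :
    Vec m :=
  if 0 < (inner ℝ z (ν 0) : ℝ) then aplus else aminus

theorem enorm_rpow_eq {W : Type*} [SeminormedAddCommGroup W] (w : W) {p : ℝ} (hp : 0 ≤ p) :
    ‖w‖ₑ ^ p = ENNReal.ofReal (‖w‖ ^ p) := by
  rw [← ENNReal.ofReal_rpow_of_nonneg (norm_nonneg _) hp, ofReal_norm]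

theorem enorm_add_rpow_le {W : Type*} [NormedAddCommGroup W] (u v : W) {p : ℝ} (hp : 1 ≤ p) :
    ‖u + v‖ₑ ^ p ≤ 2 ^ p * (‖u‖ₑ ^ p + ‖v‖ₑ ^ p) :=
  (ENNReal.rpow_le_rpow (enorm_add_le u v) (by linarith)).trans (rpow_add_le_mul hp _ _)

omit [NeZero N] in
theorem lintegral_enorm_add_rpow_le {W : Type*} [NormedAddCommGroup W] {p : ℝ} (hp : 1 ≤ p)
    {A : Set (Vec N)} {u v : Vec N → W} {S : Set (Vec N)} (hS : MeasurableSet S) {M : ℝ}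
    (hv : ∀ z ∈ S, ‖v z‖ ≤ M) (hv0 : ∀ z, z ∉ S → v z = 0) :
    ∫⁻ z in A, ‖u z + v z‖ₑ ^ p ≤
      2 ^ p * ((∫⁻ z in A, ‖u z‖ₑ ^ p) + ENNReal.ofReal (M ^ p) * volume (S ∩ A)) := by
  have hp0 : 0 < p := by linarith
  have h1 : ∀ z, ‖v z‖ₑ ^ p ≤ S.indicator (fun _ => ENNReal.ofReal (M ^ p)) z := by
    intro z
    by_cases hz : z ∈ S
    · rw [indicator_of_mem hz, enorm_rpow_eq _ hp0.le]
      exact ENNReal.ofReal_le_ofReal (Real.rpow_le_rpow (norm_nonneg _) (hv z hz) hp0.le)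
    · simp [hv0 z hz, hp0]
  calc _ ≤ ∫⁻ z in A, 2 ^ p * (‖u z‖ₑ ^ p + S.indicator (fun _ => ENNReal.ofReal (M ^ p)) z) := by
        refine lintegral_mono fun z => (enorm_add_rpow_le _ _ hp).trans ?_
        gcongr
        exact h1 z
    _ = _ := by
        rw [lintegral_const_mul' _ _ (ENNReal.rpow_ne_top_of_nonneg hp0.le (by simp)),
          lintegral_add_right _ (measurable_const.indicator hS), setLIntegral_indicator hS,
          setLIntegral_const]

set_option maxHeartbeats 1000000 in
/-- Quantitative lower bound for the energy of a smooth map which is close to a jump on a large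
cube. -/
theorem exists_cell_lower_bound (hn : 1 ≤ n) {F : Jet N m n → Vec m → Vec N → ℝ} {x : Vec N}
    {p : ℝ} (hp : 1 ≤ p) (hF : Continuous fun q : Jet N m n × Vec m => F q.1 q.2 x)
    {C₀ c₁ : ℝ} (hC₀ : 0 ≤ C₀) (hc₁ : 0 < c₁)
    (hlow : ∀ A b, c₁ * ‖A ⟨n - 1, Nat.sub_lt hn one_pos⟩‖ ^ p ≤ F A b x)
    (hup : ∀ A b, F A b x ≤ C₀ * ((∑ j, ‖A j‖ ^ p) + ‖b‖ ^ p + 1)) {aplus aminus : Vec m}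
    (hplus : F 0 aplus x = 0) (hminus : F 0 aminus x = 0) {c : ℝ≥0}
    (hc : (c : ℝ≥0∞) < cellEnergy F aplus aminus ν x) :
    ∃ η R₀ : ℝ, 0 < η ∧ ∀ R, R₀ ≤ R → ∀ W : Vec N → Vec m, ContDiff ℝ ∞ W →
      ∫⁻ z in box ν (R / 2), ‖W z - jump ν aplus aminus z‖ₑ ^ p ≤ ENNReal.ofReal (η * R ^ N) →
      ENNReal.ofReal (c * R ^ (N - 1)) ≤
        ∫⁻ z in box ν (R / 2), ENNReal.ofReal (F (jet n W z) (W z) x) := by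
  have hp0 : 0 < p := by linarith
  -- A finite c' strictly between c and the possibly infinite cell energy. The gap e = c' - c is the
  -- budget for the gluing errors, each of which will be at most e/4.
  obtain ⟨c', hcc', hc'⟩ := ENNReal.lt_iff_exists_nnreal_btwn.1 hc
  have he : 0 < (c' : ℝ) - c := sub_pos.2 (by exact_mod_cast hcc')
  set e : ℝ := (c' : ℝ) - c with he_def
  obtain ⟨M, hM0, hM⟩ :=
    exists_norm_iteratedFDeriv_transition_le (ν := ν) (aplus := aplus) (aminus := aminus) n
  obtain ⟨C', hC'0, hglue⟩ := exists_gluing ν hp hF hC₀ hup hplus hminus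
  obtain ⟨Ci, κ, hCi0, hκ, hint⟩ := exists_lintegral_derivSum_le N m n hp
  -- The gluing takes place in a frame of relative width β, and β is chosen so that the strip inside
  -- this frame costs at most e/4.
  obtain ⟨β, hβ0, hβ1, hβ⟩ : ∃ β : ℝ, 0 < β ∧ β ≤ 1 / 4 ∧ C' * (4 * N * β) ≤ e / 4 := by
    refine ⟨min (1 / 4) (e / (4 * (C' * (4 * N) + 1))), by positivity, min_le_left _ _, ?_⟩
    have h1 : min (1 / 4) (e / (4 * (C' * (4 * N) + 1))) ≤ e / (4 * (C' * (4 * N) + 1)) :=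
      min_le_right _ _
    calc C' * (4 * N * min (1 / 4) (e / (4 * (C' * (4 * N) + 1))))
        = (C' * (4 * N)) * min (1 / 4) (e / (4 * (C' * (4 * N) + 1))) := by ring
      _ ≤ (C' * (4 * N) + 1) * (e / (4 * (C' * (4 * N) + 1))) := by gcongr; linarith
      _ = e / 4 := by field_simp
  -- A shell of width 2 has volume at most 4N R^{N-1}, whence this choice of τ.
  obtain ⟨τ, hτ0, hτ⟩ : ∃ τ : ℝ, 0 < τ ∧ τ * (4 * N) ≤ e / 4 := by
    refine ⟨e / (4 * (4 * N + 1)), by positivity, ?_⟩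
    calc e / (4 * (4 * N + 1)) * (4 * N) ≤ e / (4 * (4 * N + 1)) * (4 * N + 1) := by
          gcongr; linarith
      _ = e / 4 := by field_simp
  obtain ⟨C'', hC''0, hglue⟩ := hglue τ hτ0
  set M₁ : ℝ := ‖aplus - aminus‖
  set C₃ : ℝ := Ci * (2 ^ p * (1 + 2 * M₁ ^ p + c / c₁ + 2 * M ^ p)) with hC₃
  have hC₃0 : 0 ≤ C₃ := by positivity
  set B : ℝ := C'' * (C₃ * 4 / β) with hB
  have hB0 : 0 ≤ B := by positivity
  -- B(η + 1/R)R^{N-1} will bound the cost of the derivatives in the chosen shell; η and R₀ make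
  -- each of its two terms at most e/8. The other entries of R₀ ensure a > 1 and leave enough shells
  -- after the interpolation loss κ.
  refine ⟨e / (8 * (B + 1)), max (max 5 ((2 * κ + 4) / β)) (8 * (B + 1) / e), by positivity,
    fun R hR W hW hWη => ?_⟩
  have hR5 : 5 ≤ R := ((le_max_left _ _).trans (le_max_left _ _)).trans hR
  have hRκ : 2 * κ + 4 ≤ β * R := by
    have := ((le_max_right 5 ((2 * κ + 4) / β)).trans (le_max_left _ _)).trans hR
    rw [div_le_iff₀ hβ0] at this
    linarith
  have hRB : 8 * (B + 1) ≤ R * e := by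
    have := (le_max_right _ _).trans hR
    rwa [div_le_iff₀ he] at this
  set η : ℝ := e / (8 * (B + 1)) with hη
  have hη0 : 0 < η := by positivity
  have hR0 : 0 < R := by linarith
  have hRN : R ^ N = R * R ^ (N - 1) := by
    rw [← pow_succ', Nat.sub_add_cancel NeZero.one_le]
  set Q : ℝ := R ^ (N - 1) with hQ
  have hQ0 : 0 < Q := by positivity
  -- The contrary assumption bounds the energy from above, and through coercivity the n-th
  -- derivatives.
  by_contra! hlt
  set χ := transition ν aplus aminus with hχdef
  have hχ : ContDiff ℝ ∞ χ := contDiff_transition ν aplus aminus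
  set w : Vec N → Vec m := fun y => W y - χ y with hwdef
  have hw : ContDiff ℝ ∞ w := hW.sub hχ
  have hstrip : volume (strip ν ∩ box ν (R / 2)) ≤ ENNReal.ofReal (2 * Q) :=
    volume_strip_inter_box_le ν hR0.le
  have h2p : (2 : ℝ≥0∞) ^ p = ENNReal.ofReal (2 ^ p) := by
    rw [← ENNReal.ofReal_rpow_of_nonneg (by norm_num) hp0.le]; simp
  have hI : ∫⁻ z in box ν (R / 2), ‖w z‖ₑ ^ p ≤
      ENNReal.ofReal (2 ^ p * (η * R ^ N + M₁ ^ p * (2 * Q))) := by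
    have h1 := lintegral_enorm_add_rpow_le hp (A := box ν (R / 2))
      (u := fun z => W z - jump ν aplus aminus z) (v := fun z => jump ν aplus aminus z - χ z)
      (measurableSet_strip ν) (M := M₁)
      (fun z _ => by
        rw [norm_sub_rev, jump]
        refine norm_transition_sub_le z _ ?_
        split_ifs <;> simp)
      (fun z hz => by rw [hχdef, transition_eq_of_notMem_strip hz, jump, sub_self])
    simp only [sub_add_sub_cancel] at h1
    refine h1.trans ?_
    rw [h2p, ENNReal.ofReal_mul (by positivity), ENNReal.ofReal_add (by positivity) (by positivity),
      ENNReal.ofReal_mul (p := M₁ ^ p) (by positivity)]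
    gcongr
  have hWn : ∫⁻ z in box ν (R / 2), ‖iteratedFDeriv ℝ n W z‖ₑ ^ p ≤
      ENNReal.ofReal (c / c₁ * Q) := by
    calc _ ≤ ∫⁻ z in box ν (R / 2), ENNReal.ofReal (1 / c₁) *
          ENNReal.ofReal (F (jet n W z) (W z) x) := by
          refine lintegral_mono fun z => ?_
          rw [enorm_rpow_eq _ hp0.le, ← ENNReal.ofReal_mul (by positivity)]
          refine ENNReal.ofReal_le_ofReal ?_
          have h1 := hlow (jet n W z) (W z)
          have h2 : ‖jet n W z ⟨n - 1, Nat.sub_lt hn one_pos⟩‖ = ‖iteratedFDeriv ℝ n W z‖ := by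
            obtain ⟨k, rfl⟩ : ∃ k, n = k + 1 := ⟨n - 1, by omega⟩
            rfl
          rw [h2] at h1
          rw [one_div, le_inv_mul_iff₀ hc₁]
          exact h1
      _ ≤ ENNReal.ofReal (1 / c₁) * ENNReal.ofReal (c * Q) := by
          rw [lintegral_const_mul' _ _ ENNReal.ofReal_ne_top]
          gcongr
      _ = _ := by
          rw [← ENNReal.ofReal_mul (by positivity)]
          congr 1; ring
  have hJ : ∫⁻ z in box ν (R / 2), ‖iteratedFDeriv ℝ n w z‖ₑ ^ p ≤
      ENNReal.ofReal (2 ^ p * (c / c₁ * Q + M ^ p * (2 * Q))) := by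
    have h1 := lintegral_enorm_add_rpow_le hp (A := box ν (R / 2))
      (u := fun z => iteratedFDeriv ℝ n W z) (v := fun z => - iteratedFDeriv ℝ n χ z)
      (measurableSet_strip ν) (M := M)
      (fun z _ => by rw [norm_neg]; exact hM n le_rfl z)
      (fun z hz => by
        obtain ⟨k, rfl⟩ : ∃ k, n = k + 1 := ⟨n - 1, by omega⟩
        rw [iteratedFDeriv_transition_eq_zero k hz, neg_zero])
    have h2 : ∀ z, iteratedFDeriv ℝ n w z = iteratedFDeriv ℝ n W z + -iteratedFDeriv ℝ n χ z := by
      intro z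
      rw [← sub_eq_add_neg]
      exact iteratedFDeriv_sub_apply (hW.contDiffAt.of_le (by exact_mod_cast le_top))
        (hχ.contDiffAt.of_le (by exact_mod_cast le_top))
    simp_rw [h2]
    refine h1.trans ?_
    rw [h2p, ENNReal.ofReal_mul (by positivity), ENNReal.ofReal_add (by positivity) (by positivity),
      ENNReal.ofReal_mul (p := M ^ p) (by positivity)]
    gcongr
  have hT : ∫⁻ z in box ν (R / 2 - κ), ENNReal.ofReal (derivSum p n w z) ≤
      ENNReal.ofReal (C₃ * (η * R + 1) * Q) := by
    refine (hint ν w hw (R / 2)).trans ?_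
    calc _ ≤ ENNReal.ofReal Ci * (ENNReal.ofReal (2 ^ p * (η * R ^ N + M₁ ^ p * (2 * Q))) +
          ENNReal.ofReal (2 ^ p * (c / c₁ * Q + M ^ p * (2 * Q)))) := by gcongr
      _ = ENNReal.ofReal (Ci * (2 ^ p * (η * R ^ N + M₁ ^ p * (2 * Q)) +
          2 ^ p * (c / c₁ * Q + M ^ p * (2 * Q)))) := by
          rw [← ENNReal.ofReal_add (by positivity) (by positivity),
            ← ENNReal.ofReal_mul hCi0]
      _ ≤ _ := by
          refine ENNReal.ofReal_le_ofReal ?_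
          rw [hRN, hC₃]
          have h1 : 0 ≤ Ci * 2 ^ p * Q * (2 * M₁ ^ p + c / c₁ + 2 * M ^ p) * (η * R) := by positivity
          have h2 : 0 ≤ Ci * 2 ^ p * Q := by positivity
          nlinarith
  -- k shells of width 2 fit between half-sides (1/2 - β)R and R/2 - κ; rounding down still leaves k
  -- ≥ βR/4 because βR ≥ 2κ + 4.
  obtain ⟨k, hk0, hk1, hk2⟩ : ∃ k : ℕ, 0 < k ∧ β * R / 4 ≤ k ∧ 2 * (k : ℝ) ≤ β * R - κ := by
    have h0 : 0 ≤ (β * R - κ) / 2 := by linarith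
    have h1 := Nat.floor_le h0
    have h2 := Nat.lt_floor_add_one ((β * R - κ) / 2)
    have h3 : β * R / 4 ≤ (⌊(β * R - κ) / 2⌋₊ : ℝ) := by linarith
    refine ⟨⌊(β * R - κ) / 2⌋₊, ?_, h3, by linarith⟩
    have : (0 : ℝ) < (⌊(β * R - κ) / 2⌋₊ : ℝ) := lt_of_lt_of_le (by positivity) h3
    exact_mod_cast this
  obtain ⟨i, hik, hi⟩ := exists_layer_lintegral_le ν
    (fun z => ENNReal.ofReal (derivSum p n w z)) ((1 / 2 - β) * R) hk0 (b := R / 2 - κ)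
    (by nlinarith)
  set a : ℝ := (1 / 2 - β) * R + 2 * i with ha
  have hik' : (i : ℝ) + 1 ≤ k := by exact_mod_cast hik
  have hi0 : (0 : ℝ) ≤ i := by positivity
  have ha1 : 1 < a := by nlinarith
  have haR : a + 2 < R / 2 := by nlinarith
  have hlayer : ∫⁻ z in box ν (a + 2) \ box ν a, ENNReal.ofReal (derivSum p n w z) ≤
      ENNReal.ofReal (C₃ * 4 / β * (η + 1 / R) * Q) := by
    have hkR : (0 : ℝ) < k := by exact_mod_cast hk0
    have h1 : (k : ℝ≥0∞) * ∫⁻ z in box ν (a + 2) \ box ν a, ENNReal.ofReal (derivSum p n w z) ≤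
        ENNReal.ofReal (C₃ * (η * R + 1) * Q) := hi.trans hT
    rw [mul_comm, ← ENNReal.le_div_iff_mul_le (Or.inl (by exact_mod_cast hk0.ne')) (Or.inl (by simp)),
      ← ENNReal.ofReal_natCast, ← ENNReal.ofReal_div_of_pos hkR] at h1
    refine h1.trans (ENNReal.ofReal_le_ofReal ?_)
    rw [div_le_iff₀ hkR]
    calc C₃ * (η * R + 1) * Q = C₃ * 4 / β * (η + 1 / R) * Q * (β * R / 4) := by field_simp
      _ ≤ _ := by gcongr
  have hdiff : volume (box ν (a + 2) \ box ν a) ≤ ENNReal.ofReal (2 * N * (a + 2 - a) * Q) :=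
    volume_box_diff_le ν hR0.le (by linarith) haR.le
  have hstrip2 : volume (strip ν ∩ (box ν (R / 2) \ box ν a)) ≤ ENNReal.ofReal (4 * N * β * Q) :=
    volume_strip_inter_box_diff_le ν hR0.le hβ0.le ha1 (by linarith) (by rw [ha]; nlinarith)
  have hfin := hglue a R (by linarith) haR W hW
  have hle : ENNReal.ofReal Q * cellEnergy F aplus aminus ν x ≤ ENNReal.ofReal (c * Q +
      τ * (2 * N * (a + 2 - a) * Q) + C'' * (C₃ * 4 / β * (η + 1 / R) * Q) +
      C' * (4 * N * β * Q)) := by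
    refine hfin.trans ?_
    rw [ENNReal.ofReal_add (by ring_nf; positivity) (by positivity),
      ENNReal.ofReal_add (by ring_nf; positivity) (by positivity),
      ENNReal.ofReal_add (by positivity) (by ring_nf; positivity),
      ENNReal.ofReal_mul hτ0.le, ENNReal.ofReal_mul (p := C'') hC''0,
      ENNReal.ofReal_mul (p := C') hC'0]
    exact add_le_add (add_le_add (add_le_add hlt.le (mul_le_mul_right hdiff _))
      (mul_le_mul_right hlayer _)) (mul_le_mul_right hstrip2 _)
  have hreal : c * Q + τ * (2 * N * (a + 2 - a) * Q) + C'' * (C₃ * 4 / β * (η + 1 / R) * Q) +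
      C' * (4 * N * β * Q) ≤ c' * Q := by
    have h1 : τ * (2 * N * (a + 2 - a) * Q) ≤ e / 4 * Q := by
      calc _ = τ * (4 * N) * Q := by ring
        _ ≤ _ := by gcongr
    have h2 : C'' * (C₃ * 4 / β * (η + 1 / R) * Q) ≤ e / 4 * Q := by
      have h3 : B * (η + 1 / R) ≤ e / 4 := by
        have h4 : (B + 1) * η = e / 8 := by rw [hη]; field_simp
        have h5 : (B + 1) * (1 / R) ≤ e / 8 := by
          rw [mul_one_div, div_le_iff₀ hR0]; linarith
        have h6 : 0 < 1 / R := by positivity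
        nlinarith
      calc _ = B * (η + 1 / R) * Q := by rw [hB]; ring
        _ ≤ _ := by gcongr
    have h3 : C' * (4 * N * β * Q) ≤ e / 4 * Q := by
      calc _ = C' * (4 * N * β) * Q := by ring
        _ ≤ _ := by gcongr
    have h4 : 0 < e * Q := by positivity
    have h5 : (c' : ℝ) * Q = c * Q + e * Q := by rw [he_def]; ring
    linarith
  have hcontra : ENNReal.ofReal Q * cellEnergy F aplus aminus ν x ≤ ENNReal.ofReal Q * c' := by
    refine hle.trans ((ENNReal.ofReal_le_ofReal hreal).trans (le_of_eq ?_))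
    rw [mul_comm, ENNReal.ofReal_mul hQ0.le, ENNReal.ofReal_coe_nnreal]
  have := (ENNReal.mul_le_mul_iff_right (by simpa using hQ0) ENNReal.ofReal_ne_top).1 hcontra
  exact absurd hc' (not_lt.2 this)

end CellBound

/-- A one-sided generalised dominated convergence theorem. -/
theorem le_lintegral_of_tendsto {α : Type*} [MeasurableSpace α] {μ : Measure α}
    {u h : ℕ → α → ℝ≥0∞} {f G : α → ℝ≥0∞} (hu : ∀ k, AEMeasurable (u k) μ)
    (hh : ∀ k, AEMeasurable (h k) μ) (hG : ∫⁻ a, G a ∂μ ≠ ⊤)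
    (hle : ∀ k, ∀ᵐ a ∂μ, u k a ≤ G a + h k a) (huf : ∀ᵐ a ∂μ, Tendsto (fun k => u k a) atTop (𝓝 (f a)))
    (hf : ∀ᵐ a ∂μ, f a ≠ ⊤)
    (hh0 : ∀ᵐ a ∂μ, Tendsto (fun k => h k a) atTop (𝓝 0))
    (hint : Tendsto (fun k => ∫⁻ a, h k a ∂μ) atTop (𝓝 0)) {c : ℝ≥0∞}
    (hc : ∀ᶠ k in atTop, c ≤ ∫⁻ a, u k a ∂μ) : c ≤ ∫⁻ a, f a ∂μ := by
  -- The truncated difference is dominated by the integrable G, and adding back the vanishing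
  -- integrals of h k restores the lower bound.
  have h1 : Tendsto (fun k => ∫⁻ a, (u k a - h k a) ∂μ) atTop (𝓝 (∫⁻ a, f a ∂μ)) := by
    refine tendsto_lintegral_of_dominated_convergence' G (fun k => (hu k).sub (hh k)) ?_ hG ?_
    · intro k
      filter_upwards [hle k] with a ha using tsub_le_iff_right.2 ha
    · filter_upwards [huf, hh0, hf] with a h1 h2 h3
      simpa using ENNReal.Tendsto.sub h1 h2 (Or.inl h3)
  have h2 := h1.add hint
  rw [add_zero] at h2
  refine ge_of_tendsto h2 ?_
  filter_upwards [hc] with k hk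
  refine hk.trans ?_
  rw [← lintegral_add_right' _ (hh k)]
  exact lintegral_mono fun a => le_tsub_add

theorem aestronglyMeasurable_pi {α ι : Type*} [Fintype ι] {E : ι → Type*}
    [∀ i, NormedAddCommGroup (E i)] [MeasurableSpace α] {μ : Measure α} {f : α → (i : ι) → E i}
    (hf : ∀ i, AEStronglyMeasurable (fun a => f a i) μ) : AEStronglyMeasurable f μ := by
  classical
  have h : f = fun a => ∑ i, Pi.single i (f a i) := by
    funext a
    exact (Finset.univ_sum_single (f a)).symm
  rw [h]
  exact Finset.aestronglyMeasurable_fun_sum _ fun i _ =>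
    (continuous_single i).comp_aestronglyMeasurable (hf i)

theorem aestronglyMeasurable_of_continuous {N : ℕ} {W : Type*} [NormedAddCommGroup W]
    {μ : Measure (Vec N)} {f : Vec N → W} (hf : Continuous f) : AEStronglyMeasurable f μ :=
  haveI := secondCountableTopologyEither_of_left (Vec N) W
  hf.aestronglyMeasurable

/-! ### Approximating the energy of Sobolev maps by smooth maps -/

section WeakCellBound

variable {N m n : ℕ}

/-- The rescaled jet of weak derivatives which enters the energy. -/
noncomputable def weakJet (Ω : Set (Vec N)) (n : ℕ) (ε : ℝ) (f : Vec N → Vec m) (z : Vec N) :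
    Jet N m n :=
  fun j => ε ^ ((j : ℕ) + 1) • weakGrad Ω ((j : ℕ) + 1) f z

/-- The jet of `u` at scale `ε`. -/
noncomputable def scaledJet (n : ℕ) (ε : ℝ) (u : Vec N → Vec m) (z : Vec N) : Jet N m n :=
  fun j => ε ^ ((j : ℕ) + 1) • iteratedFDeriv ℝ ((j : ℕ) + 1) u z

theorem jet_comp_add_smul {u : Vec N → Vec m} (hu : ContDiff ℝ ∞ u) (y : Vec N) (ε : ℝ) (z : Vec N) :
    jet n (fun z => u (y + ε • z)) z = scaledJet n ε u (y + ε • z) := by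
  funext j
  have h1 : ContDiff ℝ (((j : ℕ) + 1 : ℕ) : ℕ∞ω) (fun z => u (y + z)) :=
    (hu.comp (by fun_prop)).of_le (by exact_mod_cast le_top)
  have h2 := congrFun (iteratedFDeriv_comp_const_smul ε h1) z
  simp only [jet, scaledJet]
  rw [h2, iteratedFDeriv_comp_add_left]

theorem continuous_scaledJet {u : Vec N → Vec m} (hu : ContDiff ℝ ∞ u) (ε : ℝ) :
    Continuous (scaledJet n ε u) :=
  continuous_pi fun j =>
    (hu.continuous_iteratedFDeriv (m := (j : ℕ) + 1) (by exact_mod_cast le_top)).const_smul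
      (ε ^ ((j : ℕ) + 1))

theorem continuous_powSum {p : ℝ} (hp : 1 ≤ p) :
    Continuous fun q : Jet N m n × Vec m => powSum p q.1 q.2 := by
  unfold powSum
  have hp0 : 0 ≤ p := by linarith
  fun_prop (disch := exact hp0)

theorem ofReal_powSum {p : ℝ} (hp : 0 ≤ p) (A : Jet N m n) (b : Vec m) :
    ENNReal.ofReal (powSum p A b) = (∑ j, ‖A j‖ₑ ^ p) + ‖b‖ₑ ^ p := by
  rw [powSum, ENNReal.ofReal_add (by positivity) (by positivity),
    ENNReal.ofReal_sum_of_nonneg (fun _ _ => by positivity), enorm_rpow_eq b hp]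
  simp_rw [enorm_rpow_eq _ hp]

theorem MemLpLoc.lintegral_lt_top {W : Type*} [NormedAddCommGroup W] {p : ℝ} (hp : 1 ≤ p)
    {Ω K : Set (Vec N)} {f : Vec N → W} (hf : MemLpLoc p Ω f) (hK : IsCompact K) (hKΩ : K ⊆ Ω) :
    ∫⁻ x in K, ‖f x‖ₑ ^ p < ⊤ := by
  have h := (hf K hK hKΩ).eLpNorm_lt_top
  have hp0 : 0 < p := by linarith
  rwa [eLpNorm_lt_top_iff_lintegral_rpow_enorm_lt_top (by simpa using hp0) ENNReal.ofReal_ne_top,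
    ENNReal.toReal_ofReal hp0.le] at h

theorem aestronglyMeasurable_weakGrad {p : ℝ} {Ω K : Set (Vec N)} (hΩ : IsOpen Ω)
    (hK : IsCompact K) (hKΩ : K ⊆ Ω) {f : Vec N → Vec m} (hf : MemSobolevLoc n p Ω f) (j : Fin n) :
    AEStronglyMeasurable (weakGrad Ω ((j : ℕ) + 1) f) (volume.restrict K) :=
  ((weakGrad_spec hΩ hf (by omega) j.2).2 K hK hKΩ).aestronglyMeasurable

theorem aestronglyMeasurable_weakJet {p : ℝ} {Ω K : Set (Vec N)} (hΩ : IsOpen Ω)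
    (hK : IsCompact K) (hKΩ : K ⊆ Ω) {f : Vec N → Vec m} (hf : MemSobolevLoc n p Ω f) (ε : ℝ) :
    AEStronglyMeasurable (weakJet Ω n ε f : Vec N → Jet N m n) (volume.restrict K) :=
  aestronglyMeasurable_pi fun j =>
    (aestronglyMeasurable_weakGrad hΩ hK hKΩ hf j).const_smul (ε ^ ((j : ℕ) + 1))

theorem lintegral_powSum_eq {p : ℝ} (hp : 0 ≤ p) {μ : Measure (Vec N)} (s : Fin n → ℝ)
    {G : Vec N → Jet N m n} {f : Vec N → Vec m}
    (hG : ∀ j, AEStronglyMeasurable (fun z => G z j) μ) (hf : AEStronglyMeasurable f μ)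
    {C : ℝ} (hC : 0 ≤ C) :
    ∫⁻ z, ENNReal.ofReal (C * powSum p (fun j => s j • G z j) (f z)) ∂μ =
      ENNReal.ofReal C * ((∑ j, ‖s j‖ₑ ^ p * ∫⁻ z, ‖G z j‖ₑ ^ p ∂μ) + ∫⁻ z, ‖f z‖ₑ ^ p ∂μ) := by
  have h1 : ∀ z, ENNReal.ofReal (C * powSum p (fun j => s j • G z j) (f z)) =
      ENNReal.ofReal C * ((∑ j, ‖s j‖ₑ ^ p * ‖G z j‖ₑ ^ p) + ‖f z‖ₑ ^ p) := by
    intro z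
    rw [ENNReal.ofReal_mul hC, ofReal_powSum hp]
    simp_rw [enorm_smul, ENNReal.mul_rpow_of_nonneg _ _ hp]
  simp_rw [h1]
  rw [lintegral_const_mul' _ _ ENNReal.ofReal_ne_top,
    lintegral_add_right' _ (hf.enorm.pow_const p),
    lintegral_finsetSum' _ fun j _ => ((hG j).enorm.pow_const p).const_mul _]
  have hne : ∀ j, ‖s j‖ₑ ^ p ≠ ⊤ := fun j => ENNReal.rpow_ne_top_of_nonneg hp (by simp)
  simp_rw [lintegral_const_mul' _ _ (hne _)]

theorem lintegral_powSum_weakJet_ne_top {p : ℝ} (hp : 1 ≤ p) {Ω K : Set (Vec N)} (hΩ : IsOpen Ω)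
    (hK : IsCompact K) (hKΩ : K ⊆ Ω) {f : Vec N → Vec m} (hf : MemSobolevLoc n p Ω f) (ε : ℝ)
    {C : ℝ} (hC : 0 ≤ C) :
    ∫⁻ z in K, ENNReal.ofReal (C * powSum p (weakJet Ω n ε f z : Jet N m n) (f z)) ≠ ⊤ := by
  have hp0 : 0 ≤ p := by linarith
  have h := lintegral_powSum_eq hp0 (μ := volume.restrict K) (fun j : Fin n => ε ^ ((j : ℕ) + 1))
    (G := fun z j => weakGrad Ω ((j : ℕ) + 1) f z) (f := f)
    (aestronglyMeasurable_weakGrad hΩ hK hKΩ hf) (hf.1 K hK hKΩ).aestronglyMeasurable hC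
  refine (h.trans_ne ?_ : _)
  refine ENNReal.mul_ne_top ENNReal.ofReal_ne_top (ENNReal.add_ne_top.2
    ⟨ENNReal.sum_ne_top.2 fun j _ => ENNReal.mul_ne_top
      (ENNReal.rpow_ne_top_of_nonneg hp0 (by simp)) ?_, ?_⟩)
  · exact ((weakGrad_spec hΩ hf (by omega) j.2).2.lintegral_lt_top hp hK hKΩ).ne
  · exact (hf.1.lintegral_lt_top hp hK hKΩ).ne

theorem tendsto_lintegral_powSum_sub {p : ℝ} (hp : 1 ≤ p) {Ω Q : Set (Vec N)}
    {f : Vec N → Vec m} {u : ℕ → Vec N → Vec m} (hu : ∀ k, ContDiff ℝ ∞ (u k))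
    (hf : AEStronglyMeasurable f (volume.restrict Q))
    (hG : ∀ j : Fin n, AEStronglyMeasurable (weakGrad Ω ((j : ℕ) + 1) f) (volume.restrict Q))
    (h0 : Tendsto (fun k => ∫⁻ x in Q, ‖u k x - f x‖ₑ ^ p) atTop (𝓝 0))
    (hj : ∀ j : Fin n, Tendsto (fun k => ∫⁻ x in Q, ‖iteratedFDeriv ℝ ((j : ℕ) + 1) (u k) x -
      weakGrad Ω ((j : ℕ) + 1) f x‖ₑ ^ p) atTop (𝓝 0)) (ε : ℝ) {C : ℝ} (hC : 0 ≤ C) :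
    Tendsto (fun k => ∫⁻ z in Q, ENNReal.ofReal (C *
      powSum p (scaledJet n ε (u k) z - weakJet Ω n ε f z) (u k z - f z))) atTop (𝓝 0) := by
  have hp0 : 0 ≤ p := by linarith
  have h1 : ∀ k, ∫⁻ z in Q, ENNReal.ofReal (C *
      powSum p (scaledJet n ε (u k) z - weakJet Ω n ε f z) (u k z - f z)) =
      ENNReal.ofReal C * ((∑ j : Fin n, ‖ε ^ ((j : ℕ) + 1)‖ₑ ^ p * ∫⁻ z in Q,
        ‖iteratedFDeriv ℝ ((j : ℕ) + 1) (u k) z - weakGrad Ω ((j : ℕ) + 1) f z‖ₑ ^ p) +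
        ∫⁻ z in Q, ‖u k z - f z‖ₑ ^ p) := by
    intro k
    rw [← lintegral_powSum_eq hp0 (fun j : Fin n => ε ^ ((j : ℕ) + 1))
      (G := fun z j => iteratedFDeriv ℝ ((j : ℕ) + 1) (u k) z - weakGrad Ω ((j : ℕ) + 1) f z)
      (f := fun z => u k z - f z) (fun j => ?_)
      ((hu k).continuous.aestronglyMeasurable.sub hf) hC]
    · refine lintegral_congr fun z => ?_
      congr 3
      funext j
      rw [smul_sub]
      rfl
    · have hm : Continuous (iteratedFDeriv ℝ ((j : ℕ) + 1) (u k)) :=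
        (hu k).continuous_iteratedFDeriv (by exact_mod_cast le_top)
      exact (aestronglyMeasurable_of_continuous hm).sub (hG j)
  simp_rw [h1]
  have hne : ∀ j : Fin n, ‖ε ^ ((j : ℕ) + 1)‖ₑ ^ p ≠ ⊤ := fun j =>
    ENNReal.rpow_ne_top_of_nonneg hp0 (by simp)
  have h3 := (tendsto_finsetSum Finset.univ fun (j : Fin n) _ =>
    ENNReal.Tendsto.const_mul (hj j) (Or.inr (hne j))).add h0
  simpa using ENNReal.Tendsto.const_mul h3 (Or.inr (ENNReal.ofReal_ne_top (r := C)))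

/-- Smooth approximation in energy. -/
theorem exists_smooth_energy_approx {p : ℝ} (hp : 1 ≤ p) {F : Jet N m n → Vec m → Vec N → ℝ}
    {x : Vec N} (hF : Continuous fun q : Jet N m n × Vec m => F q.1 q.2 x)
    {C₀ : ℝ} (hC₀ : 0 ≤ C₀)
    (hup : ∀ A b, F A b x ≤ C₀ * ((∑ j, ‖A j‖ ^ p) + ‖b‖ ^ p + 1))
    {Ω K Q : Set (Vec N)} (hΩ : IsOpen Ω)
    (hK : IsCompact K) (hKΩ : K ⊆ Ω) (hQ : MeasurableSet Q) {r : ℝ} (hr : 0 < r)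
    (hQK : ∀ x ∈ Q, Metric.closedBall x r ⊆ K) {f : Vec N → Vec m}
    (hf : MemSobolevLoc n p Ω f) (ε : ℝ) :
    ∃ u : ℕ → Vec N → Vec m, (∀ k, ContDiff ℝ ∞ (u k)) ∧
      Tendsto (fun k => ∫⁻ x in Q, ‖u k x - f x‖ₑ ^ p) atTop (𝓝 0) ∧
      ∀ c : ℝ≥0∞, (∀ᶠ k in atTop, c ≤ ∫⁻ z in Q, ENNReal.ofReal (F (scaledJet n ε (u k) z) (u k z) x)) →
        c ≤ ∫⁻ z in Q, ENNReal.ofReal (F (weakJet Ω n ε f z) (f z) x) := by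
  have hp0 : 0 < p := by linarith
  have hQK' : Q ⊆ K := fun x hx => hQK x hx (Metric.mem_closedBall_self hr.le)
  have hmono : volume.restrict Q ≤ volume.restrict K := Measure.restrict_mono hQK' le_rfl
  obtain ⟨u, hu, hu1, hu2, hu3⟩ := exists_smooth_approx hp hΩ hK hKΩ hQ hr hQK hf
  refine ⟨u, hu, hu1, fun c hc => ?_⟩
  have hmeas : AEStronglyMeasurable f (volume.restrict Q) :=
    (hf.1 K hK hKΩ).aestronglyMeasurable.mono_measure hmono
  have hmeasG : AEStronglyMeasurable (weakJet Ω n ε f : Vec N → Jet N m n) (volume.restrict Q) :=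
    (aestronglyMeasurable_weakJet hΩ hK hKΩ hf ε).mono_measure hmono
  have hjetlim : ∀ᵐ z ∂(volume.restrict Q),
      Tendsto (fun k => scaledJet n ε (u k) z) atTop (𝓝 (weakJet Ω n ε f z)) := by
    have : ∀ᵐ z ∂(volume.restrict Q), ∀ j : Fin n, Tendsto
        (fun k => iteratedFDeriv ℝ ((j : ℕ) + 1) (u k) z) atTop (𝓝 (weakGrad Ω ((j : ℕ) + 1) f z)) :=
      ae_all_iff.2 fun j => (hu3 _ (by omega) j.2).2
    filter_upwards [this] with z hz
    exact tendsto_pi_nhds.2 fun j => (hz j).const_smul _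
  have hC : 0 ≤ C₀ * 2 ^ p := by positivity
  have hPcont : Continuous fun q : Jet N m n × Vec m =>
      ENNReal.ofReal (C₀ * 2 ^ p * powSum p q.1 q.2) :=
    ENNReal.continuous_ofReal.comp (continuous_const.mul (continuous_powSum hp))
  have hpow : ∀ k, AEMeasurable (fun z => ENNReal.ofReal (C₀ * 2 ^ p *
      powSum p (scaledJet n ε (u k) z - weakJet Ω n ε f z) (u k z - f z))) (volume.restrict Q) := by
    intro k
    have h0 : AEStronglyMeasurable (scaledJet n ε (u k)) (volume.restrict Q) :=
      aestronglyMeasurable_of_continuous (continuous_scaledJet (hu k) ε)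
    exact (hPcont.comp_aestronglyMeasurable ((h0.sub hmeasG).prodMk
      ((hu k).continuous.aestronglyMeasurable.sub hmeas))).aemeasurable
  have hsub : ∀ᵐ z ∂(volume.restrict Q), Tendsto (fun k => ENNReal.ofReal (C₀ * 2 ^ p *
      powSum p (scaledJet n ε (u k) z - weakJet Ω n ε f z) (u k z - f z))) atTop (𝓝 0) := by
    filter_upwards [hjetlim, hu2] with z h1 h2
    have h3 : Tendsto (fun k => (scaledJet n ε (u k) z - weakJet Ω n ε f z, u k z - f z)) atTop
        (𝓝 ((0 : Jet N m n), (0 : Vec m))) := by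
      have h4 := h1.sub_const (weakJet Ω n ε f z)
      have h5 := h2.sub_const (f z)
      rw [sub_self] at h4 h5
      exact h4.prodMk_nhds h5
    have h6 : ENNReal.ofReal (C₀ * 2 ^ p * powSum p (0 : Jet N m n) (0 : Vec m)) = 0 := by
      simp [powSum, Real.zero_rpow hp0.ne']
    have h7 := Tendsto.comp (hPcont.tendsto (0, 0)) h3
    simp only [h6] at h7
    exact h7
  have hGfin : ∫⁻ z in Q, (ENNReal.ofReal (C₀ * 2 ^ p * powSum p (weakJet Ω n ε f z) (f z)) +
      ENNReal.ofReal C₀) ≠ ⊤ := by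
    refine ((lintegral_mono_set hQK').trans_lt ?_).ne
    rw [lintegral_add_right _ measurable_const, setLIntegral_const]
    have h1 : ∫⁻ z in K, ENNReal.ofReal (C₀ * 2 ^ p * powSum p (weakJet Ω n ε f z : Jet N m n) (f z))
        ≠ ⊤ := lintegral_powSum_weakJet_ne_top hp hΩ hK hKΩ hf ε hC
    have h2 : ENNReal.ofReal C₀ * volume K ≠ ⊤ :=
      ENNReal.mul_ne_top ENNReal.ofReal_ne_top hK.measure_lt_top.ne
    exact (ENNReal.add_ne_top.2 ⟨h1, h2⟩).lt_top
  -- The growth condition bounds the integrand of u k by a fixed integrable function of f plus a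
  -- multiple of the `powSum` of the difference. That second term depends on k, but its integral
  -- tends to zero.
  refine le_lintegral_of_tendsto
    (u := fun k z => ENNReal.ofReal (F (scaledJet n ε (u k) z) (u k z) x)) (fun k => ?_) hpow hGfin
    (fun k => Eventually.of_forall fun z => ?_) ?_ (by simp) hsub
    (tendsto_lintegral_powSum_sub hp hu hmeas (fun j =>
      (aestronglyMeasurable_weakGrad hΩ hK hKΩ hf j).mono_measure hmono) hu1
      (fun j => (hu3 _ (by omega) j.2).1) ε hC) hc
  · have h1 : Continuous fun z => F (scaledJet n ε (u k) z) (u k z) x :=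
      hF.comp ((continuous_scaledJet (hu k) ε).prodMk (hu k).continuous)
    exact h1.measurable.ennreal_ofReal.aemeasurable
  · have hP0 := mul_nonneg hC (powSum_nonneg (p := p) (weakJet Ω n ε f z : Jet N m n) (f z))
    have hP1 := mul_nonneg hC (powSum_nonneg (p := p)
      (scaledJet n ε (u k) z - weakJet Ω n ε f z) (u k z - f z))
    rw [← ENNReal.ofReal_add hP0 hC₀, ← ENNReal.ofReal_add (add_nonneg hP0 hC₀) hP1]
    refine ENNReal.ofReal_le_ofReal ((hup _ _).trans ?_)
    have h1 := powSum_add_le hp (weakJet Ω n ε f z) (scaledJet n ε (u k) z - weakJet Ω n ε f z)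
      (f z) (u k z - f z)
    rw [add_sub_cancel, add_sub_cancel] at h1
    have h2 := mul_le_mul_of_nonneg_left h1 hC₀
    have h3 : (∑ j, ‖scaledJet n ε (u k) z j‖ ^ p) + ‖u k z‖ ^ p =
      powSum p (scaledJet n ε (u k) z) (u k z) := rfl
    rw [h3]
    linarith
  · filter_upwards [hjetlim, hu2] with z h1 h2
    have h3 := Tendsto.comp (hF.tendsto (weakJet Ω n ε f z, f z)) (h1.prodMk_nhds h2)
    exact ENNReal.tendsto_ofReal h3

end WeakCellBound

/-! ### Lower bound on a small cube for Sobolev maps -/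

section WeakCellBound

variable {N m n : ℕ} [NeZero N] (ν : OrthonormalBasis (Fin N) ℝ (Vec N))

theorem jump_smul (aplus aminus : Vec m) {ε : ℝ} (hε : 0 < ε) (z : Vec N) :
    jump ν aplus aminus (ε • z) = jump ν aplus aminus z := by
  simp only [jump, inner_smul_left, conj_trivial, mul_pos_iff_of_pos_left hε]

theorem jump_sub_of_inner_eq_zero (aplus aminus : Vec m) (z : Vec N) {w : Vec N}
    (hw : inner ℝ w (ν 0) = (0 : ℝ)) : jump ν aplus aminus (z - w) = jump ν aplus aminus z := by
  simp only [jump, inner_sub_left, hw, sub_zero]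

/-- The open cube of side `ρ` centred at `y`. -/
def boxAt (ν : OrthonormalBasis (Fin N) ℝ (Vec N)) (y : Vec N) (ρ : ℝ) : Set (Vec N) :=
  (fun z => z - y) ⁻¹' box ν (ρ / 2)

omit [NeZero N] in
theorem measurableSet_boxAt (y : Vec N) (ρ : ℝ) : MeasurableSet (boxAt ν y ρ) :=
  ((isOpen_box ν (ρ / 2)).preimage (by fun_prop)).measurableSet

omit [NeZero N] in
theorem preimage_add_smul_boxAt (y : Vec N) {ε : ℝ} (hε : 0 < ε) (ρ : ℝ) :
    (fun z => y + ε • z) ⁻¹' boxAt ν y ρ = box ν (ρ / ε / 2) := by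
  ext z
  simp only [boxAt, box, mem_preimage, mem_ofPred_eq, add_sub_cancel_left, inner_smul_left,
    conj_trivial, abs_mul, abs_of_pos hε]
  refine forall_congr' fun j => ?_
  rw [div_right_comm, lt_div_iff₀' hε]

/-- Lower bound for the energy of a Sobolev map on a cube on which it is close to a jump. -/
theorem exists_weak_cell_lower_bound (hn : 1 ≤ n) {F : Jet N m n → Vec m → Vec N → ℝ} {x : Vec N}
    {p : ℝ} (hp : 1 ≤ p) (hF : Continuous fun q : Jet N m n × Vec m => F q.1 q.2 x)
    {C₀ c₁ : ℝ} (hC₀ : 0 ≤ C₀) (hc₁ : 0 < c₁)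
    (hlow : ∀ A b, c₁ * ‖A ⟨n - 1, Nat.sub_lt hn one_pos⟩‖ ^ p ≤ F A b x)
    (hup : ∀ A b, F A b x ≤ C₀ * ((∑ j, ‖A j‖ ^ p) + ‖b‖ ^ p + 1)) {aplus aminus : Vec m}
    (hplus : F 0 aplus x = 0) (hminus : F 0 aminus x = 0) {c : ℝ≥0}
    (hc : (c : ℝ≥0∞) < cellEnergy F aplus aminus ν x) :
    ∃ η R₀ : ℝ, 0 < η ∧ ∀ (Ω K : Set (Vec N)), IsOpen Ω → IsCompact K → K ⊆ Ω →
      ∀ (f : Vec N → Vec m), MemSobolevLoc n p Ω f → ∀ (y : Vec N) (ρ ε r : ℝ), 0 < ρ → 0 < ε →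
      R₀ ≤ ρ / ε → 0 < r → (∀ z ∈ boxAt ν y ρ, Metric.closedBall z r ⊆ K) →
      ∫⁻ z in boxAt ν y ρ, ‖f z - jump ν aplus aminus (z - y)‖ₑ ^ p ≤ ENNReal.ofReal (η * ρ ^ N) →
      ENNReal.ofReal (c * ρ ^ (N - 1)) ≤ ENNReal.ofReal (1 / ε) *
        ∫⁻ z in boxAt ν y ρ, ENNReal.ofReal (F (weakJet Ω n ε f z) (f z) x) := by
  have hp0 : 0 < p := by linarith
  obtain ⟨η, R₀, hη, h⟩ :=
    exists_cell_lower_bound ν hn hp hF hC₀ hc₁ hlow hup hplus hminus hc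
  -- The triangle inequality costs a factor 2^p, and the remaining half of η is reserved for the
  -- mollification error.
  refine ⟨η / (2 * 2 ^ p), R₀, by positivity, fun Ω K hΩ hK hKΩ f hf y ρ ε r hρ hε hR hr hQK hclose => ?_⟩
  set Q := boxAt ν y ρ with hQdef
  have hQ : MeasurableSet Q := measurableSet_boxAt ν y ρ
  have hQK' : Q ⊆ K := fun x hx => hQK x hx (Metric.mem_closedBall_self hr.le)
  obtain ⟨u, hu, hu1, hlim⟩ := exists_smooth_energy_approx hp hF hC₀ hup hΩ hK hKΩ hQ hr hQK hf ε
  have hρN : 0 < ρ ^ N := by positivity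
  have h2p : (2 : ℝ≥0∞) ^ p = ENNReal.ofReal (2 ^ p) := by
    rw [← ENNReal.ofReal_rpow_of_nonneg (by norm_num) hp0.le]; simp
  have hfmeas : AEStronglyMeasurable f (volume.restrict Q) :=
    (hf.1 K hK hKΩ).aestronglyMeasurable.mono_measure (Measure.restrict_mono hQK' le_rfl)
  have hev : ∀ᶠ k in atTop, ∫⁻ z in Q, ‖u k z - jump ν aplus aminus (z - y)‖ₑ ^ p ≤
      ENNReal.ofReal (η * ρ ^ N) := by
    have hδ : (0 : ℝ≥0∞) < ENNReal.ofReal (η / (2 * 2 ^ p) * ρ ^ N) := by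
      rw [ENNReal.ofReal_pos]; positivity
    filter_upwards [hu1.eventually (gt_mem_nhds hδ)] with k hk
    calc ∫⁻ z in Q, ‖u k z - jump ν aplus aminus (z - y)‖ₑ ^ p
        ≤ ∫⁻ z in Q, 2 ^ p * (‖u k z - f z‖ₑ ^ p + ‖f z - jump ν aplus aminus (z - y)‖ₑ ^ p) := by
          refine lintegral_mono fun z => ?_
          have := enorm_add_rpow_le (u k z - f z) (f z - jump ν aplus aminus (z - y)) hp
          rwa [sub_add_sub_cancel] at this
      _ = 2 ^ p * ((∫⁻ z in Q, ‖u k z - f z‖ₑ ^ p) +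
            ∫⁻ z in Q, ‖f z - jump ν aplus aminus (z - y)‖ₑ ^ p) := by
          rw [lintegral_const_mul' _ _ (ENNReal.rpow_ne_top_of_nonneg hp0.le (by simp)),
            lintegral_add_left']
          exact ((hu k).continuous.aestronglyMeasurable.sub hfmeas).enorm.pow_const p
      _ ≤ 2 ^ p * (ENNReal.ofReal (η / (2 * 2 ^ p) * ρ ^ N) +
            ENNReal.ofReal (η / (2 * 2 ^ p) * ρ ^ N)) := by gcongr
      _ = ENNReal.ofReal (η * ρ ^ N) := by
          rw [← ENNReal.ofReal_add (by positivity) (by positivity), h2p,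
            ← ENNReal.ofReal_mul (by positivity)]
          congr 1
          field_simp
          ring
  have hεN : 0 < ε ^ N := by positivity
  have hscale : ∀ g : Vec N → ℝ≥0∞, ENNReal.ofReal (ε ^ N) *
      ∫⁻ z in box ν (ρ / ε / 2), g (y + ε • z) = ∫⁻ z in Q, g z := by
    intro g
    rw [← preimage_add_smul_boxAt ν y hε ρ]
    exact setLIntegral_comp_add_smul y hε Q g
  have hε0 : ENNReal.ofReal (ε ^ N) ≠ 0 := by simpa using hεN
  -- Blow-up about y by the factor 1/ε gives a cube of side R = ρ/ε, and ε^N · c(ρ/ε)^{N-1} = ε c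
  -- ρ^{N-1}.
  have hfinal : ENNReal.ofReal (ε * (c * ρ ^ (N - 1))) ≤
      ∫⁻ z in Q, ENNReal.ofReal (F (weakJet Ω n ε f z) (f z) x) := by
    refine hlim _ ?_
    filter_upwards [hev] with k hk
    have h1 := h (ρ / ε) hR (fun z => u k (y + ε • z)) ((hu k).comp (by fun_prop)) ?_
    · simp_rw [jet_comp_add_smul (hu k)] at h1
      rw [← hscale fun z => ENNReal.ofReal (F (scaledJet n ε (u k) z) (u k z) x)]
      refine le_trans (le_of_eq ?_) (mul_le_mul_right h1 _)
      rw [← ENNReal.ofReal_mul hεN.le]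
      congr 1
      have : ε ^ N = ε * ε ^ (N - 1) := by rw [← pow_succ', Nat.sub_add_cancel NeZero.one_le]
      rw [this, div_pow]
      field_simp
    · rw [← ENNReal.mul_le_mul_iff_right hε0 ENNReal.ofReal_ne_top]
      have h2 := hscale fun z => ‖u k z - jump ν aplus aminus (z - y)‖ₑ ^ p
      simp only [add_sub_cancel_left, jump_smul ν aplus aminus hε] at h2
      rw [h2, ← ENNReal.ofReal_mul hεN.le]
      refine hk.trans (ENNReal.ofReal_le_ofReal (le_of_eq ?_))
      rw [div_pow]
      field_simp
  refine le_trans (le_of_eq ?_) (mul_le_mul_right hfinal _)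
  rw [← ENNReal.ofReal_mul (by positivity)]
  congr 1
  field_simp

end WeakCellBound

/-! ### Averaging over tangential translations of a cube -/

section Averaging

variable {N : ℕ} [NeZero N] (ν : OrthonormalBasis (Fin N) ℝ (Vec N))

/-- The indices of the tangential directions. -/
def tangentIndex (i : Fin (N - 1)) : Fin N := ⟨i + 1, by omega⟩

theorem tangentIndex_ne_zero (i : Fin (N - 1)) : tangentIndex i ≠ (0 : Fin N) := by
  intro h
  have := congrArg Fin.val h
  simp [tangentIndex] at this

omit [NeZero N] in
theorem tangentIndex_injective : Function.Injective (tangentIndex (N := N)) := by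
  intro i j h
  have := congrArg Fin.val h
  simp [tangentIndex] at this
  exact Fin.ext this

/-- The isometric parametrisation of the hyperplane orthogonal to the first basis vector. -/
noncomputable def tangent (ν : OrthonormalBasis (Fin N) ℝ (Vec N)) (t : Vec (N - 1)) : Vec N :=
  ∑ i, t i • ν (tangentIndex i)

omit [NeZero N] in
theorem continuous_tangent : Continuous (tangent ν) := by
  unfold tangent
  fun_prop

theorem inner_tangent_zero (t : Vec (N - 1)) : inner ℝ (tangent ν t) (ν 0) = (0 : ℝ) := by
  simp [tangent, sum_inner, inner_smul_left, ν.inner_eq_ite, tangentIndex_ne_zero]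

omit [NeZero N] in
theorem inner_tangent (t : Vec (N - 1)) (i : Fin (N - 1)) :
    inner ℝ (tangent ν t) (ν (tangentIndex i)) = t i := by
  simp [tangent, sum_inner, inner_smul_left, ν.inner_eq_ite, tangentIndex_injective.eq_iff]

omit [NeZero N] in
theorem norm_tangent (t : Vec (N - 1)) : ‖tangent ν t‖ = ‖t‖ := by
  have h : ‖tangent ν t‖ ^ 2 = ‖t‖ ^ 2 := by
    rw [← real_inner_self_eq_norm_sq, EuclideanSpace.norm_sq_eq]
    conv_lhs => enter [3]; rw [tangent]
    simp only [inner_sum, inner_smul_right, inner_tangent, Real.norm_eq_abs, sq_abs]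
    exact Finset.sum_congr rfl fun i _ => (sq _).symm
  exact (sq_eq_sq₀ (norm_nonneg _) (norm_nonneg _)).1 h

omit [NeZero N] in
theorem norm_le_of_mem_box {a : ℝ} {z : Vec N} (hz : z ∈ box ν a) : ‖z‖ ≤ N * a := by
  rw [← ν.sum_repr' z]
  refine (norm_sum_le _ _).trans ?_
  calc _ ≤ ∑ _j : Fin N, a := Finset.sum_le_sum fun j _ => by
        rw [norm_smul, ν.norm_eq_one, mul_one, real_inner_comm]
        exact (hz j).le
    _ = N * a := by simp

omit [NeZero N] in
theorem volume_setOf_mem_boxAt_le (x z : Vec N) {ρ : ℝ} (hρ : 0 ≤ ρ) :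
    volume {t : Vec (N - 1) | z ∈ boxAt ν (x + tangent ν t) ρ} ≤ ENNReal.ofReal (ρ ^ (N - 1)) := by
  let μ := EuclideanSpace.basisFun (Fin (N - 1)) ℝ
  let s : Fin (N - 1) → ℝ := fun i => inner ℝ (z - x) (ν (tangentIndex i))
  calc _ ≤ volume {t : Vec (N - 1) | ∀ i, inner ℝ t (μ i) ∈ Ioo (s i - ρ / 2) (s i + ρ / 2)} := by
        refine measure_mono fun t ht i => ?_
        have h1 : |inner ℝ (z - (x + tangent ν t)) (ν (tangentIndex i))| < ρ / 2 := ht (tangentIndex i)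
        rw [← sub_sub, inner_sub_left, inner_tangent, abs_lt] at h1
        have h2 : inner ℝ t (μ i) = t i := by
          simp [μ, EuclideanSpace.inner_single_right]
        rw [h2]
        constructor <;> simp only [s] <;> linarith [h1.1, h1.2]
    _ = ∏ i : Fin (N - 1), volume (Ioo (s i - ρ / 2) (s i + ρ / 2)) :=
        volume_setOf_inner_mem μ _ fun i => measurableSet_Ioo
    _ = ∏ _i : Fin (N - 1), ENNReal.ofReal ρ := by
        refine Finset.prod_congr rfl fun i _ => ?_
        rw [Real.volume_Ioo]
        congr 1; ring
    _ ≤ _ := by rw [Finset.prod_const, Finset.card_univ, Fintype.card_fin, ENNReal.ofReal_pow hρ]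

omit [NeZero N] in
-- Integrate the bound over the translations t and exchange the integrals: each z lies in the
-- translated cube only for t in a set of measure at most ρ^{N-1}, which cancels the same power on
-- the left. This replaces a packing of the disc by disjoint cubes.
theorem mul_volume_ball_le_of_forall_boxAt {x : Vec N} {K : Set (Vec N)}
    {G : Vec N → ℝ≥0∞} (hG : AEMeasurable G (volume.restrict K)) {ρ s : ℝ} (hρ : 0 < ρ)
    (hK : ∀ t ∈ Metric.ball (0 : Vec (N - 1)) s, boxAt ν (x + tangent ν t) ρ ⊆ K) {c : ℝ≥0}
    {κ : ℝ≥0∞} (hκ : κ ≠ ⊤)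
    (h : ∀ t ∈ Metric.ball (0 : Vec (N - 1)) s,
      ENNReal.ofReal (c * ρ ^ (N - 1)) ≤ κ * ∫⁻ z in boxAt ν (x + tangent ν t) ρ, G z) :
    c * volume (Metric.ball (0 : Vec (N - 1)) s) ≤ κ * ∫⁻ z in K, G z := by
  have hQ0 : 0 < ρ ^ (N - 1) := by positivity
  set B := Metric.ball (0 : Vec (N - 1)) s
  have hS : MeasurableSet {q : Vec (N - 1) × Vec N | q.2 ∈ boxAt ν (x + tangent ν q.1) ρ} := by
    have : {q : Vec (N - 1) × Vec N | q.2 ∈ boxAt ν (x + tangent ν q.1) ρ} =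
        (fun q : Vec (N - 1) × Vec N => q.2 - (x + tangent ν q.1)) ⁻¹' box ν (ρ / 2) := rfl
    rw [this]
    have := continuous_tangent ν
    exact ((isOpen_box ν (ρ / 2)).preimage (by fun_prop)).measurableSet
  set S := {q : Vec (N - 1) × Vec N | q.2 ∈ boxAt ν (x + tangent ν q.1) ρ}
  have hmeas : AEMeasurable (Function.uncurry fun (t : Vec (N - 1)) (z : Vec N) =>
      S.indicator (fun q => G q.2) (t, z)) ((volume.restrict B).prod (volume.restrict K)) := by
    have : (Function.uncurry fun (t : Vec (N - 1)) (z : Vec N) =>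
        S.indicator (fun q => G q.2) (t, z)) = S.indicator (fun q => G q.2) := rfl
    rw [this]
    exact AEMeasurable.indicator (hG.comp_snd) hS
  have h1 : ∀ t ∈ B, ENNReal.ofReal (c * ρ ^ (N - 1)) ≤
      κ * ∫⁻ z in K, S.indicator (fun q => G q.2) (t, z) := by
    intro t ht
    refine (h t ht).trans (mul_le_mul_right (le_of_eq ?_) _)
    have h2 : ∀ z, S.indicator (fun q => G q.2) (t, z) =
        (boxAt ν (x + tangent ν t) ρ).indicator G z := fun z => rfl
    simp_rw [h2]
    rw [setLIntegral_indicator (measurableSet_boxAt ν _ _), inter_eq_self_of_subset_left (hK t ht)]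
  have h2 : ENNReal.ofReal (c * ρ ^ (N - 1)) * volume B ≤
      κ * ∫⁻ z in K, ENNReal.ofReal (ρ ^ (N - 1)) * G z := by
    calc _ = ∫⁻ _t in B, ENNReal.ofReal (c * ρ ^ (N - 1)) := by rw [setLIntegral_const]
      _ ≤ ∫⁻ t in B, κ * ∫⁻ z in K, S.indicator (fun q => G q.2) (t, z) :=
          setLIntegral_mono' measurableSet_ball h1
      _ = κ * ∫⁻ z in K, ∫⁻ t in B, S.indicator (fun q => G q.2) (t, z) := by
          rw [lintegral_const_mul' _ _ hκ, lintegral_lintegral_swap hmeas]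
      _ ≤ _ := by
          refine mul_le_mul_right (lintegral_mono fun z => ?_) _
          have hSz : MeasurableSet {t : Vec (N - 1) | z ∈ boxAt ν (x + tangent ν t) ρ} :=
            measurable_prodMk_right (y := z) hS
          have h3 : ∀ t, S.indicator (fun q => G q.2) (t, z) =
            {t : Vec (N - 1) | z ∈ boxAt ν (x + tangent ν t) ρ}.indicator (fun _ => G z) t :=
            fun t => rfl
          simp_rw [h3]
          rw [lintegral_indicator_const hSz, mul_comm]
          exact mul_le_mul_left ((Measure.restrict_apply_le _ _).trans
            (volume_setOf_mem_boxAt_le ν x z hρ.le)) _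
  rw [lintegral_const_mul' _ _ ENNReal.ofReal_ne_top, mul_comm (c : ℝ), ENNReal.ofReal_mul hQ0.le,
    ENNReal.ofReal_coe_nnreal, mul_assoc, mul_left_comm κ] at h2
  exact (ENNReal.mul_le_mul_iff_right (by simpa using hQ0) ENNReal.ofReal_ne_top).1 h2

end Averaging

/-! ### Consequences of the one-sided limits -/

section OneSided

variable {N m : ℕ}

theorem isOpen_halfBall (x v : Vec N) (ρ : ℝ) : IsOpen (halfBall x v ρ) :=
  Metric.isOpen_ball.inter (isOpen_lt (f := fun _ => (0 : ℝ)) (g := fun y => inner ℝ (y - x) v)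
    continuous_const (by fun_prop))

theorem ball_subset_halfBall {x v : Vec N} (hv : ‖v‖ = 1) (ρ : ℝ) :
    Metric.ball (x + (ρ / 2) • v) (ρ / 2) ⊆ halfBall x v ρ := by
  intro y hy
  have hy' : ‖y - (x + (ρ / 2) • v)‖ < ρ / 2 := by rwa [← dist_eq_norm]
  have hρ : 0 < ρ / 2 := (norm_nonneg _).trans_lt hy'
  have hdec : y - x = (y - (x + (ρ / 2) • v)) + (ρ / 2) • v := by abel
  refine ⟨?_, ?_⟩
  · rw [Metric.mem_ball, dist_eq_norm, hdec]
    refine (norm_add_le _ _).trans_lt ?_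
    rw [norm_smul, hv, Real.norm_eq_abs, abs_of_pos hρ]
    linarith
  · have h1 := (abs_le.1 (abs_real_inner_le_norm (y - (x + (ρ / 2) • v)) v)).1
    rw [hdec, inner_add_left, inner_smul_left, real_inner_self_eq_norm_sq, hv]
    simp only [conj_trivial]
    rw [hv] at h1
    linarith

/-- A one-sided limit of zeros is a zero. -/
theorem eq_zero_of_hasOneSidedLimit {p : ℝ} (hp : 1 ≤ p) {f : Vec m → Vec N → ℝ}
    (hf : Continuous fun q : Vec m × Vec N => f q.1 q.2) {Ω : Set (Vec N)} (hΩ : IsOpen Ω)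
    {φ : Vec N → Vec m} (hφ : ∀ᵐ x ∂(volume.restrict Ω), f (φ x) x = 0) {x v : Vec N} (hx : x ∈ Ω)
    (hv : ‖v‖ = 1) {a : Vec m} (hlim : HasOneSidedLimit p φ x v a) : f a x = 0 := by
  have hp0 : 0 < p := by linarith
  by_contra hne
  have hopen : IsOpen {q : Vec m × Vec N | f q.1 q.2 ≠ 0} := isOpen_ne_fun hf continuous_const
  obtain ⟨δ, hδ, hball⟩ := Metric.isOpen_iff.1 hopen (a, x) hne
  obtain ⟨r, hr, hrΩ⟩ := Metric.isOpen_iff.1 hΩ x hx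
  -- If f(a, x) ≠ 0, continuity forces |φ - a| ≥ δ almost everywhere on small half balls. Each
  -- contains a ball of half the radius, so the averages stay above δ^p · 2^{-N} and cannot tend to
  -- zero.
  have hpos : (0 : ℝ≥0∞) < ENNReal.ofReal (δ ^ p) * ENNReal.ofReal ((1 / 2) ^ N) :=
    ENNReal.mul_pos (by simp; positivity) (by simp)
  have h1 : ∀ᶠ ρ : ℝ in 𝓝[>] 0, ρ < min δ r :=
    mem_nhdsWithin_of_mem_nhds (gt_mem_nhds (lt_min hδ hr))
  obtain ⟨ρ, hρ1, hρ2, hρ0⟩ :=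
    ((Tendsto.eventually hlim (gt_mem_nhds hpos)).and (h1.and self_mem_nhdsWithin)).exists
  have hρ0 : 0 < ρ := hρ0
  have hvol : volume (Metric.ball (x + (ρ / 2) • v) (ρ / 2)) =
      ENNReal.ofReal ((1 / 2) ^ N) * volume (Metric.ball x ρ) := by
    have h2 : ρ / 2 = 1 / 2 * ρ := by ring
    rw [h2, Measure.addHaar_ball_mul_of_pos _ _ (by norm_num), finrank_euclideanSpace_fin,
      Measure.addHaar_ball_center volume x]
  refine absurd hρ1 (not_lt.2 ?_)
  rw [ENNReal.le_div_iff_mul_le (Or.inl (Metric.measure_ball_pos _ _ hρ0).ne')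
    (Or.inl measure_ball_lt_top.ne), mul_assoc, ← hvol]
  calc _ ≤ ENNReal.ofReal (δ ^ p) * volume (halfBall x v ρ) := by
        gcongr
        exact ball_subset_halfBall hv ρ
    _ = ∫⁻ _y in halfBall x v ρ, ENNReal.ofReal (δ ^ p) := by rw [setLIntegral_const]
    _ ≤ _ := by
        refine lintegral_mono_ae ?_
        have hsub : halfBall x v ρ ⊆ Ω := fun y hy =>
          hrΩ (Metric.ball_subset_ball (hρ2.le.trans (min_le_right _ _)) hy.1)
        filter_upwards [ae_restrict_of_ae_restrict_of_subset hsub hφ,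
          ae_restrict_mem (isOpen_halfBall x v ρ).measurableSet] with y hy hyb
        refine ENNReal.ofReal_le_ofReal (Real.rpow_le_rpow hδ.le ?_ hp0.le)
        by_contra! hlt
        refine hball (a := (φ y, y)) ?_ hy
        rw [Metric.mem_ball, Prod.dist_eq]
        refine max_lt ?_ ((Metric.mem_ball.1 hyb.1).trans (hρ2.trans_le (min_le_left _ _)))
        rwa [dist_eq_norm]

theorem HasOneSidedLimit.eventually_le [NeZero N] {p : ℝ} (hp : 1 ≤ p) {φ : Vec N → Vec m}
    {x v : Vec N} {a : Vec m} (hlim : HasOneSidedLimit p φ x v a) {δ : ℝ} (hδ : 0 < δ) :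
    ∀ᶠ r : ℝ in 𝓝[>] 0, ∫⁻ y in halfBall x v r, ‖φ y - a‖ₑ ^ p ≤ ENNReal.ofReal (δ * r ^ N) := by
  have hV : volume (Metric.ball (0 : Vec N) 1) ≠ 0 := (Metric.measure_ball_pos _ _ one_pos).ne'
  have hV' : volume (Metric.ball (0 : Vec N) 1) ≠ ⊤ := measure_ball_lt_top.ne
  have hpos : 0 < ENNReal.ofReal δ / volume (Metric.ball (0 : Vec N) 1) :=
    ENNReal.div_pos (by simpa using hδ) hV'
  filter_upwards [Tendsto.eventually hlim (gt_mem_nhds hpos), self_mem_nhdsWithin] with r hr hr0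
  have hr0 : 0 < r := hr0
  have hvol : volume (Metric.ball x r) =
      ENNReal.ofReal (r ^ N) * volume (Metric.ball (0 : Vec N) 1) := by
    rw [Measure.addHaar_ball_of_pos _ _ hr0, finrank_euclideanSpace_fin]
  have h1 := (ENNReal.div_le_iff_le_mul (Or.inl (Metric.measure_ball_pos _ _ hr0).ne')
    (Or.inl measure_ball_lt_top.ne)).1 hr.le
  simp_rw [enorm_rpow_eq _ (by linarith : 0 ≤ p)]
  refine h1.trans (le_of_eq ?_)
  rw [hvol, mul_left_comm, ENNReal.div_mul_cancel hV hV', mul_comm δ,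
    ENNReal.ofReal_mul (by positivity)]

theorem volume_setOf_inner_sub_eq_zero [NeZero N] (ν : OrthonormalBasis (Fin N) ℝ (Vec N))
    (x : Vec N) : volume {y : Vec N | inner ℝ (y - x) (ν 0) = (0 : ℝ)} = 0 := by
  have h1 := volume_setOf_inner_mem ν (fun j => if j = 0 then {inner ℝ x (ν 0)} else univ)
    (fun j => by split_ifs; exacts [measurableSet_singleton _, MeasurableSet.univ])
  rw [Finset.prod_eq_zero (Finset.mem_univ 0) (by simp)] at h1
  refine measure_mono_null (fun y hy => ?_) h1
  rw [mem_ofPred_eq]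
  intro j
  split_ifs with hj
  · subst hj
    have hy : inner ℝ (y - x) (ν 0) = (0 : ℝ) := hy
    rw [inner_sub_left, sub_eq_zero] at hy
    exact hy
  · trivial

/-- The two half balls fill the ball up to a piece of hyperplane, which is a null set. -/
theorem eventually_lintegral_sub_jump_le [NeZero N] (ν : OrthonormalBasis (Fin N) ℝ (Vec N))
    {p : ℝ} (hp : 1 ≤ p) {φ : Vec N → Vec m} {x : Vec N} {aplus aminus : Vec m}
    (hplus : HasOneSidedLimit p φ x (ν 0) aplus) (hminus : HasOneSidedLimit p φ x (-ν 0) aminus)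
    {δ : ℝ} (hδ : 0 < δ) : ∀ᶠ r : ℝ in 𝓝[>] 0,
      ∫⁻ y in Metric.ball x r, ‖φ y - jump ν aplus aminus (y - x)‖ₑ ^ p ≤
        ENNReal.ofReal (δ * r ^ N) := by
  filter_upwards [hplus.eventually_le hp (half_pos hδ), hminus.eventually_le hp (half_pos hδ),
    self_mem_nhdsWithin] with r h1 h2 hr
  have hr : 0 < r := hr
  have hsub : Metric.ball x r ⊆ (halfBall x (ν 0) r ∪ halfBall x (-ν 0) r) ∪
      {y : Vec N | inner ℝ (y - x) (ν 0) = (0 : ℝ)} := by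
    intro y hy
    rcases lt_trichotomy (inner ℝ (y - x) (ν 0) : ℝ) 0 with h | h | h
    · exact Or.inl (Or.inr ⟨hy, by rw [inner_neg_right]; linarith⟩)
    · exact Or.inr h
    · exact Or.inl (Or.inl ⟨hy, h⟩)
  have h3 : ∫⁻ y in halfBall x (ν 0) r, ‖φ y - jump ν aplus aminus (y - x)‖ₑ ^ p =
      ∫⁻ y in halfBall x (ν 0) r, ‖φ y - aplus‖ₑ ^ p :=
    setLIntegral_congr_fun (isOpen_halfBall _ _ _).measurableSet fun y hy => by
      simp only [jump, if_pos hy.2]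
  have h4 : ∫⁻ y in halfBall x (-ν 0) r, ‖φ y - jump ν aplus aminus (y - x)‖ₑ ^ p =
      ∫⁻ y in halfBall x (-ν 0) r, ‖φ y - aminus‖ₑ ^ p :=
    setLIntegral_congr_fun (isOpen_halfBall _ _ _).measurableSet fun y hy => by
      have := hy.2
      rw [inner_neg_right] at this
      simp only [jump, if_neg (by linarith : ¬ (0 < (inner ℝ (y - x) (ν 0) : ℝ)))]
  calc _ ≤ ∫⁻ y in (halfBall x (ν 0) r ∪ halfBall x (-ν 0) r) ∪
        {y : Vec N | inner ℝ (y - x) (ν 0) = (0 : ℝ)},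
          ‖φ y - jump ν aplus aminus (y - x)‖ₑ ^ p := lintegral_mono_set hsub
    _ ≤ ((∫⁻ y in halfBall x (ν 0) r, ‖φ y - jump ν aplus aminus (y - x)‖ₑ ^ p) +
        ∫⁻ y in halfBall x (-ν 0) r, ‖φ y - jump ν aplus aminus (y - x)‖ₑ ^ p) + 0 := by
        refine (lintegral_union_le _ _ _).trans (add_le_add (lintegral_union_le _ _ _) ?_)
        rw [setLIntegral_measure_zero _ _ (volume_setOf_inner_sub_eq_zero ν x)]
    _ ≤ ENNReal.ofReal (δ / 2 * r ^ N) + ENNReal.ofReal (δ / 2 * r ^ N) := by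
        rw [h3, h4, add_zero]
        exact add_le_add h1 h2
    _ = _ := by
        rw [← ENNReal.ofReal_add (by positivity) (by positivity)]
        congr 1; ring

end OneSided

/-! ### Superadditivity of the lower limit -/

section Liminf

theorem ennreal_liminf_add_le {ι : Type*} {l : Filter ι} (u v : ι → ℝ≥0∞) :
    liminf u l + liminf v l ≤ liminf (fun i => u i + v i) l := by
  rw [liminf_eq_iSup_iInf (u := u), liminf_eq_iSup_iInf (u := v)]
  refine ENNReal.biSup_add_biSup_le' ⟨univ, univ_mem⟩ ⟨univ, univ_mem⟩ fun s hs t ht => ?_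
  rw [liminf_eq_iSup_iInf]
  refine le_iSup₂_of_le (s ∩ t) (inter_mem hs ht) (le_iInf₂ fun i hi => ?_)
  exact add_le_add (iInf₂_le i hi.1) (iInf₂_le i hi.2)

end Liminf

/-! ### The density estimate at a point of D -/

section Density

variable {N m n : ℕ} [NeZero N] (ν : OrthonormalBasis (Fin N) ℝ (Vec N))

omit [NeZero N] in
theorem tendsto_lintegral_of_tendstoLpLoc {p : ℝ} (hp : 1 ≤ p) {Ω K : Set (Vec N)}
    {φe : ℝ → Vec N → Vec m} {φ : Vec N → Vec m} (h : TendstoLpLoc p Ω φe φ) (hK : IsCompact K)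
    (hKΩ : K ⊆ Ω) :
    Tendsto (fun ε => ∫⁻ x in K, ‖φe ε x - φ x‖ₑ ^ p) (𝓝[>] 0) (𝓝 0) := by
  have hp0 : 0 < p := by linarith
  have h1 := (ENNReal.continuous_rpow_const (y := p)).tendsto 0 |>.comp (h K hK hKΩ)
  rw [ENNReal.zero_rpow_of_pos hp0] at h1
  refine h1.congr fun ε => ?_
  simp only [Function.comp]
  rw [eLpNorm_eq_lintegral_rpow_enorm_toReal (by simpa using hp0) ENNReal.ofReal_ne_top,
    ENNReal.toReal_ofReal hp0.le, ← ENNReal.rpow_mul, one_div, inv_mul_cancel₀ hp0.ne',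
    ENNReal.rpow_one]

/-- One parameter t governs both losses in the density estimate: 1 - t from freezing x, and (1 -
Nt)^{N-1} from shrinking the disc so that cubes of side tr stay in the ball. -/
theorem exists_shrink_lt (N : ℕ) {c c' : ℝ≥0} (h : c < c') :
    ∃ t : ℝ, 0 < t ∧ t < 1 ∧ N * t < 1 ∧ (c : ℝ) ≤ (1 - t) * ((1 - N * t) ^ (N - 1) * c') := by
  have h1 : Continuous fun t : ℝ => (1 - t) * ((1 - N * t) ^ (N - 1) * c') := by fun_prop
  have h2 : ∀ᶠ t : ℝ in 𝓝[>] 0, (c : ℝ) < (1 - t) * ((1 - N * t) ^ (N - 1) * c') :=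
    mem_nhdsWithin_of_mem_nhds (h1.tendsto 0 |>.eventually (lt_mem_nhds (by simpa using h)))
  have h3 : ∀ᶠ t : ℝ in 𝓝[>] 0, t < 1 := mem_nhdsWithin_of_mem_nhds (gt_mem_nhds one_pos)
  have h4 : Continuous fun t : ℝ => N * t := by fun_prop
  have h5 : ∀ᶠ t : ℝ in 𝓝[>] 0, N * t < 1 :=
    mem_nhdsWithin_of_mem_nhds (h4.tendsto 0 |>.eventually (gt_mem_nhds (by simp)))
  obtain ⟨t, ht2, ht3, ht5, ht0⟩ := (h2.and (h3.and (h5.and self_mem_nhdsWithin))).exists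
  exact ⟨t, ht0, ht3, ht5, ht2.le⟩

/-- The asymptotic energy of small balls is at least the cell energy times the area of the disc. -/
theorem eventually_mul_volume_ball_le_liminf (hn : 1 ≤ n) {Ω : Set (Vec N)} (hΩ : IsOpen Ω)
    {F : Jet N m n → Vec m → Vec N → ℝ}
    (hFcont : Continuous fun q : Jet N m n × Vec m × Vec N => F q.1 q.2.1 q.2.2)
    {p : ℝ} (hp : 1 ≤ p) {x : Vec N} (hx : x ∈ Ω)
    {C₀ c₁ : ℝ} (hC₀ : 0 ≤ C₀) (hc₁ : 0 < c₁)
    (hlow : ∀ A b, c₁ * ‖A ⟨n - 1, Nat.sub_lt hn one_pos⟩‖ ^ p ≤ F A b x)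
    (hup : ∀ A b, F A b x ≤ C₀ * ((∑ j, ‖A j‖ ^ p) + ‖b‖ ^ p + 1))
    (hFx : ∀ τ : ℝ, 0 < τ → ∃ α : ℝ, 0 < α ∧ ∀ A b y, ‖y - x‖ < α →
      -τ * F A b x ≤ F A b y - F A b x)
    {φ : Vec N → Vec m} (hφ : MemLp φ (ENNReal.ofReal p) (volume.restrict Ω))
    (hφzero : ∀ᵐ y ∂(volume.restrict Ω), F 0 (φ y) y = 0) {aplus aminus : Vec m}
    (hplus : HasOneSidedLimit p φ x (ν 0) aplus) (hminus : HasOneSidedLimit p φ x (-ν 0) aminus)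
    {φe : ℝ → Vec N → Vec m} (hφe : ∀ ε : ℝ, 0 < ε → MemSobolevLoc n p Ω (φe ε))
    (hφe_tendsto : TendstoLpLoc p Ω φe φ) {c : ℝ≥0}
    (hc : (c : ℝ≥0∞) < cellEnergy F aplus aminus ν x) :
    ∀ᶠ r : ℝ in 𝓝[>] 0, c * volume (Metric.ball (0 : Vec (N - 1)) r) ≤
      liminf (fun ε : ℝ => ENNReal.ofReal (1 / ε) * ∫⁻ z in Metric.closedBall x r,
        ENNReal.ofReal (F (weakJet Ω n ε (φe ε) z) (φe ε z) z)) (𝓝[>] 0) := by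
  have hp0 : 0 < p := by linarith
  have hF0 : Continuous fun q : Vec m × Vec N => F 0 q.1 q.2 :=
    hFcont.comp (continuous_const.prodMk continuous_id)
  have hF1 : Continuous fun q : Jet N m n × Vec m => F q.1 q.2 x :=
    hFcont.comp (continuous_fst.prodMk (continuous_snd.prodMk continuous_const))
  have hzp : F 0 aplus x = 0 := eq_zero_of_hasOneSidedLimit (f := fun b y => F 0 b y) hp hF0 hΩ
    hφzero hx (ν.norm_eq_one 0) hplus
  have hzm : F 0 aminus x = 0 := eq_zero_of_hasOneSidedLimit (f := fun b y => F 0 b y) hp hF0 hΩ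
    hφzero hx (by rw [norm_neg, ν.norm_eq_one]) hminus
  obtain ⟨c₂, hcc₂, hc₂⟩ := ENNReal.lt_iff_exists_nnreal_btwn.1 hc
  obtain ⟨t, ht0, ht1, htN, ht⟩ := exists_shrink_lt N (ENNReal.coe_lt_coe.1 hcc₂)
  obtain ⟨η, R₀, hη, hcell⟩ :=
    exists_weak_cell_lower_bound ν hn hp hF1 hC₀ hc₁ hlow hup hzp hzm hc₂
  obtain ⟨α, hα, hFα⟩ := hFx t ht0
  obtain ⟨r₀, hr₀, hr₀Ω⟩ := Metric.isOpen_iff.1 hΩ x hx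
  -- The error is measured on the whole ball but needed relative to a cube of side tr, hence t^N;
  -- the factor 2 · 2^p splits it between φ_ε - φ and φ - jump.
  set δ : ℝ := η * t ^ N / (2 * 2 ^ p) with hδ
  have hδ0 : 0 < δ := by positivity
  have hsmall : ∀ᶠ r : ℝ in 𝓝[>] 0, r < min α r₀ :=
    mem_nhdsWithin_of_mem_nhds (gt_mem_nhds (lt_min hα hr₀))
  filter_upwards [eventually_lintegral_sub_jump_le ν hp hplus hminus hδ0, hsmall,
    self_mem_nhdsWithin] with r hrj hrs hr
  have hr : 0 < r := hr
  have hN : 0 < (N : ℝ) := by exact_mod_cast NeZero.pos N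
  set K := Metric.closedBall x r with hKdef
  have hK : IsCompact K := isCompact_closedBall x r
  have hKΩ : K ⊆ Ω :=
    (Metric.closedBall_subset_ball (hrs.trans_le (min_le_right _ _))).trans hr₀Ω
  have hBK : Metric.ball x r ⊆ K := Metric.ball_subset_closedBall
  have hρ : 0 < t * r := by positivity
  have hδr : (0 : ℝ≥0∞) < ENNReal.ofReal (δ * r ^ N) := by
    rw [ENNReal.ofReal_pos]; positivity
  have hεR : ∀ᶠ ε : ℝ in 𝓝[>] 0, R₀ ≤ t * r / ε := by
    have : Tendsto (fun ε : ℝ => t * r * ε⁻¹) (𝓝[>] 0) atTop :=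
      tendsto_inv_nhdsGT_zero.const_mul_atTop hρ
    exact this.eventually_ge_atTop R₀
  refine le_liminf_of_le (by isBoundedDefault) ?_
  filter_upwards [(tendsto_lintegral_of_tendstoLpLoc hp hφe_tendsto hK hKΩ).eventually
    (gt_mem_nhds hδr), hεR, self_mem_nhdsWithin] with ε hε1 hεR hε
  have hε : 0 < ε := hε
  have hfe := hφe ε hε
  have hmeas : AEStronglyMeasurable (φe ε) (volume.restrict K) :=
    (hfe.1 K hK hKΩ).aestronglyMeasurable
  have hmeasφ : AEStronglyMeasurable φ (volume.restrict K) :=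
    hφ.aestronglyMeasurable.mono_measure (Measure.restrict_mono hKΩ le_rfl)
  have h2p : (2 : ℝ≥0∞) ^ p = ENNReal.ofReal (2 ^ p) := by
    rw [← ENNReal.ofReal_rpow_of_nonneg (by norm_num) hp0.le]; simp
  have hclose : ∫⁻ z in Metric.ball x r, ‖φe ε z - jump ν aplus aminus (z - x)‖ₑ ^ p ≤
      ENNReal.ofReal (η * (t * r) ^ N) := by
    calc _ ≤ ∫⁻ z in Metric.ball x r,
          2 ^ p * (‖φe ε z - φ z‖ₑ ^ p + ‖φ z - jump ν aplus aminus (z - x)‖ₑ ^ p) := by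
          refine lintegral_mono fun z => ?_
          have := enorm_add_rpow_le (φe ε z - φ z) (φ z - jump ν aplus aminus (z - x)) hp
          rwa [sub_add_sub_cancel] at this
      _ = 2 ^ p * ((∫⁻ z in Metric.ball x r, ‖φe ε z - φ z‖ₑ ^ p) +
            ∫⁻ z in Metric.ball x r, ‖φ z - jump ν aplus aminus (z - x)‖ₑ ^ p) := by
          rw [lintegral_const_mul' _ _ (ENNReal.rpow_ne_top_of_nonneg hp0.le (by simp)),
            lintegral_add_left']
          exact ((hmeas.sub hmeasφ).mono_measure
            (Measure.restrict_mono hBK le_rfl)).enorm.pow_const p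
      _ ≤ 2 ^ p * (ENNReal.ofReal (δ * r ^ N) + ENNReal.ofReal (δ * r ^ N)) := by
          gcongr
          exact (lintegral_mono_set hBK).trans hε1.le
      _ = _ := by
          rw [← ENNReal.ofReal_add (by positivity) (by positivity), h2p,
            ← ENNReal.ofReal_mul (by positivity)]
          congr 1
          rw [hδ, mul_pow]
          field_simp
          ring
  set G : Vec N → ℝ≥0∞ := fun z => ENNReal.ofReal (F (weakJet Ω n ε (φe ε) z) (φe ε z) x) with hG
  have hGmeas : AEMeasurable G (volume.restrict K) :=
    (hF1.comp_aestronglyMeasurable ((aestronglyMeasurable_weakJet hΩ hK hKΩ hfe ε).prodMk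
      hmeas)).aemeasurable.ennreal_ofReal
  -- The centre is within (1 - Nt)r of x and the cube within N tr/2 of its centre. This leaves the
  -- margin N tr/2 needed for mollifying inside the closed ball.
  have hdist : ∀ s ∈ Metric.ball (0 : Vec (N - 1)) ((1 - N * t) * r),
      ∀ z ∈ boxAt ν (x + tangent ν s) (t * r), dist z x < r - N * (t * r / 2) := by
    intro s hs z hz
    have h1 : ‖z - (x + tangent ν s)‖ ≤ N * (t * r / 2) := norm_le_of_mem_box ν hz
    have h2 : ‖tangent ν s‖ < (1 - N * t) * r := by
      rw [norm_tangent]; simpa using hs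
    have h3 : z - x = (z - (x + tangent ν s)) + tangent ν s := by abel
    rw [dist_eq_norm, h3]
    refine (norm_add_le _ _).trans_lt ?_
    linarith
  have hNr : 0 < N * (t * r / 2) := by positivity
  have hdisc := mul_volume_ball_le_of_forall_boxAt ν (x := x) hGmeas hρ (c := c₂)
    (κ := ENNReal.ofReal (1 / ε)) (s := (1 - N * t) * r)
    (fun s hs z hz => (((hdist s hs z hz).trans (by linarith)).le : dist z x ≤ r))
    ENNReal.ofReal_ne_top fun s hs => by
      refine hcell Ω K hΩ hK hKΩ (φe ε) hfe (x + tangent ν s) (t * r) ε (N * (t * r / 2)) hρ hε hεR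
        hNr (fun z hz => ?_) ?_
      · exact Metric.closedBall_subset_closedBall' (by linarith [hdist s hs z hz])
      -- A tangential shift does not change the jump, so one closeness estimate serves every
      -- translated cube.
      · have h1 : ∀ z, jump ν aplus aminus (z - (x + tangent ν s)) =
            jump ν aplus aminus (z - x) := fun z => by
          rw [← sub_sub, jump_sub_of_inner_eq_zero ν _ _ _ (inner_tangent_zero ν s)]
        simp_rw [h1]
        exact (lintegral_mono_set fun z hz => Metric.mem_ball.2
          ((hdist s hs z hz).trans (by linarith))).trans hclose
  have hvol : volume (Metric.ball (0 : Vec (N - 1)) ((1 - N * t) * r)) =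
      ENNReal.ofReal ((1 - N * t) ^ (N - 1)) * volume (Metric.ball (0 : Vec (N - 1)) r) := by
    rw [Measure.addHaar_ball_mul_of_pos _ _ (by linarith), finrank_euclideanSpace_fin]
  have hcmp : ENNReal.ofReal (1 - t) * ∫⁻ z in K, G z ≤
      ∫⁻ z in K, ENNReal.ofReal (F (weakJet Ω n ε (φe ε) z) (φe ε z) z) := by
    rw [← lintegral_const_mul' _ _ ENNReal.ofReal_ne_top]
    refine setLIntegral_mono' measurableSet_closedBall fun z hz => ?_
    rw [hG, ← ENNReal.ofReal_mul (by linarith)]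
    refine ENNReal.ofReal_le_ofReal ?_
    have h1 : ‖z - x‖ < α := by
      rw [← dist_eq_norm]
      exact (Metric.mem_closedBall.1 hz).trans_lt (hrs.trans_le (min_le_left _ _))
    have h2 := hFα (weakJet Ω n ε (φe ε) z) (φe ε z) z h1
    linarith
  have htN' : 0 ≤ (1 - N * t) ^ (N - 1) := pow_nonneg (by linarith) _
  calc (c : ℝ≥0∞) * volume (Metric.ball (0 : Vec (N - 1)) r)
      ≤ ENNReal.ofReal ((1 - t) * ((1 - N * t) ^ (N - 1) * c₂)) *
          volume (Metric.ball (0 : Vec (N - 1)) r) := by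
        gcongr
        rw [← ENNReal.ofReal_coe_nnreal]
        exact ENNReal.ofReal_le_ofReal ht
    _ = ENNReal.ofReal (1 - t) * (c₂ * volume (Metric.ball (0 : Vec (N - 1)) ((1 - N * t) * r))) := by
        rw [hvol, ENNReal.ofReal_mul (by linarith), ENNReal.ofReal_mul htN',
          ENNReal.ofReal_coe_nnreal]
        ring
    _ ≤ ENNReal.ofReal (1 - t) * (ENNReal.ofReal (1 / ε) * ∫⁻ z in K, G z) := by gcongr
    _ = ENNReal.ofReal (1 / ε) * (ENNReal.ofReal (1 - t) * ∫⁻ z in K, G z) := by ring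
    _ ≤ _ := by gcongr

end Density

end SingularPerturbation

/-! ### Conclusion -/

theorem mainTheorem7 (N m n : ℕ) [NeZero N] (hn : 1 ≤ n)
    (Ω : Set (SingularPerturbation.Vec N)) (hΩ : IsOpen Ω)
    (F : SingularPerturbation.Jet N m n → SingularPerturbation.Vec m →
      SingularPerturbation.Vec N → ℝ)
    (hFcont : Continuous (fun q : SingularPerturbation.Jet N m n × SingularPerturbation.Vec m ×
      SingularPerturbation.Vec N => F q.1 q.2.1 q.2.2))
    (hFnonneg : ∀ A b x, 0 ≤ F A b x)
    (g : SingularPerturbation.Vec N → ℝ) (hgcont : Continuous g) (hgpos : ∀ x, 0 < g x)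
    (p : ℝ) (hp : 1 ≤ p)
    (hFlower : ∀ A b x, 1 / g x * ‖A ⟨n - 1, by omega⟩‖ ^ p ≤ F A b x)
    (hFupper : ∀ A b x, F A b x ≤ g x * ((∑ j, ‖A j‖ ^ p) + ‖b‖ ^ p + 1))
    (hFx : ∀ x₀ ∈ Ω, ∀ τ : ℝ, 0 < τ → ∃ α : ℝ, 0 < α ∧ ∀ A b x, ‖x - x₀‖ < α →
      -τ * F A b x₀ ≤ F A b x - F A b x₀)
    (φ : SingularPerturbation.Vec N → SingularPerturbation.Vec m)
    (hφ : MemLp φ (ENNReal.ofReal p) (volume.restrict Ω))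
    (hφzero : ∀ᵐ x ∂(volume.restrict Ω), F 0 (φ x) x = 0)
    (D : Set (SingularPerturbation.Vec N)) (hDΩ : D ⊆ Ω) (hDmeas : MeasurableSet D)
    (hDfin : SigmaFinite ((SingularPerturbation.hausdorff (N - 1)).restrict D))
    (φplus φminus : SingularPerturbation.Vec N → SingularPerturbation.Vec m)
    (normal : SingularPerturbation.Vec N → SingularPerturbation.Vec N)
    (hφplus : Measurable (D.domRestrict φplus)) (hφminus : Measurable (D.domRestrict φminus))
    (hnormal : Measurable (D.domRestrict normal)) (hnormal_unit : ∀ x ∈ D, ‖normal x‖ = 1)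
    (hlimplus : ∀ x ∈ D,
      SingularPerturbation.HasOneSidedLimit p φ x (normal x) (φplus x))
    (hlimminus : ∀ x ∈ D,
      SingularPerturbation.HasOneSidedLimit p φ x (-normal x) (φminus x))
    -- any choice of orthonormal bases whose first vector is the given normal
    (ν : SingularPerturbation.Vec N → OrthonormalBasis (Fin N) ℝ (SingularPerturbation.Vec N))
    (hν : ∀ x ∈ D, ν x 0 = normal x)
    (φe : ℝ → SingularPerturbation.Vec N → SingularPerturbation.Vec m)
    (hφe : ∀ ε : ℝ, 0 < ε → SingularPerturbation.MemSobolevLoc n p Ω (φe ε))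
    (hφe_tendsto : SingularPerturbation.TendstoLpLoc p Ω φe φ) :
    ∫⁻ x in D, SingularPerturbation.cellEnergy F (φplus x) (φminus x) (ν x) x
        ∂(SingularPerturbation.hausdorff (N - 1)) ≤
      liminf (fun ε : ℝ => SingularPerturbation.energy F Ω ε (φe ε)) (𝓝[>] 0) := by
  -- The covering theorem is applied to the lower limit of the localised energies. Monotonicity is
  -- immediate, and superadditivity comes from additivity of the integral and superadditivity of
  -- liminf.
  have h := SingularPerturbation.setLIntegral_hausdorff_le_of_density
    (e := fun A => liminf (fun ε : ℝ => ENNReal.ofReal (1 / ε) * ∫⁻ z in A, ENNReal.ofReal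
      (F (SingularPerturbation.weakJet Ω n ε (φe ε) z) (φe ε z) z)) (𝓝[>] 0))
    (fun A B hAB => liminf_le_liminf (Eventually.of_forall fun ε =>
      mul_le_mul_right (lintegral_mono_set hAB) _))
    (fun A B _ hB hAB => by
      refine (SingularPerturbation.ennreal_liminf_add_le _ _).trans (le_of_eq ?_)
      simp_rw [lintegral_union hB hAB, mul_add])
    (N - 1) hDmeas hΩ hDΩ hDfin
    (fun x => SingularPerturbation.cellEnergy F (φplus x) (φminus x) (ν x) x)
    (fun x hx c hc => SingularPerturbation.eventually_mul_volume_ball_le_liminf (ν x) hn hΩ hFcont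
      hp (hDΩ hx) (hgpos x).le (one_div_pos.2 (hgpos x)) (fun A b => hFlower A b x)
      (fun A b => hFupper A b x) (hFx x (hDΩ hx)) hφ hφzero (by rw [hν x hx]; exact hlimplus x hx)
      (by rw [hν x hx]; exact hlimminus x hx) hφe hφe_tendsto hc)
  exact h
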